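/- A *triangulated torus* is a finite abstract simplicial complex of dimension $2$ in which the link of every vertex is a cycle and whose geometric realization is homeomorphic to the torus $S^1\times S^1$; triangulated tori are considered up to combinatorial isomorphism (bijections of the vertex sets that preserve faces in both directions). A *general position realization* of such a complex $K$ in the $2\times2\times3$-cuboid is an injective map $p$ from the vertex set of $K$ to the integer points $\{0,1,2\}\times\{0,1,2\}\times\{0,1,2,3\}\subset\mathbb{R}^3$ such that no three vertices are mapped to points on a line, no four vertices are mapped to points on a plane, and there are no self-intersections, that is, $\operatorname{conv} p(\sigma)\cap\operatorname{conv} p(\tau)=\operatorname{conv} p(\sigma\cap\tau)$ for all faces $\sigma,\tau$ of $K$. **Theorem.** Up to combinatorial isomorphism there are exactly two triangulated tori, with any number of vertices, that have a general position realization in the $2\times2\times3$-cuboid, and both of them have $8$ vertices. -/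

import Mathlib

/-- The geometric realization of a simplicial complex on a finite vertex set `V`: the points of the
standard simplex in `ℝ^V` (barycentric coordinates) whose support lies in a face. -/
def AbstractSimplicialComplex.geomRealization {V : Type*} [Fintype V]
    (K : AbstractSimplicialComplex V) : Set (V → ℝ) :=
  {x | x ∈ stdSimplex ℝ V ∧ ∃ s ∈ K, ∀ v, x v ≠ 0 → v ∈ s}

/-- The 1-skeleton of the link of `v`: its vertices are the neighbours of `v`, and two of them are
adjacent when they span a triangle together with `v`. -/
def AbstractSimplicialComplex.linkGraph {V : Type*} [DecidableEq V]
    (K : AbstractSimplicialComplex V) (v : V) :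
    SimpleGraph {w : V // w ≠ v ∧ ({v, w} : Finset V) ∈ K} where
  Adj a b := a ≠ b ∧ ({v, a.1, b.1} : Finset V) ∈ K
  symm := ⟨fun a b h => ⟨h.1.symm, by rw [Finset.pair_comm]; exact h.2⟩⟩
  loopless := ⟨fun _ h => h.1 rfl⟩

/-- A triangulated closed surface (not necessarily connected): a simplicial complex of
dimension at most `2` in which the link of every vertex is a cycle. -/
def AbstractSimplicialComplex.IsTriangulatedSurface {V : Type*} [DecidableEq V]
    (K : AbstractSimplicialComplex V) : Prop :=
  (∀ s ∈ K, s.card ≤ 3) ∧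
    ∀ v, ∃ m, 3 ≤ m ∧ Nonempty (K.linkGraph v ≃g SimpleGraph.cycleGraph m)

/-- A triangulated torus: a triangulated surface whose geometric realization is homeomorphic
to the torus `S¹ × S¹`. -/
def AbstractSimplicialComplex.IsTriangulatedTorus {V : Type*} [Fintype V] [DecidableEq V]
    (K : AbstractSimplicialComplex V) : Prop :=
  K.IsTriangulatedSurface ∧ Nonempty (K.geomRealization ≃ₜ Circle × Circle)

/-- Combinatorial isomorphism of simplicial complexes. -/
def AbstractSimplicialComplex.Isomorphic {V W : Type*}
    (K : AbstractSimplicialComplex V) (L : AbstractSimplicialComplex W) : Prop :=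
  ∃ e : V ≃ W, ∀ s : Finset V, s ∈ K ↔ s.map e.toEmbedding ∈ L

/-- A linear realization in `ℝ³`: distinct vertices go to distinct points, every face
spans a nondegenerate simplex, and two such simplices meet exactly in the simplex spanned by their
common vertices (no self-intersections). -/
def AbstractSimplicialComplex.IsLinearRealization {V : Type*}
    (K : AbstractSimplicialComplex V) (p : V → Fin 3 → ℝ) : Prop :=
  Function.Injective p ∧
  (∀ s ∈ K, AffineIndependent ℝ (fun v : s => p v)) ∧
  ∀ s ∈ K, ∀ t ∈ K,
    convexHull ℝ (p '' s) ∩ convexHull ℝ (p '' t) = convexHull ℝ (p '' (s ∩ t : Set V))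

/-- No three of the points lie on a line and no four of them lie on a plane. -/
def InGeneralPosition {V : Type*} (p : V → Fin 3 → ℝ) : Prop :=
  (∀ a b c : V, a ≠ b → a ≠ c → b ≠ c → ¬ Collinear ℝ {p a, p b, p c}) ∧
  ∀ a b c d : V, a ≠ b → a ≠ c → a ≠ d → b ≠ c → b ≠ d → c ≠ d →
    ¬ Coplanar ℝ {p a, p b, p c, p d}

/-- `K` has a general position realization whose vertices are integer points of the
`l 0 × l 1 × l 2`-cuboid, i.e. integer vectors `q` with `0 ≤ q i ≤ l i`. -/
def AbstractSimplicialComplex.HasGeneralPositionRealizationIn {V : Type*}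
    (K : AbstractSimplicialComplex V) (l : Fin 3 → ℤ) : Prop :=
  ∃ q : V → Fin 3 → ℤ,
    (∀ v i, 0 ≤ q v i ∧ q v i ≤ l i) ∧
    K.IsLinearRealization (fun v i => (q v i : ℝ)) ∧
    InGeneralPosition (fun v i => (q v i : ℝ))

namespace CuboidTorus

noncomputable section

/-- Edges of a candidate surface, each with the bit masks of the triangles that contain it, of the
triangles that it pierces, and of both. -/
inductive EdgeList
  | nil
  | cons (s p q : ℕ) (tl : EdgeList)

/-- Points of the cuboid: index, coordinates, weight, and packed weights of the images under the
symmetries of the cuboid. -/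
inductive PointList
  | nil
  | cons (c x y z w im : ℕ) (tl : PointList)

/-- Shifted Plücker coordinates of pairs of points, and eight times their sum. -/
inductive PairList
  | nil
  | cons (a1 a2 a3 a4 a5 a6 e : ℕ) (tl : PairList)

/-- For each five points: the bits of the five sign conditions, and the positions of the ten
pairs (edge, triangle) in the table of piercings. -/
inductive FiveList
  | nil
  | cons (m0 m1 m2 m3 m4 c0 c1 c2 c3 c4 c5 c6 c7 c8 c9 : ℕ) (tl : FiveList)

def sweepUndecided (U : EdgeList) :
    ℕ → ℕ → ℕ → EdgeList → (ℕ → ℕ → ℕ → EdgeList → EdgeList → Bool) → Bool :=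
  EdgeList.rec
    (motive := fun _ =>
      ℕ → ℕ → ℕ → EdgeList → (ℕ → ℕ → ℕ → EdgeList → EdgeList → Bool) → Bool)
    (fun A C r P k => k A C r .nil P)
    (fun s p q _ ih A C r P k => ih A C r P (fun A C r U P =>
      (fun x => Bool.rec
        (Bool.rec
          (Bool.rec
            (Bool.rec (k (Nat.xor A x) C (Nat.pred r) U P) true (Nat.beq r (nat_lit 0)))
            (k (Nat.xor A (Nat.land A p)) C r U (.cons s p q P))
            (Nat.beq (Nat.land C p) (nat_lit 0)))
          (k A C r (.cons s p q U) P)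
          (Nat.beq (Nat.land C q) (nat_lit 0)))
        (Bool.rec (k (Nat.xor A x) C (Nat.pred r) U P) true (Nat.beq r (nat_lit 0)))
        (Nat.beq (Nat.land x (Nat.pred x)) (nat_lit 0)))
      (Nat.land A s))) U

def declareAll (U : EdgeList) : ℕ → EdgeList → (ℕ → EdgeList → Bool) → Bool :=
  EdgeList.rec (motive := fun _ => ℕ → EdgeList → (ℕ → EdgeList → Bool) → Bool)
    (fun A P k => k A P)
    (fun s p q _ ih A P k => ih (Nat.xor A (Nat.land A p)) (.cons s p q P) k) U

def sweepPresent (P : EdgeList) : ℕ → ℕ → (ℕ → ℕ → EdgeList → Bool) → Bool :=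
  EdgeList.rec (motive := fun _ => ℕ → ℕ → (ℕ → ℕ → EdgeList → Bool) → Bool)
    (fun A C k => k A C .nil)
    (fun s p q _ ih A C k => ih A C (fun A C P =>
      (fun x => (fun y => Bool.rec
        ((fun t => (fun t1 => Bool.rec
            (Bool.rec true (k (Nat.xor A (Nat.xor x t)) C P)
              (Nat.beq (Nat.land t1 (Nat.pred t1)) (nat_lit 0)))
            (k A C (.cons s p q P))
            (Nat.beq t1 (nat_lit 0)))
          (Nat.land t (Nat.pred t))) (Nat.land C x))
        (Bool.rec (k A (Nat.lor C x) P) true (Nat.beq y (nat_lit 0)))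
        (Nat.beq (Nat.land y (Nat.pred y)) (nat_lit 0)))
        (Nat.land x (Nat.pred x)))
      (Nat.land A s))) P

def branch (leaf : ℕ → Bool) (ih : EdgeList → EdgeList → ℕ → ℕ → ℕ → Bool)
    (A C r : ℕ) (U P : EdgeList) : Bool :=
  Bool.rec true
    (EdgeList.rec
      (EdgeList.rec (leaf C)
        (fun s _ _ _ _ => (fun x => (fun b => Bool.rec false (ih U P (Nat.xor A b) C r)
            (ih U P A (Nat.lor C b) r)) (Nat.xor x (Nat.land x (Nat.pred x))))
          (Nat.xor (Nat.land A s) (Nat.land C (Nat.land A s)))) P)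
      (fun s p q tl _ => Bool.rec false
        (ih tl P (Nat.xor A (Nat.land A s)) C (Nat.pred r))
        (ih tl (.cons s p q P) (Nat.xor A (Nat.land A p)) C r))
      U)
    (Nat.beq (Nat.land A C) C)

/-- Branch and propagate over the sets of triangles that contain the mask `C`, are contained in the
mask `A` and miss at most `r` of the undecided edges `U`, all edges of `P` being present. -/
def solve (leaf : ℕ → Bool) (fuel : ℕ) : EdgeList → EdgeList → ℕ → ℕ → ℕ → Bool :=
  Nat.rec (fun _ _ _ _ _ => false)
    (fun _ ih U P A C r => sweepUndecided U A C r P (fun A C r U P =>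
      Bool.rec (sweepPresent P A C (fun A C P => branch leaf ih A C r U P))
        (declareAll U A P (fun A P => sweepPresent P A C (fun A C P => branch leaf ih A C r .nil P)))
        (Nat.beq r (nat_lit 0)))) fuel

def addPairs (S : PointList) (x y z : ℕ) (Q : PairList) : PairList :=
  PointList.rec Q (fun _ x' y' z' _ _ _ ih =>
    (fun a1 a2 a3 a4 a5 a6 => PairList.cons a1 a2 a3 a4 a5 a6
      (Nat.mul (nat_lit 8) (Nat.add a1 (Nat.add a2 (Nat.add a3 (Nat.add a4 (Nat.add a5 a6)))))) ih)
    (Nat.sub (Nat.add (nat_lit 8) x) x')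
    (Nat.sub (Nat.add (nat_lit 8) y) y')
    (Nat.sub (Nat.add (nat_lit 8) z) z')
    (Nat.sub (Nat.add (nat_lit 8) (Nat.mul x' y)) (Nat.mul x y'))
    (Nat.sub (Nat.add (nat_lit 8) (Nat.mul x' z)) (Nat.mul x z'))
    (Nat.sub (Nat.add (nat_lit 8) (Nat.mul y' z)) (Nat.mul y z'))) S

def dualPair {α : Type} (x' y' z' x y z : ℕ) (k : ℕ → ℕ → ℕ → ℕ → ℕ → ℕ → ℕ → α) : α :=
  (fun b1 b2 b3 b4 b5 b6 => k b1 b2 b3 b4 b5 b6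
    (Nat.mul (nat_lit 8) (Nat.add b1 (Nat.add b2 (Nat.add b3 (Nat.add b4 (Nat.add b5 b6)))))))
    (Nat.sub (Nat.add (nat_lit 8) (Nat.mul y' z)) (Nat.mul y z'))
    (Nat.sub (Nat.add (nat_lit 8) (Nat.mul x z')) (Nat.mul x' z))
    (Nat.sub (Nat.add (nat_lit 8) (Nat.mul x' y)) (Nat.mul x y'))
    (Nat.sub (Nat.add (nat_lit 8) z) z')
    (Nat.sub (Nat.add (nat_lit 8) y') y)
    (Nat.sub (Nat.add (nat_lit 8) x) x')

def noneCoplanar (Q : PairList) (b1 b2 b3 b4 b5 b6 f : ℕ) : Bool :=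
  PairList.rec true (fun a1 a2 a3 a4 a5 a6 e _ ih => Bool.rec ih false
    (Nat.beq (Nat.add (Nat.mul a1 b1) (Nat.add (Nat.mul a2 b2) (Nat.add (Nat.mul a3 b3)
      (Nat.add (Nat.mul a4 b4) (Nat.add (Nat.mul a5 b5) (Nat.add (Nat.mul a6 b6) (nat_lit 384)))))))
      (Nat.add e f))) Q

def keepGeneral (Q : PairList) (x y z : ℕ) (R : PointList) : PointList :=
  PointList.rec .nil (fun c x' y' z' w im _ ih =>
    Bool.rec ih (.cons c x' y' z' w im ih) (dualPair x y z x' y' z' (noneCoplanar Q))) R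

def signFold (Q : PairList) (b1 b2 b3 b4 b5 b6 f O : ℕ) : ℕ :=
  PairList.rec (motive := fun _ => ℕ → ℕ) (fun O => O)
    (fun a1 a2 a3 a4 a5 a6 e _ ih O => ih (Bool.rec (Nat.add O O) (Nat.succ (Nat.add O O))
    (Nat.ble (Nat.succ (Nat.add e f))
      (Nat.add (Nat.mul a1 b1) (Nat.add (Nat.mul a2 b2) (Nat.add (Nat.mul a3 b3)
        (Nat.add (Nat.mul a4 b4) (Nat.add (Nat.mul a5 b5)
          (Nat.add (Nat.mul a6 b6) (nat_lit 384)))))))))) Q O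

def signFoldPoints (Q : PairList) (x y z : ℕ) (R : PointList) (O : ℕ) : ℕ :=
  PointList.rec (motive := fun _ => ℕ → ℕ) (fun O => O)
    (fun _ x' y' z' _ _ _ ih O =>
      ih (dualPair x y z x' y' z' (fun b1 b2 b3 b4 b5 b6 f => signFold Q b1 b2 b3 b4 b5 b6 f O))) R O

/-- The signs of the orientations of all quadruples of points of `S`, as a bit mask. -/
def signMask (S : PointList) : ℕ :=
  PointList.rec (motive := fun _ => PointList → PairList → ℕ → ℕ) (fun _ _ O => O)
    (fun c x y z w im tl ih S' Q O =>
      ih (.cons c x y z w im S') (addPairs S' x y z Q) (signFoldPoints Q x y z tl O)) S .nil .nil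
      (nat_lit 0)

/-- The pair (edge, triangle) of a Radon partition of five points of type (2, 3), if there is
one. -/
def radonBit (O m0 m1 m2 m3 m4 c0 c1 c2 c3 c4 c5 c6 c7 c8 c9 : ℕ) : ℕ :=
  (Bool.rec (Bool.rec (Bool.rec (Bool.rec (Bool.rec (Nat.shiftLeft (nat_lit 1) c5) (Nat.shiftLeft (nat_lit 1) c1) (Nat.beq (Nat.land O m4) (nat_lit 0))) (Bool.rec (nat_lit 0) (Nat.shiftLeft (nat_lit 1) c6) (Nat.beq (Nat.land O m4) (nat_lit 0))) (Nat.beq (Nat.land O m3) (nat_lit 0))) (Bool.rec (Bool.rec (Nat.shiftLeft (nat_lit 1) c3) (nat_lit 0) (Nat.beq (Nat.land O m4) (nat_lit 0))) (Bool.rec (Nat.shiftLeft (nat_lit 1) c4) (Nat.shiftLeft (nat_lit 1) c2) (Nat.beq (Nat.land O m4) (nat_lit 0))) (Nat.beq (Nat.land O m3) (nat_lit 0))) (Nat.beq (Nat.land O m2) (nat_lit 0))) (Bool.rec (Bool.rec (Bool.rec (nat_lit 0) (Nat.shiftLeft (nat_lit 1) c9) (Nat.beq (Nat.land O m4) (nat_lit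 0))) (nat_lit 0) (Nat.beq (Nat.land O m3) (nat_lit 0))) (Bool.rec (Bool.rec (Nat.shiftLeft (nat_lit 1) c7) (Nat.shiftLeft (nat_lit 1) c0) (Nat.beq (Nat.land O m4) (nat_lit 0))) (Bool.rec (nat_lit 0) (Nat.shiftLeft (nat_lit 1) c8) (Nat.beq (Nat.land O m4) (nat_lit 0))) (Nat.beq (Nat.land O m3) (nat_lit 0))) (Nat.beq (Nat.land O m2) (nat_lit 0))) (Nat.beq (Nat.land O m1) (nat_lit 0))) (Bool.rec (Bool.rec (Bool.rec (Bool.rec (Nat.shiftLeft (nat_lit 1) c8) (nat_lit 0) (Nat.beq (Nat.land O m4) (nat_lit 0))) (Bool.rec (Nat.shiftLeft (nat_lit 1) c0) (Nat.shiftLeft (nat_lit 1) c7) (Nat.beq (Nat.land O m4) (nat_lit 0))) (Nat.beq (Nat.land O m3) (nat_lit 0))) (Bool.rec (nat_lit 0) (Bool.rec (Nat.shiftLeft (nat_lit 1) c9) (nat_lit 0) (Nat.beq (Nat.land O m4) (nat_lit 0))) (Nat.beq (Nat.land O m3) (nat_lit 0))) (Nat.beq (Nat.land O m2) (nat_lit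 0))) (Bool.rec (Bool.rec (Bool.rec (Nat.shiftLeft (nat_lit 1) c2) (Nat.shiftLeft (nat_lit 1) c4) (Nat.beq (Nat.land O m4) (nat_lit 0))) (Bool.rec (nat_lit 0) (Nat.shiftLeft (nat_lit 1) c3) (Nat.beq (Nat.land O m4) (nat_lit 0))) (Nat.beq (Nat.land O m3) (nat_lit 0))) (Bool.rec (Bool.rec (Nat.shiftLeft (nat_lit 1) c6) (nat_lit 0) (Nat.beq (Nat.land O m4) (nat_lit 0))) (Bool.rec (Nat.shiftLeft (nat_lit 1) c1) (Nat.shiftLeft (nat_lit 1) c5) (Nat.beq (Nat.land O m4) (nat_lit 0))) (Nat.beq (Nat.land O m3) (nat_lit 0))) (Nat.beq (Nat.land O m2) (nat_lit 0))) (Nat.beq (Nat.land O m1) (nat_lit 0))) (Nat.beq (Nat.land O m0) (nat_lit 0)))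

def pierceMask (F : FiveList) (O : ℕ) : ℕ :=
  FiveList.rec O (fun m0 m1 m2 m3 m4 c0 c1 c2 c3 c4 c5 c6 c7 c8 c9 _ ih =>
    Nat.lor (radonBit O m0 m1 m2 m3 m4 c0 c1 c2 c3 c4 c5 c6 c7 c8 c9) ih) F

def force {α : Type} (n : ℕ) (k : ℕ → α) : α :=
  Nat.rec (k 0) (fun m _ => k (Nat.succ m)) n

/-- Edges with their position in a table of piercings and the mask of the triangles containing
them. -/
inductive StarList
  | nil
  | cons (e s : ℕ) (tl : StarList)

def edgeList (T : StarList) (M : ℕ) (k : EdgeList → Bool) : Bool :=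
  StarList.rec (motive := fun _ => (EdgeList → Bool) → Bool) (fun k => k .nil)
    (fun e s _ ih k => ih (fun U =>
      force (Nat.land (Nat.shiftRight M (Nat.add (nat_lit 70) (Nat.mul (nat_lit 56) e))) (nat_lit 72057594037927935))
        (fun p => force (Nat.lor s p) (fun q => k (.cons s p q U))))) T k

def findStar (T : StarList) (e : ℕ) (k : ℕ → ℕ → StarList) : StarList :=
  StarList.rec .nil (fun e' s _ ih => Bool.rec ih (k e' s) (Nat.beq e e')) T

def reorder (T : StarList) (order : List ℕ) : StarList :=
  List.rec .nil (fun e _ ih => findStar T e (fun e s => .cons e s ih)) order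

def fiveList7 : FiveList :=
  (.cons (nat_lit 1073741824) (nat_lit 536870912) (nat_lit 268435456) (nat_lit 8589934592) (nat_lit 17179869184) (nat_lit 79) (nat_lit 134) (nat_lit 244) (nat_lit 409) (nat_lit 189) (nat_lit 299) (nat_lit 464) (nat_lit 354) (nat_lit 519) (nat_lit 574)
  (.cons (nat_lit 134217728) (nat_lit 67108864) (nat_lit 33554432) (nat_lit 4294967296) (nat_lit 17179869184) (nat_lit 85) (nat_lit 140) (nat_lit 250) (nat_lit 633) (nat_lit 195) (nat_lit 305) (nat_lit 688) (nat_lit 360) (nat_lit 743) (nat_lit 798)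
  (.cons (nat_lit 16777216) (nat_lit 8388608) (nat_lit 4194304) (nat_lit 2147483648) (nat_lit 17179869184) (nat_lit 95) (nat_lit 150) (nat_lit 260) (nat_lit 913) (nat_lit 205) (nat_lit 315) (nat_lit 968) (nat_lit 370) (nat_lit 1023) (nat_lit 1078)
  (.cons (nat_lit 262144) (nat_lit 131072) (nat_lit 65536) (nat_lit 4294967296) (nat_lit 8589934592) (nat_lit 88) (nat_lit 143) (nat_lit 418) (nat_lit 636) (nat_lit 198) (nat_lit 473) (nat_lit 691) (nat_lit 528) (nat_lit 746) (nat_lit 854)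
  (.cons (nat_lit 4096) (nat_lit 2048) (nat_lit 1024) (nat_lit 2147483648) (nat_lit 8589934592) (nat_lit 98) (nat_lit 153) (nat_lit 428) (nat_lit 916) (nat_lit 208) (nat_lit 483) (nat_lit 971) (nat_lit 538) (nat_lit 1026) (nat_lit 1134)
  (.cons (nat_lit 4) (nat_lit 2) (nat_lit 1) (nat_lit 2147483648) (nat_lit 4294967296) (nat_lit 102) (nat_lit 157) (nat_lit 652) (nat_lit 922) (nat_lit 212) (nat_lit 707) (nat_lit 977) (nat_lit 762) (nat_lit 1032) (nat_lit 1190)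
  (.cons (nat_lit 1048576) (nat_lit 524288) (nat_lit 65536) (nat_lit 33554432) (nat_lit 268435456) (nat_lit 89) (nat_lit 255) (nat_lit 420) (nat_lit 638) (nat_lit 310) (nat_lit 475) (nat_lit 693) (nat_lit 584) (nat_lit 802) (nat_lit 855)
  (.cons (nat_lit 16384) (nat_lit 8192) (nat_lit 1024) (nat_lit 4194304) (nat_lit 268435456) (nat_lit 99) (nat_lit 265) (nat_lit 430) (nat_lit 918) (nat_lit 320) (nat_lit 485) (nat_lit 973) (nat_lit 594) (nat_lit 1082) (nat_lit 1135)
  (.cons (nat_lit 16) (nat_lit 8) (nat_lit 1) (nat_lit 4194304) (nat_lit 33554432) (nat_lit 103) (nat_lit 269) (nat_lit 654) (nat_lit 924) (nat_lit 324) (nat_lit 709) (nat_lit 979) (nat_lit 818) (nat_lit 1088) (nat_lit 1191)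
  (.cons (nat_lit 128) (nat_lit 64) (nat_lit 1) (nat_lit 1024) (nat_lit 65536) (nat_lit 104) (nat_lit 437) (nat_lit 657) (nat_lit 927) (nat_lit 492) (nat_lit 712) (nat_lit 982) (nat_lit 874) (nat_lit 1144) (nat_lit 1194)
  (.cons (nat_lit 2097152) (nat_lit 524288) (nat_lit 131072) (nat_lit 67108864) (nat_lit 536870912) (nat_lit 145) (nat_lit 256) (nat_lit 421) (nat_lit 639) (nat_lit 366) (nat_lit 531) (nat_lit 749) (nat_lit 585) (nat_lit 803) (nat_lit 856)
  (.cons (nat_lit 32768) (nat_lit 8192) (nat_lit 2048) (nat_lit 8388608) (nat_lit 536870912) (nat_lit 155) (nat_lit 266) (nat_lit 431) (nat_lit 919) (nat_lit 376) (nat_lit 541) (nat_lit 1029) (nat_lit 595) (nat_lit 1083) (nat_lit 1136)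
  (.cons (nat_lit 32) (nat_lit 8) (nat_lit 2) (nat_lit 8388608) (nat_lit 67108864) (nat_lit 159) (nat_lit 270) (nat_lit 655) (nat_lit 925) (nat_lit 380) (nat_lit 765) (nat_lit 1035) (nat_lit 819) (nat_lit 1089) (nat_lit 1192)
  (.cons (nat_lit 256) (nat_lit 64) (nat_lit 2) (nat_lit 2048) (nat_lit 131072) (nat_lit 160) (nat_lit 438) (nat_lit 658) (nat_lit 928) (nat_lit 548) (nat_lit 768) (nat_lit 1038) (nat_lit 875) (nat_lit 1145) (nat_lit 1195)
  (.cons (nat_lit 512) (nat_lit 64) (nat_lit 8) (nat_lit 8192) (nat_lit 524288) (nat_lit 272) (nat_lit 439) (nat_lit 659) (nat_lit 929) (nat_lit 604) (nat_lit 824) (nat_lit 1094) (nat_lit 877) (nat_lit 1147) (nat_lit 1197)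
  (.cons (nat_lit 2097152) (nat_lit 1048576) (nat_lit 262144) (nat_lit 134217728) (nat_lit 1073741824) (nat_lit 201) (nat_lit 312) (nat_lit 477) (nat_lit 695) (nat_lit 367) (nat_lit 532) (nat_lit 750) (nat_lit 586) (nat_lit 804) (nat_lit 857)
  (.cons (nat_lit 32768) (nat_lit 16384) (nat_lit 4096) (nat_lit 16777216) (nat_lit 1073741824) (nat_lit 211) (nat_lit 322) (nat_lit 487) (nat_lit 975) (nat_lit 377) (nat_lit 542) (nat_lit 1030) (nat_lit 596) (nat_lit 1084) (nat_lit 1137)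
  (.cons (nat_lit 32) (nat_lit 16) (nat_lit 4) (nat_lit 16777216) (nat_lit 134217728) (nat_lit 215) (nat_lit 326) (nat_lit 711) (nat_lit 981) (nat_lit 381) (nat_lit 766) (nat_lit 1036) (nat_lit 820) (nat_lit 1090) (nat_lit 1193)
  (.cons (nat_lit 256) (nat_lit 128) (nat_lit 4) (nat_lit 4096) (nat_lit 262144) (nat_lit 216) (nat_lit 494) (nat_lit 714) (nat_lit 984) (nat_lit 549) (nat_lit 769) (nat_lit 1039) (nat_lit 876) (nat_lit 1146) (nat_lit 1196)
  (.cons (nat_lit 512) (nat_lit 128) (nat_lit 16) (nat_lit 16384) (nat_lit 1048576) (nat_lit 328) (nat_lit 495) (nat_lit 715) (nat_lit 985) (nat_lit 605) (nat_lit 825) (nat_lit 1095) (nat_lit 878) (nat_lit 1148) (nat_lit 1198)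
  (.cons (nat_lit 512) (nat_lit 256) (nat_lit 32) (nat_lit 32768) (nat_lit 2097152) (nat_lit 384) (nat_lit 551) (nat_lit 771) (nat_lit 1041) (nat_lit 606) (nat_lit 826) (nat_lit 1096) (nat_lit 879) (nat_lit 1149) (nat_lit 1199) .nil)))))))))))))))))))))

def fiveList8 : FiveList :=
  (.cons (nat_lit 18446744073709551616) (nat_lit 9223372036854775808) (nat_lit 4611686018427387904) (nat_lit 295147905179352825856) (nat_lit 590295810358705651712) (nat_lit 79) (nat_lit 134) (nat_lit 244) (nat_lit 409) (nat_lit 189) (nat_lit 299) (nat_lit 464) (nat_lit 354) (nat_lit 519) (nat_lit 574)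
  (.cons (nat_lit 2305843009213693952) (nat_lit 1152921504606846976) (nat_lit 576460752303423488) (nat_lit 147573952589676412928) (nat_lit 590295810358705651712) (nat_lit 85) (nat_lit 140) (nat_lit 250) (nat_lit 633) (nat_lit 195) (nat_lit 305) (nat_lit 688) (nat_lit 360) (nat_lit 743) (nat_lit 798)
  (.cons (nat_lit 288230376151711744) (nat_lit 144115188075855872) (nat_lit 72057594037927936) (nat_lit 73786976294838206464) (nat_lit 590295810358705651712) (nat_lit 95) (nat_lit 150) (nat_lit 260) (nat_lit 913) (nat_lit 205) (nat_lit 315) (nat_lit 968) (nat_lit 370) (nat_lit 1023) (nat_lit 1078)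
  (.cons (nat_lit 36028797018963968) (nat_lit 18014398509481984) (nat_lit 9007199254740992) (nat_lit 36893488147419103232) (nat_lit 590295810358705651712) (nat_lit 110) (nat_lit 165) (nat_lit 275) (nat_lit 1249) (nat_lit 220) (nat_lit 330) (nat_lit 1304) (nat_lit 385) (nat_lit 1359) (nat_lit 1414)
  (.cons (nat_lit 562949953421312) (nat_lit 281474976710656) (nat_lit 140737488355328) (nat_lit 147573952589676412928) (nat_lit 295147905179352825856) (nat_lit 88) (nat_lit 143) (nat_lit 418) (nat_lit 636) (nat_lit 198) (nat_lit 473) (nat_lit 691) (nat_lit 528) (nat_lit 746) (nat_lit 854)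
  (.cons (nat_lit 8796093022208) (nat_lit 4398046511104) (nat_lit 2199023255552) (nat_lit 73786976294838206464) (nat_lit 295147905179352825856) (nat_lit 98) (nat_lit 153) (nat_lit 428) (nat_lit 916) (nat_lit 208) (nat_lit 483) (nat_lit 971) (nat_lit 538) (nat_lit 1026) (nat_lit 1134)
  (.cons (nat_lit 137438953472) (nat_lit 68719476736) (nat_lit 34359738368) (nat_lit 36893488147419103232) (nat_lit 295147905179352825856) (nat_lit 113) (nat_lit 168) (nat_lit 443) (nat_lit 1252) (nat_lit 223) (nat_lit 498) (nat_lit 1307) (nat_lit 553) (nat_lit 1362) (nat_lit 1470)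
  (.cons (nat_lit 134217728) (nat_lit 67108864) (nat_lit 33554432) (nat_lit 73786976294838206464) (nat_lit 147573952589676412928) (nat_lit 102) (nat_lit 157) (nat_lit 652) (nat_lit 922) (nat_lit 212) (nat_lit 707) (nat_lit 977) (nat_lit 762) (nat_lit 1032) (nat_lit 1190)
  (.cons (nat_lit 131072) (nat_lit 65536) (nat_lit 32768) (nat_lit 36893488147419103232) (nat_lit 147573952589676412928) (nat_lit 117) (nat_lit 172) (nat_lit 667) (nat_lit 1258) (nat_lit 227) (nat_lit 722) (nat_lit 1313) (nat_lit 777) (nat_lit 1368) (nat_lit 1526)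
  (.cons (nat_lit 4) (nat_lit 2) (nat_lit 1) (nat_lit 36893488147419103232) (nat_lit 73786976294838206464) (nat_lit 122) (nat_lit 177) (nat_lit 947) (nat_lit 1268) (nat_lit 232) (nat_lit 1002) (nat_lit 1323) (nat_lit 1057) (nat_lit 1378) (nat_lit 1582)
  (.cons (nat_lit 2251799813685248) (nat_lit 1125899906842624) (nat_lit 140737488355328) (nat_lit 576460752303423488) (nat_lit 4611686018427387904) (nat_lit 89) (nat_lit 255) (nat_lit 420) (nat_lit 638) (nat_lit 310) (nat_lit 475) (nat_lit 693) (nat_lit 584) (nat_lit 802) (nat_lit 855)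
  (.cons (nat_lit 35184372088832) (nat_lit 17592186044416) (nat_lit 2199023255552) (nat_lit 72057594037927936) (nat_lit 4611686018427387904) (nat_lit 99) (nat_lit 265) (nat_lit 430) (nat_lit 918) (nat_lit 320) (nat_lit 485) (nat_lit 973) (nat_lit 594) (nat_lit 1082) (nat_lit 1135)
  (.cons (nat_lit 549755813888) (nat_lit 274877906944) (nat_lit 34359738368) (nat_lit 9007199254740992) (nat_lit 4611686018427387904) (nat_lit 114) (nat_lit 280) (nat_lit 445) (nat_lit 1254) (nat_lit 335) (nat_lit 500) (nat_lit 1309) (nat_lit 609) (nat_lit 1418) (nat_lit 1471)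
  (.cons (nat_lit 536870912) (nat_lit 268435456) (nat_lit 33554432) (nat_lit 72057594037927936) (nat_lit 576460752303423488) (nat_lit 103) (nat_lit 269) (nat_lit 654) (nat_lit 924) (nat_lit 324) (nat_lit 709) (nat_lit 979) (nat_lit 818) (nat_lit 1088) (nat_lit 1191)
  (.cons (nat_lit 524288) (nat_lit 262144) (nat_lit 32768) (nat_lit 9007199254740992) (nat_lit 576460752303423488) (nat_lit 118) (nat_lit 284) (nat_lit 669) (nat_lit 1260) (nat_lit 339) (nat_lit 724) (nat_lit 1315) (nat_lit 833) (nat_lit 1424) (nat_lit 1527)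
  (.cons (nat_lit 16) (nat_lit 8) (nat_lit 1) (nat_lit 9007199254740992) (nat_lit 72057594037927936) (nat_lit 123) (nat_lit 289) (nat_lit 949) (nat_lit 1270) (nat_lit 344) (nat_lit 1004) (nat_lit 1325) (nat_lit 1113) (nat_lit 1434) (nat_lit 1583)
  (.cons (nat_lit 4294967296) (nat_lit 2147483648) (nat_lit 33554432) (nat_lit 2199023255552) (nat_lit 140737488355328) (nat_lit 104) (nat_lit 437) (nat_lit 657) (nat_lit 927) (nat_lit 492) (nat_lit 712) (nat_lit 982) (nat_lit 874) (nat_lit 1144) (nat_lit 1194)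
  (.cons (nat_lit 4194304) (nat_lit 2097152) (nat_lit 32768) (nat_lit 34359738368) (nat_lit 140737488355328) (nat_lit 119) (nat_lit 452) (nat_lit 672) (nat_lit 1263) (nat_lit 507) (nat_lit 727) (nat_lit 1318) (nat_lit 889) (nat_lit 1480) (nat_lit 1530)
  (.cons (nat_lit 128) (nat_lit 64) (nat_lit 1) (nat_lit 34359738368) (nat_lit 2199023255552) (nat_lit 124) (nat_lit 457) (nat_lit 952) (nat_lit 1273) (nat_lit 512) (nat_lit 1007) (nat_lit 1328) (nat_lit 1169) (nat_lit 1490) (nat_lit 1586)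
  (.cons (nat_lit 2048) (nat_lit 1024) (nat_lit 1) (nat_lit 32768) (nat_lit 33554432) (nat_lit 125) (nat_lit 681) (nat_lit 956) (nat_lit 1277) (nat_lit 736) (nat_lit 1011) (nat_lit 1332) (nat_lit 1225) (nat_lit 1546) (nat_lit 1592)
  (.cons (nat_lit 4503599627370496) (nat_lit 1125899906842624) (nat_lit 281474976710656) (nat_lit 1152921504606846976) (nat_lit 9223372036854775808) (nat_lit 145) (nat_lit 256) (nat_lit 421) (nat_lit 639) (nat_lit 366) (nat_lit 531) (nat_lit 749) (nat_lit 585) (nat_lit 803) (nat_lit 856)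
  (.cons (nat_lit 70368744177664) (nat_lit 17592186044416) (nat_lit 4398046511104) (nat_lit 144115188075855872) (nat_lit 9223372036854775808) (nat_lit 155) (nat_lit 266) (nat_lit 431) (nat_lit 919) (nat_lit 376) (nat_lit 541) (nat_lit 1029) (nat_lit 595) (nat_lit 1083) (nat_lit 1136)
  (.cons (nat_lit 1099511627776) (nat_lit 274877906944) (nat_lit 68719476736) (nat_lit 18014398509481984) (nat_lit 9223372036854775808) (nat_lit 170) (nat_lit 281) (nat_lit 446) (nat_lit 1255) (nat_lit 391) (nat_lit 556) (nat_lit 1365) (nat_lit 610) (nat_lit 1419) (nat_lit 1472)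
  (.cons (nat_lit 1073741824) (nat_lit 268435456) (nat_lit 67108864) (nat_lit 144115188075855872) (nat_lit 1152921504606846976) (nat_lit 159) (nat_lit 270) (nat_lit 655) (nat_lit 925) (nat_lit 380) (nat_lit 765) (nat_lit 1035) (nat_lit 819) (nat_lit 1089) (nat_lit 1192)
  (.cons (nat_lit 1048576) (nat_lit 262144) (nat_lit 65536) (nat_lit 18014398509481984) (nat_lit 1152921504606846976) (nat_lit 174) (nat_lit 285) (nat_lit 670) (nat_lit 1261) (nat_lit 395) (nat_lit 780) (nat_lit 1371) (nat_lit 834) (nat_lit 1425) (nat_lit 1528)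
  (.cons (nat_lit 32) (nat_lit 8) (nat_lit 2) (nat_lit 18014398509481984) (nat_lit 144115188075855872) (nat_lit 179) (nat_lit 290) (nat_lit 950) (nat_lit 1271) (nat_lit 400) (nat_lit 1060) (nat_lit 1381) (nat_lit 1114) (nat_lit 1435) (nat_lit 1584)
  (.cons (nat_lit 8589934592) (nat_lit 2147483648) (nat_lit 67108864) (nat_lit 4398046511104) (nat_lit 281474976710656) (nat_lit 160) (nat_lit 438) (nat_lit 658) (nat_lit 928) (nat_lit 548) (nat_lit 768) (nat_lit 1038) (nat_lit 875) (nat_lit 1145) (nat_lit 1195)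
  (.cons (nat_lit 8388608) (nat_lit 2097152) (nat_lit 65536) (nat_lit 68719476736) (nat_lit 281474976710656) (nat_lit 175) (nat_lit 453) (nat_lit 673) (nat_lit 1264) (nat_lit 563) (nat_lit 783) (nat_lit 1374) (nat_lit 890) (nat_lit 1481) (nat_lit 1531)
  (.cons (nat_lit 256) (nat_lit 64) (nat_lit 2) (nat_lit 68719476736) (nat_lit 4398046511104) (nat_lit 180) (nat_lit 458) (nat_lit 953) (nat_lit 1274) (nat_lit 568) (nat_lit 1063) (nat_lit 1384) (nat_lit 1170) (nat_lit 1491) (nat_lit 1587)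
  (.cons (nat_lit 4096) (nat_lit 1024) (nat_lit 2) (nat_lit 65536) (nat_lit 67108864) (nat_lit 181) (nat_lit 682) (nat_lit 957) (nat_lit 1278) (nat_lit 792) (nat_lit 1067) (nat_lit 1388) (nat_lit 1226) (nat_lit 1547) (nat_lit 1593)
  (.cons (nat_lit 17179869184) (nat_lit 2147483648) (nat_lit 268435456) (nat_lit 17592186044416) (nat_lit 1125899906842624) (nat_lit 272) (nat_lit 439) (nat_lit 659) (nat_lit 929) (nat_lit 604) (nat_lit 824) (nat_lit 1094) (nat_lit 877) (nat_lit 1147) (nat_lit 1197)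
  (.cons (nat_lit 16777216) (nat_lit 2097152) (nat_lit 262144) (nat_lit 274877906944) (nat_lit 1125899906842624) (nat_lit 287) (nat_lit 454) (nat_lit 674) (nat_lit 1265) (nat_lit 619) (nat_lit 839) (nat_lit 1430) (nat_lit 892) (nat_lit 1483) (nat_lit 1533)
  (.cons (nat_lit 512) (nat_lit 64) (nat_lit 8) (nat_lit 274877906944) (nat_lit 17592186044416) (nat_lit 292) (nat_lit 459) (nat_lit 954) (nat_lit 1275) (nat_lit 624) (nat_lit 1119) (nat_lit 1440) (nat_lit 1172) (nat_lit 1493) (nat_lit 1589)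
  (.cons (nat_lit 8192) (nat_lit 1024) (nat_lit 8) (nat_lit 262144) (nat_lit 268435456) (nat_lit 293) (nat_lit 683) (nat_lit 958) (nat_lit 1279) (nat_lit 848) (nat_lit 1123) (nat_lit 1444) (nat_lit 1228) (nat_lit 1549) (nat_lit 1595)
  (.cons (nat_lit 16384) (nat_lit 1024) (nat_lit 64) (nat_lit 2097152) (nat_lit 2147483648) (nat_lit 461) (nat_lit 684) (nat_lit 959) (nat_lit 1280) (nat_lit 904) (nat_lit 1179) (nat_lit 1500) (nat_lit 1231) (nat_lit 1552) (nat_lit 1598)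
  (.cons (nat_lit 4503599627370496) (nat_lit 2251799813685248) (nat_lit 562949953421312) (nat_lit 2305843009213693952) (nat_lit 18446744073709551616) (nat_lit 201) (nat_lit 312) (nat_lit 477) (nat_lit 695) (nat_lit 367) (nat_lit 532) (nat_lit 750) (nat_lit 586) (nat_lit 804) (nat_lit 857)
  (.cons (nat_lit 70368744177664) (nat_lit 35184372088832) (nat_lit 8796093022208) (nat_lit 288230376151711744) (nat_lit 18446744073709551616) (nat_lit 211) (nat_lit 322) (nat_lit 487) (nat_lit 975) (nat_lit 377) (nat_lit 542) (nat_lit 1030) (nat_lit 596) (nat_lit 1084) (nat_lit 1137)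
  (.cons (nat_lit 1099511627776) (nat_lit 549755813888) (nat_lit 137438953472) (nat_lit 36028797018963968) (nat_lit 18446744073709551616) (nat_lit 226) (nat_lit 337) (nat_lit 502) (nat_lit 1311) (nat_lit 392) (nat_lit 557) (nat_lit 1366) (nat_lit 611) (nat_lit 1420) (nat_lit 1473)
  (.cons (nat_lit 1073741824) (nat_lit 536870912) (nat_lit 134217728) (nat_lit 288230376151711744) (nat_lit 2305843009213693952) (nat_lit 215) (nat_lit 326) (nat_lit 711) (nat_lit 981) (nat_lit 381) (nat_lit 766) (nat_lit 1036) (nat_lit 820) (nat_lit 1090) (nat_lit 1193)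
  (.cons (nat_lit 1048576) (nat_lit 524288) (nat_lit 131072) (nat_lit 36028797018963968) (nat_lit 2305843009213693952) (nat_lit 230) (nat_lit 341) (nat_lit 726) (nat_lit 1317) (nat_lit 396) (nat_lit 781) (nat_lit 1372) (nat_lit 835) (nat_lit 1426) (nat_lit 1529)
  (.cons (nat_lit 32) (nat_lit 16) (nat_lit 4) (nat_lit 36028797018963968) (nat_lit 288230376151711744) (nat_lit 235) (nat_lit 346) (nat_lit 1006) (nat_lit 1327) (nat_lit 401) (nat_lit 1061) (nat_lit 1382) (nat_lit 1115) (nat_lit 1436) (nat_lit 1585)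
  (.cons (nat_lit 8589934592) (nat_lit 4294967296) (nat_lit 134217728) (nat_lit 8796093022208) (nat_lit 562949953421312) (nat_lit 216) (nat_lit 494) (nat_lit 714) (nat_lit 984) (nat_lit 549) (nat_lit 769) (nat_lit 1039) (nat_lit 876) (nat_lit 1146) (nat_lit 1196)
  (.cons (nat_lit 8388608) (nat_lit 4194304) (nat_lit 131072) (nat_lit 137438953472) (nat_lit 562949953421312) (nat_lit 231) (nat_lit 509) (nat_lit 729) (nat_lit 1320) (nat_lit 564) (nat_lit 784) (nat_lit 1375) (nat_lit 891) (nat_lit 1482) (nat_lit 1532)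
  (.cons (nat_lit 256) (nat_lit 128) (nat_lit 4) (nat_lit 137438953472) (nat_lit 8796093022208) (nat_lit 236) (nat_lit 514) (nat_lit 1009) (nat_lit 1330) (nat_lit 569) (nat_lit 1064) (nat_lit 1385) (nat_lit 1171) (nat_lit 1492) (nat_lit 1588)
  (.cons (nat_lit 4096) (nat_lit 2048) (nat_lit 4) (nat_lit 131072) (nat_lit 134217728) (nat_lit 237) (nat_lit 738) (nat_lit 1013) (nat_lit 1334) (nat_lit 793) (nat_lit 1068) (nat_lit 1389) (nat_lit 1227) (nat_lit 1548) (nat_lit 1594)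
  (.cons (nat_lit 17179869184) (nat_lit 4294967296) (nat_lit 536870912) (nat_lit 35184372088832) (nat_lit 2251799813685248) (nat_lit 328) (nat_lit 495) (nat_lit 715) (nat_lit 985) (nat_lit 605) (nat_lit 825) (nat_lit 1095) (nat_lit 878) (nat_lit 1148) (nat_lit 1198)
  (.cons (nat_lit 16777216) (nat_lit 4194304) (nat_lit 524288) (nat_lit 549755813888) (nat_lit 2251799813685248) (nat_lit 343) (nat_lit 510) (nat_lit 730) (nat_lit 1321) (nat_lit 620) (nat_lit 840) (nat_lit 1431) (nat_lit 893) (nat_lit 1484) (nat_lit 1534)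
  (.cons (nat_lit 512) (nat_lit 128) (nat_lit 16) (nat_lit 549755813888) (nat_lit 35184372088832) (nat_lit 348) (nat_lit 515) (nat_lit 1010) (nat_lit 1331) (nat_lit 625) (nat_lit 1120) (nat_lit 1441) (nat_lit 1173) (nat_lit 1494) (nat_lit 1590)
  (.cons (nat_lit 8192) (nat_lit 2048) (nat_lit 16) (nat_lit 524288) (nat_lit 536870912) (nat_lit 349) (nat_lit 739) (nat_lit 1014) (nat_lit 1335) (nat_lit 849) (nat_lit 1124) (nat_lit 1445) (nat_lit 1229) (nat_lit 1550) (nat_lit 1596)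
  (.cons (nat_lit 16384) (nat_lit 2048) (nat_lit 128) (nat_lit 4194304) (nat_lit 4294967296) (nat_lit 517) (nat_lit 740) (nat_lit 1015) (nat_lit 1336) (nat_lit 905) (nat_lit 1180) (nat_lit 1501) (nat_lit 1232) (nat_lit 1553) (nat_lit 1599)
  (.cons (nat_lit 17179869184) (nat_lit 8589934592) (nat_lit 1073741824) (nat_lit 70368744177664) (nat_lit 4503599627370496) (nat_lit 384) (nat_lit 551) (nat_lit 771) (nat_lit 1041) (nat_lit 606) (nat_lit 826) (nat_lit 1096) (nat_lit 879) (nat_lit 1149) (nat_lit 1199)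
  (.cons (nat_lit 16777216) (nat_lit 8388608) (nat_lit 1048576) (nat_lit 1099511627776) (nat_lit 4503599627370496) (nat_lit 399) (nat_lit 566) (nat_lit 786) (nat_lit 1377) (nat_lit 621) (nat_lit 841) (nat_lit 1432) (nat_lit 894) (nat_lit 1485) (nat_lit 1535)
  (.cons (nat_lit 512) (nat_lit 256) (nat_lit 32) (nat_lit 1099511627776) (nat_lit 70368744177664) (nat_lit 404) (nat_lit 571) (nat_lit 1066) (nat_lit 1387) (nat_lit 626) (nat_lit 1121) (nat_lit 1442) (nat_lit 1174) (nat_lit 1495) (nat_lit 1591)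
  (.cons (nat_lit 8192) (nat_lit 4096) (nat_lit 32) (nat_lit 1048576) (nat_lit 1073741824) (nat_lit 405) (nat_lit 795) (nat_lit 1070) (nat_lit 1391) (nat_lit 850) (nat_lit 1125) (nat_lit 1446) (nat_lit 1230) (nat_lit 1551) (nat_lit 1597)
  (.cons (nat_lit 16384) (nat_lit 4096) (nat_lit 256) (nat_lit 8388608) (nat_lit 8589934592) (nat_lit 573) (nat_lit 796) (nat_lit 1071) (nat_lit 1392) (nat_lit 906) (nat_lit 1181) (nat_lit 1502) (nat_lit 1233) (nat_lit 1554) (nat_lit 1600)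
  (.cons (nat_lit 16384) (nat_lit 8192) (nat_lit 512) (nat_lit 16777216) (nat_lit 17179869184) (nat_lit 629) (nat_lit 852) (nat_lit 1127) (nat_lit 1448) (nat_lit 907) (nat_lit 1182) (nat_lit 1503) (nat_lit 1234) (nat_lit 1555) (nat_lit 1601) .nil))))))))))))))))))))))))))))))))))))))))))))))))))))))))

def stars7 : StarList :=
  (.cons (nat_lit 0) (nat_lit 1049619)
  (.cons (nat_lit 1) (nat_lit 2099237)
  (.cons (nat_lit 2) (nat_lit 4198473)
  (.cons (nat_lit 3) (nat_lit 8396934)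
  (.cons (nat_lit 4) (nat_lit 16793866)
  (.cons (nat_lit 5) (nat_lit 33587724)
  (.cons (nat_lit 6) (nat_lit 67174576)
  (.cons (nat_lit 7) (nat_lit 134349136)
  (.cons (nat_lit 8) (nat_lit 268698208)
  (.cons (nat_lit 9) (nat_lit 537396096)
  (.cons (nat_lit 10) (nat_lit 1073818624)
  (.cons (nat_lit 11) (nat_lit 2147636224)
  (.cons (nat_lit 12) (nat_lit 4295268352)
  (.cons (nat_lit 13) (nat_lit 8590516224)
  (.cons (nat_lit 14) (nat_lit 17180852224)
  (.cons (nat_lit 15) (nat_lit 1152385024)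
  (.cons (nat_lit 16) (nat_lit 2303721472)
  (.cons (nat_lit 17) (nat_lit 4603248640)
  (.cons (nat_lit 18) (nat_lit 9185525760)
  (.cons (nat_lit 19) (nat_lit 18186502144)
  (.cons (nat_lit 20) (nat_lit 33285996544) .nil)))))))))))))))))))))

def stars8 : StarList :=
  (.cons (nat_lit 0) (nat_lit 34360787987)
  (.cons (nat_lit 1) (nat_lit 68721575973)
  (.cons (nat_lit 2) (nat_lit 137443151945)
  (.cons (nat_lit 3) (nat_lit 274886303878)
  (.cons (nat_lit 4) (nat_lit 549772607754)
  (.cons (nat_lit 5) (nat_lit 1099545215500)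
  (.cons (nat_lit 6) (nat_lit 2199090430128)
  (.cons (nat_lit 7) (nat_lit 4398180860240)
  (.cons (nat_lit 8) (nat_lit 8796361720416)
  (.cons (nat_lit 9) (nat_lit 17592723440512)
  (.cons (nat_lit 10) (nat_lit 35185445907456)
  (.cons (nat_lit 11) (nat_lit 70370891813888)
  (.cons (nat_lit 12) (nat_lit 140741783623680)
  (.cons (nat_lit 13) (nat_lit 281483567226880)
  (.cons (nat_lit 14) (nat_lit 562967134273536)
  (.cons (nat_lit 15) (nat_lit 1125901059227648)
  (.cons (nat_lit 16) (nat_lit 2251802117406720)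
  (.cons (nat_lit 17) (nat_lit 4503604230619136)
  (.cons (nat_lit 18) (nat_lit 9007208440266752)
  (.cons (nat_lit 19) (nat_lit 18014416695984128)
  (.cons (nat_lit 20) (nat_lit 36028830304960512)
  (.cons (nat_lit 21) (nat_lit 1163661259309056)
  (.cons (nat_lit 22) (nat_lit 2327288158879744)
  (.cons (nat_lit 23) (nat_lit 4654438878806016)
  (.cons (nat_lit 24) (nat_lit 9308190562844672)
  (.cons (nat_lit 25) (nat_lit 18610333811736576)
  (.cons (nat_lit 26) (nat_lit 37119512553717760)
  (.cons (nat_lit 27) (nat_lit 70931694131085312) .nil))))))))))))))))))))))))))))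

def goodMasks : List ℕ := [(nat_lit 5862881346225221), (nat_lit 6052307263294880), (nat_lit 6052307263295236), (nat_lit 6476821151618178), (nat_lit 11454862864687642), (nat_lit 11692241446374532), (nat_lit 13834211532357772), (nat_lit 22699152441888868), (nat_lit 22852337769153840), (nat_lit 41113386587785540)]

def linkTable : List (List (ℕ × ℕ)) := [
  [((nat_lit 0), (nat_lit 6)), ((nat_lit 1), (nat_lit 10)), ((nat_lit 2), (nat_lit 12)), ((nat_lit 4), (nat_lit 18)), ((nat_lit 5), (nat_lit 20)), ((nat_lit 7), (nat_lit 24)), ((nat_lit 10), (nat_lit 34)), ((nat_lit 11), (nat_lit 36)), ((nat_lit 13), (nat_lit 40)), ((nat_lit 16), (nat_lit 48)), ((nat_lit 20), (nat_lit 66)), ((nat_lit 21), (nat_lit 68)), ((nat_lit 23), (nat_lit 72)), ((nat_lit 26), (nat_lit 80)), ((nat_lit 30), (nat_lit 96)), ((nat_lit 35), (nat_lit 130)), ((nat_lit 36), (nat_lit 132)), ((nat_lit 38), (nat_lit 136)), ((nat_lit 41), (nat_lit 144)), ((nat_lit 45), (nat_lit 160)), ((nat_lit 50), (nat_lit 1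92))],
  [((nat_lit 0), (nat_lit 5)), ((nat_lit 1), (nat_lit 9)), ((nat_lit 3), (nat_lit 12)), ((nat_lit 4), (nat_lit 17)), ((nat_lit 6), (nat_lit 20)), ((nat_lit 8), (nat_lit 24)), ((nat_lit 10), (nat_lit 33)), ((nat_lit 12), (nat_lit 36)), ((nat_lit 14), (nat_lit 40)), ((nat_lit 17), (nat_lit 48)), ((nat_lit 20), (nat_lit 65)), ((nat_lit 22), (nat_lit 68)), ((nat_lit 24), (nat_lit 72)), ((nat_lit 27), (nat_lit 80)), ((nat_lit 31), (nat_lit 96)), ((nat_lit 35), (nat_lit 129)), ((nat_lit 37), (nat_lit 132)), ((nat_lit 39), (nat_lit 136)), ((nat_lit 42), (nat_lit 144)), ((nat_lit 46), (nat_lit 160)), ((nat_lit 51), (nat_lit 192))],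
  [((nat_lit 0), (nat_lit 3)), ((nat_lit 2), (nat_lit 9)), ((nat_lit 3), (nat_lit 10)), ((nat_lit 5), (nat_lit 17)), ((nat_lit 6), (nat_lit 18)), ((nat_lit 9), (nat_lit 24)), ((nat_lit 11), (nat_lit 33)), ((nat_lit 12), (nat_lit 34)), ((nat_lit 15), (nat_lit 40)), ((nat_lit 18), (nat_lit 48)), ((nat_lit 21), (nat_lit 65)), ((nat_lit 22), (nat_lit 66)), ((nat_lit 25), (nat_lit 72)), ((nat_lit 28), (nat_lit 80)), ((nat_lit 32), (nat_lit 96)), ((nat_lit 36), (nat_lit 129)), ((nat_lit 37), (nat_lit 130)), ((nat_lit 40), (nat_lit 136)), ((nat_lit 43), (nat_lit 144)), ((nat_lit 47), (nat_lit 160)), ((nat_lit 52), (nat_lit 192))],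
  [((nat_lit 1), (nat_lit 3)), ((nat_lit 2), (nat_lit 5)), ((nat_lit 3), (nat_lit 6)), ((nat_lit 7), (nat_lit 17)), ((nat_lit 8), (nat_lit 18)), ((nat_lit 9), (nat_lit 20)), ((nat_lit 13), (nat_lit 33)), ((nat_lit 14), (nat_lit 34)), ((nat_lit 15), (nat_lit 36)), ((nat_lit 19), (nat_lit 48)), ((nat_lit 23), (nat_lit 65)), ((nat_lit 24), (nat_lit 66)), ((nat_lit 25), (nat_lit 68)), ((nat_lit 29), (nat_lit 80)), ((nat_lit 33), (nat_lit 96)), ((nat_lit 38), (nat_lit 129)), ((nat_lit 39), (nat_lit 130)), ((nat_lit 40), (nat_lit 132)), ((nat_lit 44), (nat_lit 144)), ((nat_lit 48), (nat_lit 160)), ((nat_lit 53), (nat_lit 192))],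
  [((nat_lit 4), (nat_lit 3)), ((nat_lit 5), (nat_lit 5)), ((nat_lit 6), (nat_lit 6)), ((nat_lit 7), (nat_lit 9)), ((nat_lit 8), (nat_lit 10)), ((nat_lit 9), (nat_lit 12)), ((nat_lit 16), (nat_lit 33)), ((nat_lit 17), (nat_lit 34)), ((nat_lit 18), (nat_lit 36)), ((nat_lit 19), (nat_lit 40)), ((nat_lit 26), (nat_lit 65)), ((nat_lit 27), (nat_lit 66)), ((nat_lit 28), (nat_lit 68)), ((nat_lit 29), (nat_lit 72)), ((nat_lit 34), (nat_lit 96)), ((nat_lit 41), (nat_lit 129)), ((nat_lit 42), (nat_lit 130)), ((nat_lit 43), (nat_lit 132)), ((nat_lit 44), (nat_lit 136)), ((nat_lit 49), (nat_lit 160)), ((nat_lit 54), (nat_lit 192))],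
  [((nat_lit 10), (nat_lit 3)), ((nat_lit 11), (nat_lit 5)), ((nat_lit 12), (nat_lit 6)), ((nat_lit 13), (nat_lit 9)), ((nat_lit 14), (nat_lit 10)), ((nat_lit 15), (nat_lit 12)), ((nat_lit 16), (nat_lit 17)), ((nat_lit 17), (nat_lit 18)), ((nat_lit 18), (nat_lit 20)), ((nat_lit 19), (nat_lit 24)), ((nat_lit 30), (nat_lit 65)), ((nat_lit 31), (nat_lit 66)), ((nat_lit 32), (nat_lit 68)), ((nat_lit 33), (nat_lit 72)), ((nat_lit 34), (nat_lit 80)), ((nat_lit 45), (nat_lit 129)), ((nat_lit 46), (nat_lit 130)), ((nat_lit 47), (nat_lit 132)), ((nat_lit 48), (nat_lit 136)), ((nat_lit 49), (nat_lit 144)), ((nat_lit 55), (nat_lit 192))],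
  [((nat_lit 20), (nat_lit 3)), ((nat_lit 21), (nat_lit 5)), ((nat_lit 22), (nat_lit 6)), ((nat_lit 23), (nat_lit 9)), ((nat_lit 24), (nat_lit 10)), ((nat_lit 25), (nat_lit 12)), ((nat_lit 26), (nat_lit 17)), ((nat_lit 27), (nat_lit 18)), ((nat_lit 28), (nat_lit 20)), ((nat_lit 29), (nat_lit 24)), ((nat_lit 30), (nat_lit 33)), ((nat_lit 31), (nat_lit 34)), ((nat_lit 32), (nat_lit 36)), ((nat_lit 33), (nat_lit 40)), ((nat_lit 34), (nat_lit 48)), ((nat_lit 50), (nat_lit 129)), ((nat_lit 51), (nat_lit 130)), ((nat_lit 52), (nat_lit 132)), ((nat_lit 53), (nat_lit 136)), ((nat_lit 54), (nat_lit 144)), ((nat_lit 55), (nat_lit 160))],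
  [((nat_lit 35), (nat_lit 3)), ((nat_lit 36), (nat_lit 5)), ((nat_lit 37), (nat_lit 6)), ((nat_lit 38), (nat_lit 9)), ((nat_lit 39), (nat_lit 10)), ((nat_lit 40), (nat_lit 12)), ((nat_lit 41), (nat_lit 17)), ((nat_lit 42), (nat_lit 18)), ((nat_lit 43), (nat_lit 20)), ((nat_lit 44), (nat_lit 24)), ((nat_lit 45), (nat_lit 33)), ((nat_lit 46), (nat_lit 34)), ((nat_lit 47), (nat_lit 36)), ((nat_lit 48), (nat_lit 40)), ((nat_lit 49), (nat_lit 48)), ((nat_lit 50), (nat_lit 65)), ((nat_lit 51), (nat_lit 66)), ((nat_lit 52), (nat_lit 68)), ((nat_lit 53), (nat_lit 72)), ((nat_lit 54), (nat_lit 80)), ((nat_lit 55), (nat_lit 96))]]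

def reach (L : List ℕ) (R : ℕ) : ℕ :=
  List.rec (motive := fun _ => ℕ → ℕ) (fun R => R)
    (fun m _ ih R => Bool.rec (ih (Nat.lor R m)) (ih R) (Nat.beq (Nat.land R m) (nat_lit 0))) L R

def isSeparated (L : List ℕ) (R : ℕ) : Bool :=
  L.any (fun m => Nat.beq (Nat.land R m) 0) &&
    L.all (fun m => Nat.beq (Nat.land R m) 0 || Nat.beq (Nat.lor R m) R)

def isPinchedAt (C : ℕ) (T : List (ℕ × ℕ)) : Bool :=
  (fun L : List ℕ => List.rec false
    (fun m tl _ => isSeparated L (reach L (reach L (reach tl m)))) L)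
    (T.filterMap (fun tm => if Nat.testBit C tm.1 then some tm.2 else none))

def leafCheck (C : ℕ) : Bool :=
  goodMasks.any (Nat.beq C) || linkTable.any (isPinchedAt C)

def check7 (S : PointList) : Bool :=
  force (signMask S) (fun O => force (pierceMask fiveList7 O) (fun M =>
    edgeList stars7 M (fun U =>
      solve (fun C => solve (fun _ => false) 1 U .nil C C 0) 50 U .nil (nat_lit 34359738367) 0 0)))

def check8 (S : PointList) (order : List ℕ) : Bool :=
  force (signMask S) (fun O => force (pierceMask fiveList8 O) (fun M =>
    edgeList (reorder stars8 order) M (fun U =>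
      solve (fun C => solve leafCheck 1 U .nil C C 4) 100 U .nil (nat_lit 72057594037927935) 0 4)))

/-- All points of the cuboid. -/
def points : PointList :=
  (.cons (nat_lit 35) (nat_lit 1) (nat_lit 1) (nat_lit 2) (nat_lit 34359738368) (nat_lit 71288134650411636472032130822206696214541730312901589369873655221116947010413008921524050868489186799107818867043344507805757431091109267931292922768810057690466816867064872123460612643618816)
  (.cons (nat_lit 34) (nat_lit 1) (nat_lit 1) (nat_lit 1) (nat_lit 17179869184) (nat_lit 142576269300823272944064261644413392429083460625656846776451115218242563730523240373151369257334453506340995700229182320306381563499069685469317125780117683019613964613756600392332587372118016)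
  (.cons (nat_lit 33) (nat_lit 2) (nat_lit 1) (nat_lit 2) (nat_lit 8589934592) (nat_lit 1113877103915721015848803552611515085844467947674475984092165400086953633995643244486712579276640033182252825933927777600676399366603528858084324849888124864637353613110836202991759539568640)
  (.cons (nat_lit 32) (nat_lit 2) (nat_lit 1) (nat_lit 1) (nat_lit 4294967296) (nat_lit 2227754207831442031697607105223030171688935895346665531257821511292230960371871539569214019734533422044420427487108183891361436817711661742712411925357790570878375628490956323606808378736640)
  (.cons (nat_lit 31) (nat_lit 1) (nat_lit 2) (nat_lit 2) (nat_lit 2147483648) (nat_lit 278469275978170454968890022720580598820616958745026245272333793411392670517829398543394396234525310786124914538407355136893268685622133696528407225985626652017566547751376633112660950384640)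
  (.cons (nat_lit 30) (nat_lit 1) (nat_lit 2) (nat_lit 1) (nat_lit 1073741824) (nat_lit 556938551956340909937780045441161197641233917489480881313041824229069177301246888093686444336104523273889650166020034285213755519803082812292180295442433576810612808657338700082828688752640)
  (.cons (nat_lit 29) (nat_lit 1) (nat_lit 0) (nat_lit 2) (nat_lit 536870912) (nat_lit 17822033662602909118008018193855338361902869253515142930672148977575332156344848647937321644592801408261232871016188911114196634525008482684641120166855949542222314819367078710965705522544640)
  (.cons (nat_lit 28) (nat_lit 1) (nat_lit 0) (nat_lit 1) (nat_lit 268435456) (nat_lit 35644067325205818236016036387710676723805738506993702870520249149152831769901919612901778406158959828993280092034039938862147049282689887154881000656714774062416825303254558932091299052912640)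
  (.cons (nat_lit 27) (nat_lit 0) (nat_lit 1) (nat_lit 2) (nat_lit 134217728) (nat_lit 4455508415647688083528706667873383055916604733020960685429213914062807851192873077507353894824083552161657371709461437255614094464735728878558251020351763408660575307663341775172655529328640)
  (.cons (nat_lit 26) (nat_lit 0) (nat_lit 1) (nat_lit 1) (nat_lit 67108864) (nat_lit 8911016831295376167057413335746766111833209466032775623152421865132969331075256614583236703494732491465693558904552535250506011885345849793598609041664701230000385447758517268235743280496640)
  (.cons (nat_lit 25) (nat_lit 2) (nat_lit 2) (nat_lit 2) (nat_lit 33554432) (nat_lit 1087770609292696304539860716088566379709995780208506561358427335027757865668090753483849403983090873513449480782600266944257132558996980660923332409925400311127430157811446708089116426240)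
  (.cons (nat_lit 24) (nat_lit 2) (nat_lit 2) (nat_lit 1) (nat_lit 16777216) (nat_lit 2175541218585392609079721432177132759419991560414780274155810442632003684472060988499492158181798217294502375308605262032109589970689959760745676706912855360778019911999855738073896714240)
  (.cons (nat_lit 23) (nat_lit 2) (nat_lit 0) (nat_lit 2) (nat_lit 8388608) (nat_lit 17404329748683140872637542012813539537629804132356036143296662314853308323712705297565089900414253809308040173548939244454516582131452738649259989848017719809855200031139862164464824483840)
  (.cons (nat_lit 22) (nat_lit 2) (nat_lit 0) (nat_lit 1) (nat_lit 4194304) (nat_lit 34808659497366281745275084025627079075259608264676346709616616990930424368576587617630037466317292561003312075470972479251909370109992944144038894598093860806072608288700710570086985891840)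
  (.cons (nat_lit 21) (nat_lit 0) (nat_lit 2) (nat_lit 2) (nat_lit 2097152) (nat_lit 4351082437155945394071056592310635171175367815663406163696234512420877309871306614738086199116988501471270794041934494263277674302174052858645372449982924558494381047966864340395795415040)
  (.cons (nat_lit 20) (nat_lit 0) (nat_lit 2) (nat_lit 1) (nat_lit 1048576) (nat_lit 8702164874311890788142113184621270342350735631317880933148322576606748286941570860263894002777962934801085847638392507779319082136229184981700442796344492850257121399950445515464418263040)
  (.cons (nat_lit 19) (nat_lit 0) (nat_lit 0) (nat_lit 2) (nat_lit 524288) (nat_lit 69617318994495126305135987698556075718065140447379886465499699607762456157197875336067593695423363317235630110993656779913653286952571048603874833663485925896842560200162425702061129072640)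
  (.cons (nat_lit 18) (nat_lit 0) (nat_lit 0) (nat_lit 1) (nat_lit 262144) (nat_lit 139234637988990252610271975397112151436130280894616870623093056043764812873487494030278121582583611387593614266393438705191459823039144479486500149645444491920807090978104344520189853040640)
  (.cons (nat_lit 17) (nat_lit 1) (nat_lit 1) (nat_lit 3) (nat_lit 131072) (nat_lit 271942652322432084930542491234614167078177376987081868628973599323718822518970523534866527055699107357436442821668031722281484341015278884625598612857094031106822268932589996808855486464)
  (.cons (nat_lit 16) (nat_lit 1) (nat_lit 1) (nat_lit 0) (nat_lit 65536) (nat_lit 543885304644864169861084982469228334156354753973605525117687664864511732980816804401975132970178426766742689896504143983102346662517813436391132834549399120405631884055162812775926923264)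
  (.cons (nat_lit 15) (nat_lit 2) (nat_lit 1) (nat_lit 3) (nat_lit 32768) (nat_lit 4249103942549594939608778200574932425859329024026779114121114349696936164839337327906465832811889775017749122367583380129533383814252963478410052680542468508290686085170121013609922560)
  (.cons (nat_lit 14) (nat_lit 2) (nat_lit 1) (nat_lit 0) (nat_lit 16384) (nat_lit 8498207885099189879217556401149864851718658048044836163550649686020778504836546095158439711511739433458024702022965179028936145087095877619599960042411005290521147264446091932704194560)
  (.cons (nat_lit 13) (nat_lit 1) (nat_lit 2) (nat_lit 3) (nat_lit 8192) (nat_lit 1062275985634500331759986964113542933733432612400155049409232305188723260947530359433724961221791499275684030679349346683095049612511191164125088600103861435003534499173647434664386560)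
  (.cons (nat_lit 12) (nat_lit 1) (nat_lit 2) (nat_lit 0) (nat_lit 4096) (nat_lit 2124551971269000663519973928227085867466865224798129582645575806537892064290034820914026048035066693397101021446304452076773664550030070542496415311593756015055133089665751266795458560)
  (.cons (nat_lit 11) (nat_lit 1) (nat_lit 0) (nat_lit 3) (nat_lit 2048) (nat_lit 67985663080608021232635567450925210425960042013226100657166095648099259019259829131840979174014287598652774318756824154335772073841127329577030640284942434471978434827297510951865026560)
  (.cons (nat_lit 10) (nat_lit 1) (nat_lit 0) (nat_lit 0) (nat_lit 1024) (nat_lit 135971326161216042465271134901850420851920084026312648279267307850467040137870481921774972557674254718754883163582000499199474522715339230174564364077433677911441136563318477371564098560)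
  (.cons (nat_lit 9) (nat_lit 0) (nat_lit 1) (nat_lit 3) (nat_lit 512) (nat_lit 16996415770140411695589853927129299377123278553088991872517448097468596844455234823254981593414625366827611433828206776640373590334837832941277507859618238100664426069882742977800962560)
  (.cons (nat_lit 8) (nat_lit 0) (nat_lit 1) (nat_lit 0) (nat_lit 256) (nat_lit 33992831540280823391179707854258598754246557106143095486268699131519200634289766748745867551783494916785024867647371426584266707936652564215082584540041737480165044585260457108443234560)
  (.cons (nat_lit 7) (nat_lit 2) (nat_lit 2) (nat_lit 3) (nat_lit 128) (nat_lit 4149515568896088808211748947481408614006026383241678471978864040480643713638651861129186263973582738927648471002961223389652757869708941119855241431905366177091332083936487991672960)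
  (.cons (nat_lit 6) (nat_lit 2) (nat_lit 2) (nat_lit 0) (nat_lit 64) (nat_lit 8299031137792177616423497894962817228012052766474839302657357950714125383270496324537247307517235631158837796434804008606375083811530913393957812144900723879921035430907652809424960)
  (.cons (nat_lit 5) (nat_lit 2) (nat_lit 0) (nat_lit 3) (nat_lit 32) (nat_lit 66392249102337420931387107898000867987174240617202896664797448405659898085451909246693000413567557561142121023364788987939897850538073496434249839202948455085202026485976647050723360)
  (.cons (nat_lit 4) (nat_lit 2) (nat_lit 0) (nat_lit 0) (nat_lit 16) (nat_lit 132784498204674841862774215796001735974348481234269511068788974727365205263429975958366536965626878971112488080867662350661885719718906189514308527366996234154024537234118311195705360)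
  (.cons (nat_lit 3) (nat_lit 0) (nat_lit 2) (nat_lit 3) (nat_lit 8) (nat_lit 16598062275527745796474672669642010388089629423764824538025796937640675773129679163887352749317125326047022987525690056851492593010612689432698716926509569391229175750606019364913160)
  (.cons (nat_lit 2) (nat_lit 0) (nat_lit 2) (nat_lit 0) (nat_lit 4) (nat_lit 33196124551055491592949345339284020776179258847495578510850229555537217281118663254790855418311931361393302336267061263196255043549458255698014994798067065621403203582574636518342660)
  (.cons (nat_lit 1) (nat_lit 0) (nat_lit 0) (nat_lit 3) (nat_lit 2) (nat_lit 265568996408443932743591261667465498802433549680251642095564649992990326527396680206556677610104993122999687618231417770056355617342266268172740301755851462924356690216684058006519810)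
  (.cons (nat_lit 0) (nat_lit 0) (nat_lit 0) (nat_lit 0) (nat_lit 1) (nat_lit 531137992816887865487182523334930997604867099359958155147907470870074511999082542534935461359342999983190972390722040959134902279049470823236466024953630416568020213997285249787101185) .nil))))))))))))))))))))))))))))))))))))

def pointOf (c : ℕ) (k : ℕ → ℕ → ℕ → ℕ → ℕ → ℕ → PointList) : PointList :=
  PointList.rec .nil (fun c' x y z w im _ ih => Bool.rec ih (k c' x y z w im) (Nat.beq c c')) points

def ofIndices (l : List ℕ) : PointList :=
  List.rec .nil (fun c _ ih => pointOf c (fun c x y z w im => .cons c x y z w im ih)) l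

def totalWeight (R : PointList) : ℕ :=
  PointList.rec (nat_lit 0) (fun _ _ _ _ w _ _ ih => Nat.add w ih) R

def count (R : PointList) : ℕ :=
  PointList.rec (nat_lit 0) (fun _ _ _ _ _ _ _ ih => Nat.add ih (nat_lit 1)) R

def indices (R : PointList) : List ℕ :=
  PointList.rec [] (fun c _ _ _ _ _ _ ih => c :: ih) R

/-- Whether one of the sixteen packed weights exceeds `b`. -/
def exceeds (im b : ℕ) : Bool :=
  Bool.rec true false (Nat.beq (nat_lit 0) (Nat.land
    (Nat.add im (Nat.mul (nat_lit 4149515568884766920937232837442232774020040542402584807061061931295931780496151366866260070932401194886165022370260496548379674293686382654910946896395330563926463587380741422448641) (Nat.sub (nat_lit 549755813887) b)))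
    (nat_lit 2281220308813172367105028186310614278865335370011289985560797551353168114569986659143204481342118829924787355384240286166529482608961908836273173851188562567574195002462095706835127466834526208)))

def indexListEq (a b : List ℕ) : Bool :=
  List.rec (motive := fun _ => List ℕ → Bool) (fun b => List.rec true (fun _ _ _ => false) b)
    (fun x _ ih b => List.rec false (fun y tl _ => Bool.rec false (ih tl) (Nat.beq x y)) b) a b

def memLists (a : List ℕ) (L : List (List ℕ)) : Bool :=
  List.rec false (fun b _ ih => Bool.rec ih true (indexListEq a b)) L

def configurations : List (List ℕ) := [
  [0, 3, 11, 12, 25, 32, 33, 35],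
  [0, 5, 6, 9, 28, 31, 33, 35],
  [4, 12, 18, 21, 26, 30, 33, 35],
  [0, 3, 5, 12, 25, 26, 33, 35],
  [0, 9, 11, 12, 22, 25, 33, 35],
  [4, 11, 12, 15, 18, 21, 33, 35],
  [0, 3, 5, 8, 11, 25, 32, 35],
  [1, 2, 5, 8, 10, 25, 32, 35],
  [2, 11, 12, 14, 18, 24, 32, 35],
  [2, 4, 11, 12, 18, 24, 32, 35],
  [0, 7, 11, 13, 14, 20, 32, 35],
  [3, 6, 11, 18, 26, 31, 32, 33],
  [7, 11, 17, 18, 21, 31, 32, 33],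
  [1, 7, 11, 12, 16, 21, 32, 33],
  [0, 5, 11, 12, 16, 21, 32, 33],
  [1, 4, 11, 12, 16, 21, 32, 33],
  [1, 2, 4, 10, 13, 17, 32, 33],
  [1, 7, 15, 16, 21, 28, 31, 33],
  [1, 4, 7, 9, 21, 28, 31, 33],
  [6, 15, 16, 19, 20, 28, 31, 33],
  [1, 4, 9, 15, 20, 28, 31, 33],
  [0, 3, 6, 9, 15, 28, 31, 33],
  [1, 4, 7, 9, 12, 28, 31, 33],
  [0, 5, 6, 9, 12, 28, 31, 33],
  [0, 3, 11, 16, 22, 25, 31, 33],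
  [1, 8, 13, 16, 23, 24, 31, 33],
  [0, 9, 10, 13, 23, 24, 31, 33],
  [7, 9, 12, 17, 18, 23, 31, 33],
  [2, 7, 9, 17, 18, 23, 31, 33],
  [1, 6, 8, 13, 16, 23, 31, 33],
  [5, 9, 12, 17, 19, 25, 30, 33],
  [5, 9, 10, 17, 19, 25, 30, 33],
  [7, 9, 12, 17, 18, 23, 30, 33],
  [0, 3, 9, 12, 17, 22, 30, 33],
  [0, 3, 6, 9, 10, 22, 30, 33],
  [0, 3, 5, 9, 10, 14, 30, 33],
  [1, 2, 4, 7, 9, 10, 30, 33],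
  [0, 9, 11, 12, 22, 25, 27, 33],
  [0, 3, 5, 11, 16, 25, 26, 33],
  [0, 4, 12, 13, 17, 24, 26, 33],
  [0, 4, 11, 13, 16, 24, 26, 33],
  [0, 4, 9, 11, 13, 24, 26, 33],
  [0, 5, 6, 12, 13, 17, 26, 33],
  [1, 2, 4, 12, 13, 17, 26, 33],
  [0, 5, 9, 10, 13, 20, 25, 33],
  [0, 4, 9, 11, 12, 20, 25, 33],
  [10, 13, 15, 16, 18, 21, 24, 33],
  [0, 11, 12, 15, 17, 21, 24, 33],
  [0, 4, 11, 12, 17, 21, 24, 33],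
  [1, 4, 10, 12, 17, 21, 24, 33],
  [1, 10, 13, 15, 16, 21, 24, 33],
  [1, 2, 4, 10, 13, 17, 24, 33],
  [0, 4, 9, 11, 12, 13, 24, 33],
  [1, 2, 4, 9, 10, 13, 24, 33],
  [4, 11, 12, 15, 17, 18, 21, 33],
  [7, 11, 12, 14, 17, 18, 21, 33],
  [4, 7, 11, 12, 17, 18, 21, 33],
  [0, 5, 10, 13, 14, 17, 21, 33],
  [1, 4, 11, 12, 15, 16, 21, 33],
  [1, 4, 7, 11, 12, 16, 21, 33],
  [0, 5, 10, 13, 14, 17, 20, 33],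
  [0, 5, 6, 10, 13, 17, 20, 33],
  [0, 4, 9, 11, 12, 13, 20, 33],
  [10, 12, 15, 17, 19, 20, 22, 25],
  [9, 10, 12, 15, 19, 20, 22, 25]]

def explore (f : PointList → PairList → ℕ → ℕ → PointList → Bool)
    (S : PointList) (Q : PairList) (ws ims : ℕ) (R : PointList) : Bool :=
  PointList.rec true (fun c x y z w im tl ih => Bool.rec false ih
    (f (.cons c x y z w im S) (addPairs S x y z Q) (Nat.add ws w) (Nat.add ims im)
      (keepGeneral Q x y z tl))) R

/-- Search the subsets of the cuboid in general position that extend `S` by points of `R`. -/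
def search (fuel : ℕ) : PointList → PairList → ℕ → ℕ → PointList → Bool :=
  Nat.rec (fun _ _ _ _ _ => false)
    (fun k ih S Q ws ims R =>
      Bool.rec
        (Bool.rec true
          (Bool.rec false (explore ih S Q ws ims R)
            (Bool.rec (Bool.rec true (check7 S) (Nat.beq k (nat_lit 1)))
              (memLists (indices S) configurations) (Nat.beq k (nat_lit 0))))
          (Nat.ble (nat_lit 7) (Nat.add (count R) (Nat.sub (nat_lit 8) k))))
        true (exceeds ims (Nat.add ws (totalWeight R)))) fuel

def headIn (lo hi : ℕ) (S : PointList) : Bool :=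
  PointList.rec false (fun c _ _ _ _ _ _ _ => Nat.ble lo c && Nat.ble c hi) S

/-- The part of the search where the first point has index in `[lo, hi]` and the second one has
index in `[lo', hi']`. -/
def searchPart (lo hi lo' hi' : ℕ) : Bool :=
  explore (fun S Q ws ims R => Bool.rec true
    (explore (fun S Q ws ims R => Bool.rec true (search 7 S Q ws ims R) (headIn lo' hi' S))
      S Q ws ims R) (headIn lo hi S)) .nil .nil 0 0 points

end

end CuboidTorus

namespace CuboidTorus

theorem testBit_land_pred {x : ℕ} (hx : x ≠ 0) :
    ∃ i, x.testBit i = true ∧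
      ∀ k, (Nat.land x (Nat.pred x)).testBit k = true ↔ x.testBit k = true ∧ k ≠ i := by
  induction x using Nat.strong_induction_on with
  | _ x ih =>
    rcases Nat.even_or_odd' x with ⟨m, rfl | rfl⟩
    · have hm : m ≠ 0 := by omega
      obtain ⟨i, hi, h⟩ := ih m (by omega) hm
      refine ⟨i + 1, by simpa [Nat.testBit_succ] using hi, fun k => ?_⟩
      have hp : Nat.pred (2 * m) = 2 * Nat.pred m + 1 := by
        simp only [Nat.pred_eq_sub_one]; omega
      rw [hp]
      change (2 * m &&& (2 * Nat.pred m + 1)).testBit k = true ↔ _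
      rw [Nat.testBit_and]
      cases k with
      | zero => simp
      | succ k =>
        have h1 : (2 * Nat.pred m + 1) / 2 = Nat.pred m := by omega
        have h2 : 2 * m / 2 = m := by omega
        have := h k
        change (m &&& Nat.pred m).testBit k = true ↔ _ at this
        rw [Nat.testBit_and] at this
        simp only [Nat.testBit_succ, h1, h2]
        rw [this]
        simp
    · refine ⟨0, by simp, fun k => ?_⟩
      change (2 * m + 1 &&& Nat.pred (2 * m + 1)).testBit k = true ↔ _
      rw [Nat.testBit_and]
      cases k with
      | zero => simp
      | succ k =>
        have h1 : (2 * m + 1) / 2 = m := by omega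
        have h2 : Nat.pred (2 * m + 1) / 2 = m := by simp
        simp only [Nat.testBit_succ, h1, h2]
        simp

theorem testBit_ne_zero {x i : ℕ} (h : x.testBit i = true) : x ≠ 0 := by
  rintro rfl; simp at h

theorem land_pred_ne_zero {x i j : ℕ} (hi : x.testBit i = true) (hj : x.testBit j = true)
    (hij : i ≠ j) : Nat.land x (Nat.pred x) ≠ 0 := by
  obtain ⟨a, _, h⟩ := testBit_land_pred (testBit_ne_zero hi)
  by_cases hia : i = a
  · exact testBit_ne_zero ((h j).2 ⟨hj, by rintro rfl; exact hij hia⟩)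
  · exact testBit_ne_zero ((h i).2 ⟨hi, hia⟩)

theorem land_testBit {x y i : ℕ} :
    (Nat.land x y).testBit i = true ↔ x.testBit i = true ∧ y.testBit i = true := by
  change (x &&& y).testBit i = true ↔ _
  simp

theorem lor_testBit {x y i : ℕ} :
    (Nat.lor x y).testBit i = true ↔ x.testBit i = true ∨ y.testBit i = true := by
  change (x ||| y).testBit i = true ↔ _
  simp

theorem xor_testBit {x y i : ℕ} :
    (Nat.xor x y).testBit i = true ↔ ¬ (x.testBit i = true ↔ y.testBit i = true) := by
  change (x ^^^ y).testBit i = true ↔ _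
  rw [Nat.testBit_xor]
  cases x.testBit i <;> cases y.testBit i <;> simp

theorem land_eq_zero {x y : ℕ} (h : Nat.land x y = 0) {i : ℕ} (hx : x.testBit i = true) :
    ¬ y.testBit i = true := fun hy => by
  have := land_testBit.2 ⟨hx, hy⟩
  rw [h] at this
  simp at this

theorem exists_testBit {x : ℕ} (h : x ≠ 0) : ∃ i, x.testBit i = true :=
  let ⟨i, hi, _⟩ := testBit_land_pred h
  ⟨i, hi⟩

theorem land_ne_zero {x y : ℕ} (h : Nat.land x y ≠ 0) :
    ∃ i, x.testBit i = true ∧ y.testBit i = true :=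
  let ⟨i, hi⟩ := exists_testBit h
  ⟨i, land_testBit.1 hi⟩

/-- No element of `T` belongs to the mask `s`. -/
def Absent (T : Set ℕ) (s : ℕ) : Prop := ∀ i ∈ T, ¬ s.testBit i = true

/-- The edge with star `s` that pierces the triangles of `p` is either absent, or contained in
exactly two triangles of `T` and piercing none of them. -/
def EdgeOK (T : Set ℕ) (s p : ℕ) : Prop :=
  Absent T s ∨
    ((∃ a b, a ≠ b ∧ ∀ i, (i ∈ T ∧ s.testBit i = true) ↔ i = a ∨ i = b) ∧
      ∀ i ∈ T, ¬ p.testBit i = true)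

namespace EdgeList

def All (Pr : ℕ → ℕ → ℕ → Prop) : EdgeList → Prop
  | nil => True
  | cons s p q tl => Pr s p q ∧ All Pr tl

def Covers (i : ℕ) : EdgeList → Prop
  | nil => False
  | cons s _ _ tl => s.testBit i = true ∨ Covers i tl

open Classical in
noncomputable def absentCount (T : Set ℕ) : EdgeList → ℕ
  | nil => 0
  | cons s _ _ tl => (if Absent T s then 1 else 0) + absentCount T tl

end EdgeList

/-- The state of the solver is compatible with the set of triangles `T`; the triangles in `E` and
`m` absent edges are accounted for elsewhere. -/
structure Compatible (T E : Set ℕ) (m A C r : ℕ) (U P : EdgeList) : Prop where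
  lower : ∀ i, C.testBit i = true → i ∈ T
  upper : ∀ i ∈ T, A.testBit i = true
  undecided : U.All fun s p q => q = Nat.lor s p ∧ EdgeOK T s p
  present : P.All fun s p _ => EdgeOK T s p ∧ ¬ Absent T s
  budget : U.absentCount T + m ≤ r
  cover : ∀ i ∈ T, C.testBit i = true ∨ U.Covers i ∨ P.Covers i ∨ i ∈ E

variable {T : Set ℕ}

theorem absent_of_le_one {A s p : ℕ} (hA : ∀ i ∈ T, A.testBit i = true) (h : EdgeOK T s p)
    (h0 : Nat.land (Nat.land A s) (Nat.pred (Nat.land A s)) = 0) : Absent T s := by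
  rcases h with h | ⟨⟨a, b, hab, h⟩, _⟩
  · exact h
  · obtain ⟨ha, ha'⟩ := (h a).2 (Or.inl rfl)
    obtain ⟨hb, hb'⟩ := (h b).2 (Or.inr rfl)
    exact absurd h0 (land_pred_ne_zero (land_testBit.2 ⟨hA _ ha, ha'⟩)
      (land_testBit.2 ⟨hA _ hb, hb'⟩) hab)

theorem beq_true {a b : ℕ} (h : Nat.beq a b = true) : a = b := Nat.eq_of_beq_eq_true h
theorem beq_false {a b : ℕ} (h : Nat.beq a b = false) : a ≠ b := Nat.ne_of_beq_eq_false h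

theorem Compatible.drop_absent {E : Set ℕ} {m A C r s p q : ℕ} {U P : EdgeList}
    (h : Compatible T (E ∪ {i | s.testBit i = true}) (m + 1) A C r U P) (hs : Absent T s) :
    r ≠ 0 ∧ Compatible T E m (Nat.xor A (Nat.land A s)) C (Nat.pred r) U P ∧
      Compatible T E (m + 1) A C r U P ∧ (q = p → True) := by
  have hb := h.budget
  have hcov : ∀ i ∈ T, C.testBit i = true ∨ U.Covers i ∨ P.Covers i ∨ i ∈ E := by
    intro i hi
    rcases h.cover i hi with h1 | h1 | h1 | h1 | h1
    · exact Or.inl h1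
    · exact Or.inr (Or.inl h1)
    · exact Or.inr (Or.inr (Or.inl h1))
    · exact Or.inr (Or.inr (Or.inr h1))
    · exact absurd h1 (hs i hi)
  refine ⟨by omega, ⟨h.lower, ?_, h.undecided, h.present, ?_, hcov⟩,
    ⟨h.lower, h.upper, h.undecided, h.present, hb, hcov⟩, fun _ => trivial⟩
  · intro i hi
    rw [xor_testBit, land_testBit]
    have h1 := h.upper i hi
    have h2 := hs i hi
    tauto
  · rw [Nat.pred_eq_sub_one]; omega

theorem Compatible.make_present {E : Set ℕ} {m m' A C r s p q : ℕ} {U P : EdgeList}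
    (h : Compatible T (E ∪ {i | s.testBit i = true}) m' A C r U P) (hm : m ≤ m')
    (he : EdgeOK T s p) (hs : ¬ Absent T s) :
    Compatible T E m (Nat.xor A (Nat.land A p)) C r U (.cons s p q P) := by
  refine ⟨h.lower, ?_, h.undecided, ⟨⟨he, hs⟩, h.present⟩, ?_, ?_⟩
  · intro i hi
    rw [xor_testBit, land_testBit]
    have h1 := h.upper i hi
    rcases he with he | he
    · exact absurd he hs
    · have h2 := he.2 i hi
      tauto
  · have := h.budget; omega
  · intro i hi
    rcases h.cover i hi with h1 | h1 | h1 | h1 | h1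
    · exact Or.inl h1
    · exact Or.inr (Or.inl h1)
    · exact Or.inr (Or.inr (Or.inl (Or.inr h1)))
    · exact Or.inr (Or.inr (Or.inr h1))
    · exact Or.inr (Or.inr (Or.inl (Or.inl h1)))

theorem Compatible.push_head {E : Set ℕ} {m A C r s p q : ℕ} {U P : EdgeList}
    (h : Compatible T E m A C r (.cons s p q U) P) :
    ∃ m', Compatible T (E ∪ {i | s.testBit i = true}) m' A C r U P ∧ m ≤ m' ∧
      (Absent T s → m' = m + 1) ∧ q = Nat.lor s p ∧ EdgeOK T s p ∧
      (¬ Absent T s → m' = m) := by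
  classical
  have hb := h.budget
  refine ⟨m + (if Absent T s then 1 else 0), ⟨h.lower, h.upper, h.undecided.2, h.present, ?_, ?_⟩,
    by omega, fun hs => by simp [hs], h.undecided.1.1, h.undecided.1.2, fun hs => by simp [hs]⟩
  · rw [EdgeList.absentCount] at hb; split_ifs at hb ⊢ <;> omega
  · intro i hi
    rcases h.cover i hi with h1 | (h1 | h1) | h1 | h1
    · exact Or.inl h1
    · exact Or.inr (Or.inr (Or.inr (Or.inr h1)))
    · exact Or.inr (Or.inl h1)
    · exact Or.inr (Or.inr (Or.inl h1))
    · exact Or.inr (Or.inr (Or.inr (Or.inl h1)))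

theorem sweepUndecided_sound (U : EdgeList) : ∀ (E : Set ℕ) (m A C r : ℕ) (P : EdgeList)
    (k : ℕ → ℕ → ℕ → EdgeList → EdgeList → Bool), Compatible T E m A C r U P →
    sweepUndecided U A C r P k = true →
    ∃ A' C' r' U' P', Compatible T E m A' C' r' U' P' ∧ k A' C' r' U' P' = true := by
  induction U with
  | nil => exact fun E m A C r P k h hk => ⟨A, C, r, .nil, P, h, hk⟩
  | cons s p q tl ih =>
    intro E m A C r P k h hk
    obtain ⟨m', h', hm, habs, hq, he, hpre⟩ := h.push_head
    obtain ⟨A', C', r', U', P', hc, hk'⟩ := ih _ m' A C r P _ h' hk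
    have dropIt : Absent T s →
        Bool.rec (motive := fun _ => Bool) (k (Nat.xor A' (Nat.land A' s)) C' (Nat.pred r') U' P')
          true (Nat.beq r' 0) = true →
        ∃ A' C' r' U' P', Compatible T E m A' C' r' U' P' ∧ k A' C' r' U' P' = true := by
      intro ha hd
      rw [habs ha] at hc
      obtain ⟨h1, h2, _⟩ := hc.drop_absent (q := 0) (p := 0) ha
      cases hr : Nat.beq r' 0 with
      | true => exact absurd (beq_true hr) h1
      | false => rw [hr] at hd; exact ⟨_, _, _, _, _, h2, hd⟩
    dsimp only at hk'
    cases h1 : Nat.beq (Nat.land (Nat.land A' s) (Nat.pred (Nat.land A' s))) 0 with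
    | true =>
      rw [h1] at hk'
      exact dropIt (absent_of_le_one hc.upper he (beq_true h1)) hk'
    | false =>
      rw [h1] at hk'
      cases h2 : Nat.beq (Nat.land C' q) 0 with
      | true =>
        rw [h2] at hk'
        refine ⟨A', C', r', .cons s p q U', P', ⟨hc.lower, hc.upper, ⟨⟨hq, he⟩, hc.undecided⟩,
          hc.present, ?_, ?_⟩, hk'⟩
        · have hb := hc.budget
          rw [EdgeList.absentCount]
          split_ifs with ha
          · rw [habs ha] at hb; omega
          · rw [hpre ha] at hb; omega
        · intro i hi
          rcases hc.cover i hi with h1 | h1 | h1 | h1 | h1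
          · exact Or.inl h1
          · exact Or.inr (Or.inl (Or.inr h1))
          · exact Or.inr (Or.inr (Or.inl h1))
          · exact Or.inr (Or.inr (Or.inr h1))
          · exact Or.inr (Or.inl (Or.inl h1))
      | false =>
        rw [h2] at hk'
        obtain ⟨i, hi, hi'⟩ := land_ne_zero (beq_false h2)
        cases h3 : Nat.beq (Nat.land C' p) 0 with
        | true =>
          rw [h3] at hk'
          rw [hq, lor_testBit] at hi'
          have hs : s.testBit i = true := hi'.resolve_right (land_eq_zero (beq_true h3) hi)
          have hna : ¬ Absent T s := fun ha => ha i (hc.lower i hi) hs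
          exact ⟨_, _, _, _, _, hc.make_present hm he hna, hk'⟩
        | false =>
          rw [h3] at hk'
          obtain ⟨j, hj, hj'⟩ := land_ne_zero (beq_false h3)
          have ha : Absent T s := he.resolve_right fun h => h.2 j (hc.lower j hj) hj'
          exact dropIt ha hk'

theorem declareAll_sound (U : EdgeList) : ∀ (A C : ℕ) (P : EdgeList)
    (k : ℕ → EdgeList → Bool), Compatible T ∅ 0 A C 0 U P →
    declareAll U A P k = true → ∃ A' P', Compatible T ∅ 0 A' C 0 .nil P' ∧ k A' P' = true := by
  induction U with
  | nil => exact fun A C P k h hk => ⟨A, P, h, hk⟩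
  | cons s p q tl ih =>
    intro A C P k h hk
    obtain ⟨m', h', hm, habs, hq, he, hpre⟩ := h.push_head
    have hna : ¬ Absent T s := fun ha => by
      have := h'.budget; rw [habs ha] at this; omega
    exact ih _ C _ _ (h'.make_present hm he hna) hk

theorem sweepPresent_sound (P : EdgeList) : ∀ (E : Set ℕ) (A C r : ℕ) (U : EdgeList)
    (k : ℕ → ℕ → EdgeList → Bool), Compatible T E 0 A C r U P →
    sweepPresent P A C k = true →
    ∃ A' C' P', Compatible T E 0 A' C' r U P' ∧ k A' C' P' = true := by
  induction P with
  | nil => exact fun E A C r U k h hk => ⟨A, C, .nil, h, hk⟩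
  | cons s p q tl ih =>
    intro E A C r U k h hk
    have h' : Compatible T (E ∪ {i | s.testBit i = true}) 0 A C r U tl :=
      ⟨h.lower, h.upper, h.undecided, h.present.2, h.budget, fun i hi => by
        rcases h.cover i hi with h1 | h1 | (h1 | h1) | h1
        · exact Or.inl h1
        · exact Or.inr (Or.inl h1)
        · exact Or.inr (Or.inr (Or.inr (Or.inr h1)))
        · exact Or.inr (Or.inr (Or.inl h1))
        · exact Or.inr (Or.inr (Or.inr (Or.inl h1)))⟩
    obtain ⟨he, hna⟩ := h.present.1
    obtain ⟨⟨a, b, hab, hT⟩, hp⟩ := he.resolve_left hna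
    obtain ⟨A', C', P', hc, hk'⟩ := ih _ A C r U _ h' hk
    obtain ⟨haT, has⟩ := (hT a).2 (Or.inl rfl)
    obtain ⟨hbT, hbs⟩ := (hT b).2 (Or.inr rfl)
    have hax := land_testBit.2 ⟨hc.upper a haT, has⟩
    have hbx := land_testBit.2 ⟨hc.upper b hbT, hbs⟩
    dsimp only at hk'
    generalize hx : Nat.land A' s = x at *
    generalize hy : Nat.land x (Nat.pred x) = y at *
    obtain ⟨i1, hi1, hy1⟩ := testBit_land_pred (testBit_ne_zero hax)
    rw [hy] at hy1
    have hy0 : y ≠ 0 := hy ▸ land_pred_ne_zero hax hbx hab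
    cases h1 : Nat.beq (Nat.land y (Nat.pred y)) 0 with
    | true =>
      rw [h1] at hk'
      cases h2 : Nat.beq y 0 with
      | true => exact absurd (beq_true h2) hy0
      | false =>
        rw [h2] at hk'
        have hsub : ∀ i, x.testBit i = true → i = a ∨ i = b := by
          intro i hi
          by_contra hne
          push Not at hne
          -- among a, b, i two differ from i1
          have two : ∀ u v, x.testBit u = true → x.testBit v = true → u ≠ v → u ≠ i1 → v ≠ i1 →
              False := fun u v hu hv huv hu1 hv1 =>
            land_pred_ne_zero ((hy1 u).2 ⟨hu, hu1⟩) ((hy1 v).2 ⟨hv, hv1⟩) huv (beq_true h1)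
          by_cases ha1 : a = i1
          · exact two b i hbx hi (Ne.symm hne.2) (fun h => hab (ha1.trans h.symm))
              (fun h => hne.1 (h.trans ha1.symm))
          · by_cases hb1 : b = i1
            · exact two a i hax hi (Ne.symm hne.1) ha1 (fun h => hne.2 (h.trans hb1.symm))
            · exact two a b hax hbx hab ha1 hb1
        refine ⟨_, _, _, ⟨fun i hi => ?_, hc.upper, hc.undecided, hc.present, hc.budget, ?_⟩, hk'⟩
        · rcases lor_testBit.1 hi with h | h
          · exact hc.lower i h
          · rcases hsub i h with rfl | rfl <;> assumption
        · intro i hi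
          rcases hc.cover i hi with h1 | h1 | h1 | h1 | h1
          · exact Or.inl (lor_testBit.2 (Or.inl h1))
          · exact Or.inr (Or.inl h1)
          · exact Or.inr (Or.inr (Or.inl h1))
          · exact Or.inr (Or.inr (Or.inr h1))
          · exact Or.inl (lor_testBit.2 (Or.inr (hx ▸ land_testBit.2 ⟨hc.upper i hi, h1⟩)))
    | false =>
      rw [h1] at hk'
      generalize ht : Nat.land C' x = t at *
      generalize ht1 : Nat.land t (Nat.pred t) = t1 at *
      have htT : ∀ i, t.testBit i = true → i = a ∨ i = b := by
        intro i hi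
        rw [← ht, land_testBit, ← hx, land_testBit] at hi
        exact (hT i).1 ⟨hc.lower i hi.1, hi.2.2⟩
      cases h2 : Nat.beq t1 0 with
      | true =>
        rw [h2] at hk'
        refine ⟨A', C', .cons s p q P', ⟨hc.lower, hc.upper, hc.undecided, ⟨⟨he, hna⟩, hc.present⟩,
          hc.budget, ?_⟩, hk'⟩
        intro i hi
        rcases hc.cover i hi with h1 | h1 | h1 | h1 | h1
        · exact Or.inl h1
        · exact Or.inr (Or.inl h1)
        · exact Or.inr (Or.inr (Or.inl (Or.inr h1)))
        · exact Or.inr (Or.inr (Or.inr h1))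
        · exact Or.inr (Or.inr (Or.inl (Or.inl h1)))
      | false =>
        rw [h2] at hk'
        have htne : t ≠ 0 := by
          rintro rfl
          exact beq_false h2 (ht1.symm.trans rfl)
        obtain ⟨j, hj, hjt⟩ := testBit_land_pred htne
        rw [ht1] at hjt
        obtain ⟨j', hj'⟩ := exists_testBit (beq_false h2)
        obtain ⟨hj't, hjj⟩ := (hjt j').1 hj'
        have hall : ∀ i, i = a ∨ i = b → t.testBit i = true := by
          intro i hi
          have e1 := htT j hj
          have e2 := htT j' hj't
          rcases hi with rfl | rfl <;> rcases e1 with rfl | rfl <;> rcases e2 with rfl | rfl <;>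
            first | assumption | exact absurd rfl hjj
        have hone : Nat.land t1 (Nat.pred t1) = 0 := by
          by_contra hne
          obtain ⟨u, hu, h3⟩ := testBit_land_pred (beq_false h2)
          obtain ⟨u', hu'⟩ := exists_testBit hne
          obtain ⟨hu't, huu⟩ := (h3 u').1 hu'
          obtain ⟨hut, huj⟩ := (hjt u).1 hu
          obtain ⟨hu'tt, hu'j⟩ := (hjt u').1 hu't
          have e1 := htT j hj
          have e2 := htT u hut
          have e3 := htT u' hu'tt
          rcases e1 with rfl | rfl <;> rcases e2 with rfl | rfl <;> rcases e3 with rfl | rfl <;>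
            first | exact huu rfl | exact huj rfl | exact hu'j rfl
        have h4 : Nat.beq (Nat.land t1 (Nat.pred t1)) 0 = true := by rw [hone]; rfl
        rw [h4] at hk'
        have hin : ∀ i ∈ T, s.testBit i = true → t.testBit i = true :=
          fun i hi his => hall i ((hT i).1 ⟨hi, his⟩)
        refine ⟨_, _, _, ⟨hc.lower, ?_, hc.undecided, hc.present, hc.budget, ?_⟩, hk'⟩
        · intro i hi
          have h5 := hc.upper i hi
          rw [xor_testBit, xor_testBit]
          have h6 : x.testBit i = true ↔ s.testBit i = true := by
            rw [← hx, land_testBit]; tauto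
          have h7 := hin i hi
          have h8 : t.testBit i = true → x.testBit i = true := fun h => by
            rw [← ht, land_testBit] at h; exact h.2
          tauto
        · intro i hi
          rcases hc.cover i hi with h1 | h1 | h1 | h1 | h1
          · exact Or.inl h1
          · exact Or.inr (Or.inl h1)
          · exact Or.inr (Or.inr (Or.inl h1))
          · exact Or.inr (Or.inr (Or.inr h1))
          · refine Or.inl ?_
            have := hin i hi h1
            rw [← ht, land_testBit] at this
            exact this.1

theorem branch_sound {leaf : ℕ → Bool} {ih : EdgeList → EdgeList → ℕ → ℕ → ℕ → Bool}
    (hih : ∀ U P A C r, Compatible T ∅ 0 A C r U P → ih U P A C r = true →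
      ∃ C', (∀ i, C'.testBit i = true ↔ i ∈ T) ∧ leaf C' = true)
    {A C r : ℕ} {U P : EdgeList} (h : Compatible T ∅ 0 A C r U P)
    (hb : branch leaf ih A C r U P = true) :
    ∃ C', (∀ i, C'.testBit i = true ↔ i ∈ T) ∧ leaf C' = true := by
  classical
  unfold branch at hb
  cases h0 : Nat.beq (Nat.land A C) C with
  | false =>
    exfalso
    refine beq_false h0 (Nat.eq_of_testBit_eq fun i => ?_)
    have := h.lower i
    have h2 := h.upper i
    rw [Bool.eq_iff_iff, land_testBit]
    tauto
  | true =>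
    rw [h0] at hb
    cases U with
    | cons s p q tl =>
      dsimp only at hb
      obtain ⟨m', h', hm, habs, hq, he, hpre⟩ := h.push_head
      by_cases ha : Absent T s
      · rw [habs ha] at h'
        cases h1 : ih tl (.cons s p q P) (Nat.xor A (Nat.land A p)) C r with
        | false => rw [h1] at hb; exact absurd hb (by simp)
        | true => rw [h1] at hb; exact hih _ _ _ _ _ (h'.drop_absent (q := 0) (p := 0) ha).2.1 hb
      · cases h1 : ih tl (.cons s p q P) (Nat.xor A (Nat.land A p)) C r with
        | false => rw [h1] at hb; exact absurd hb (by simp)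
        | true => exact hih _ _ _ _ _ (h'.make_present hm he ha) h1
    | nil =>
      dsimp only at hb
      cases P with
      | nil =>
        refine ⟨C, fun i => ⟨h.lower i, fun hi => ?_⟩, hb⟩
        rcases h.cover i hi with h1 | h1 | h1 | h1
        · exact h1
        · exact h1.elim
        · exact h1.elim
        · exact h1.elim
      | cons s p q tl =>
        dsimp only at hb
        generalize hx : Nat.xor (Nat.land A s) (Nat.land C (Nat.land A s)) = x at *
        generalize hbb : Nat.xor x (Nat.land x (Nat.pred x)) = b at *
        cases h1 : ih .nil (.cons s p q tl) A (Nat.lor C b) r with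
        | false => rw [h1] at hb; exact absurd hb (by simp)
        | true =>
          rw [h1] at hb
          by_cases hx0 : x = 0
          · subst hx0
            refine hih _ _ _ _ _ ⟨fun i hi => ?_, h.upper, h.undecided, h.present, h.budget,
              fun i hi => ?_⟩ h1
            · rcases lor_testBit.1 hi with h | h'
              · exact ‹Compatible _ _ _ _ _ _ _ _›.lower i h
              · rw [← hbb] at h'; simp [Nat.land, Nat.xor] at h'
            · exact (h.cover i hi).imp_left fun h => lor_testBit.2 (Or.inl h)
          · obtain ⟨j, hj, hjk⟩ := testBit_land_pred hx0
            have hbj : ∀ i, b.testBit i = true ↔ i = j := by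
              intro i
              rw [← hbb, xor_testBit, hjk]
              by_cases hij : i = j
              · subst hij; tauto
              · tauto
            by_cases hjT : j ∈ T
            · refine hih _ _ _ _ _ ⟨fun i hi => ?_, h.upper, h.undecided, h.present, h.budget,
                fun i hi => ?_⟩ h1
              · rcases lor_testBit.1 hi with h' | h'
                · exact h.lower i h'
                · rwa [(hbj i).1 h']
              · exact (h.cover i hi).imp_left fun h => lor_testBit.2 (Or.inl h)
            · refine hih _ _ _ _ _ ⟨h.lower, fun i hi => ?_, h.undecided, h.present, h.budget,
                h.cover⟩ hb
              rw [xor_testBit, hbj]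
              have h1 := h.upper i hi
              have : i ≠ j := by rintro rfl; exact hjT hi
              tauto

theorem solve_sound {leaf : ℕ → Bool} (fuel : ℕ) : ∀ (U P : EdgeList) (A C r : ℕ),
    Compatible T ∅ 0 A C r U P → solve leaf fuel U P A C r = true →
    ∃ C', (∀ i, C'.testBit i = true ↔ i ∈ T) ∧ leaf C' = true := by
  induction fuel with
  | zero => intro U P A C r _ h; exact absurd h (by simp [solve])
  | succ n ih =>
    intro U P A C r h hs
    obtain ⟨A, C, r, U, P, h, hs⟩ := sweepUndecided_sound U ∅ 0 A C r P _ h hs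
    dsimp only at hs
    cases hr : Nat.beq r 0 with
    | false =>
      rw [hr] at hs
      obtain ⟨A, C, P, h, hs⟩ := sweepPresent_sound P ∅ A C r U _ h hs
      exact branch_sound ih h hs
    | true =>
      rw [hr] at hs
      obtain rfl := beq_true hr
      obtain ⟨A, P, h, hs⟩ := declareAll_sound U A C P _ h hs
      obtain ⟨A, C, P, h, hs⟩ := sweepPresent_sound P ∅ A C 0 .nil _ h hs
      exact branch_sound ih h hs

end CuboidTorus

namespace CuboidTorus

/-- An entry of a list of points. -/
@[ext] structure Point where
  c : ℕ
  x : ℕ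
  y : ℕ
  z : ℕ
  w : ℕ
  im : ℕ

instance : DecidableEq Point := fun _ _ => decidable_of_iff _ Point.ext_iff.symm

namespace PointList

def toList : PointList → List Point
  | nil => []
  | cons c x y z w im tl => ⟨c, x, y, z, w, im⟩ :: tl.toList

def ofList : List Point → PointList
  | [] => nil
  | p :: l => cons p.c p.x p.y p.z p.w p.im (ofList l)

@[simp] theorem toList_ofList (l : List Point) : (ofList l).toList = l := by
  induction l with
  | nil => rfl
  | cons p l ih => simp [ofList, toList, ih]

@[simp] theorem ofList_toList (S : PointList) : ofList S.toList = S := by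
  induction S with
  | nil => rfl
  | cons c x y z w im tl ih => simp [ofList, toList, ih]

end PointList

/-- Six times the oriented volume of a tetrahedron, in Plücker coordinates. -/
def det (a b c d : Point) : ℤ :=
  ((b.x : ℤ) - a.x) * (c.y * d.z - d.y * c.z) + ((b.y : ℤ) - a.y) * (d.x * c.z - c.x * d.z) +
  ((b.z : ℤ) - a.z) * (c.x * d.y - d.x * c.y) + ((a.x : ℤ) * b.y - b.x * a.y) * (d.z - c.z) +
  ((a.x : ℤ) * b.z - b.x * a.z) * (c.y - d.y) + ((a.y : ℤ) * b.z - b.y * a.z) * (d.x - c.x)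

def Point.Small (p : Point) : Prop := p.x ≤ 2 ∧ p.y ≤ 2 ∧ p.z ≤ 3

def consPair (a b : Point) (Q : PairList) : PairList :=
  .cons (8 + b.x - a.x) (8 + b.y - a.y) (8 + b.z - a.z)
    (8 + a.x * b.y - b.x * a.y) (8 + a.x * b.z - b.x * a.z) (8 + a.y * b.z - b.y * a.z)
    (8 * ((8 + b.x - a.x) + ((8 + b.y - a.y) + ((8 + b.z - a.z) +
      ((8 + a.x * b.y - b.x * a.y) + ((8 + a.x * b.z - b.x * a.z) +
        (8 + a.y * b.z - b.y * a.z))))))) Q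

def encodePairs (L : List (Point × Point)) : PairList := L.foldr (fun p Q => consPair p.1 p.2 Q) .nil

def SmallPairs (L : List (Point × Point)) : Prop := ∀ p ∈ L, p.1.Small ∧ p.2.Small

theorem addPairs_encodePairs (S : PointList) (b : Point) (L : List (Point × Point)) :
    addPairs S b.x b.y b.z (encodePairs L) = encodePairs (S.toList.map (·, b) ++ L) := by
  induction S with
  | nil => rfl
  | cons c x y z w im tl ih =>
    change consPair ⟨c, x, y, z, w, im⟩ b (addPairs tl b.x b.y b.z (encodePairs L)) = _
    rw [ih]; rfl

theorem plucker_sum {a b c d : Point} (ha : a.Small) (hb : b.Small) (hc : c.Small) (hd : d.Small) :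
    ((8 + b.x - a.x) * (8 + c.y * d.z - d.y * c.z) + ((8 + b.y - a.y) * (8 + d.x * c.z - c.x * d.z) +
      ((8 + b.z - a.z) * (8 + c.x * d.y - d.x * c.y) +
        ((8 + a.x * b.y - b.x * a.y) * (8 + d.z - c.z) +
          ((8 + a.x * b.z - b.x * a.z) * (8 + c.y - d.y) +
            ((8 + a.y * b.z - b.y * a.z) * (8 + d.x - c.x) + 384))))) : ℕ) =
    ((8 * ((8 + b.x - a.x) + ((8 + b.y - a.y) + ((8 + b.z - a.z) +
      ((8 + a.x * b.y - b.x * a.y) + ((8 + a.x * b.z - b.x * a.z) +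
        (8 + a.y * b.z - b.y * a.z)))))) + 8 * ((8 + c.y * d.z - d.y * c.z) +
      ((8 + d.x * c.z - c.x * d.z) + ((8 + c.x * d.y - d.x * c.y) + ((8 + d.z - c.z) +
        ((8 + c.y - d.y) + (8 + d.x - c.x)))))) : ℕ) : ℤ) + det a b c d := by
  obtain ⟨a1, a2, a3⟩ := ha
  obtain ⟨b1, b2, b3⟩ := hb
  obtain ⟨c1, c2, c3⟩ := hc
  obtain ⟨d1, d2, d3⟩ := hd
  have e : ∀ {m n : ℕ}, n ≤ 8 → ((8 + m - n : ℕ) : ℤ) = 8 + m - n := fun h => by omega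
  have m1 : ∀ {m n : ℕ}, m ≤ 2 → n ≤ 2 → m * n ≤ 8 := fun h h' =>
    (Nat.mul_le_mul h h').trans (by norm_num)
  have m2 : ∀ {m n : ℕ}, m ≤ 2 → n ≤ 3 → m * n ≤ 8 := fun h h' =>
    (Nat.mul_le_mul h h').trans (by norm_num)
  push_cast [e (m1 b1 a2), e (m2 b1 a3), e (m2 b2 a3), e (m2 d2 c3), e (m2 c1 d3), e (m1 d1 c2),
    e (a1.trans (by norm_num)), e (a2.trans (by norm_num)), e (a3.trans (by norm_num)),
    e (c3.trans (by norm_num)), e (d2.trans (by norm_num)), e (c1.trans (by norm_num))]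
  rw [det]; ring

theorem noneCoplanar_iff {c d : Point} (hc : c.Small) (hd : d.Small) {L : List (Point × Point)}
    (hL : SmallPairs L) :
    dualPair c.x c.y c.z d.x d.y d.z (noneCoplanar (encodePairs L)) = true ↔
      ∀ p ∈ L, det p.1 p.2 c d ≠ 0 := by
  induction L with
  | nil => simp [encodePairs, dualPair, noneCoplanar]
  | cons p L ih =>
    have hp := hL p (by simp)
    have hs := plucker_sum hp.1 hp.2 hc hd
    rw [List.forall_mem_cons, ← ih fun q hq => hL q (by simp [hq])]
    change Bool.rec (motive := fun _ => Bool) _ false (Nat.beq _ _) = true ↔ _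
    cases h : Nat.beq _ _ with
    | true =>
      have h' := beq_true h
      refine ⟨fun h => absurd h (by simp), fun h0 => absurd ?_ h0.1⟩
      have := congrArg (Nat.cast : ℕ → ℤ) h'
      erw [hs] at this
      exact Int.add_left_cancel (this.trans (add_zero _).symm)
    | false =>
      have h' := beq_false h
      refine ⟨fun h => ⟨fun h0 => h' ?_, h⟩, fun h => h.2⟩
      rw [h0, add_zero] at hs
      exact_mod_cast hs

/-- Append a binary digit. -/
def pushBit (O : ℕ) (b : Bool) : ℕ := Bool.rec (O + O) (O + O + 1) b

theorem signFold_encodePairs {c d : Point} (hc : c.Small) (hd : d.Small)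
    {L : List (Point × Point)} (hL : SmallPairs L) (O : ℕ) :
    dualPair c.x c.y c.z d.x d.y d.z
      (fun b1 b2 b3 b4 b5 b6 f => signFold (encodePairs L) b1 b2 b3 b4 b5 b6 f O) =
    (L.map fun p => decide (0 < det p.1 p.2 c d)).foldl pushBit O := by
  induction L generalizing O with
  | nil => rfl
  | cons p L ih =>
    have hp := hL p (by simp)
    have hs := plucker_sum hp.1 hp.2 hc hd
    have hi := ih (fun q hq => hL q (by simp [hq])) (pushBit O (decide (0 < det p.1 p.2 c d)))
    rw [List.map_cons, List.foldl_cons, ← hi]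
    change signFold (encodePairs L) _ _ _ _ _ _ _ (pushBit O _) =
      signFold (encodePairs L) _ _ _ _ _ _ _ (pushBit O _)
    congr 2
    rw [Bool.eq_iff_iff, decide_eq_true_eq, Nat.ble_eq]
    rw [← Int.ofNat_le]
    erw [hs]
    push_cast
    exact ⟨fun h => by
      have := Int.lt_of_add_one_le h
      exact pos_of_lt_add_right this, fun h => Int.add_one_le_of_lt (Int.lt_add_of_pos_right _ h)⟩

def quadsAux {α : Type*} : List α → List α → List (α × α) → List (α × α × α × α)
  | [], _, _ => []
  | p :: l, S, Q => (l.flatMap fun q => Q.map fun ab => (ab.1, ab.2, p, q)) ++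
      quadsAux l (p :: S) (S.map (·, p) ++ Q)

/-- The quadruples of entries of a list, in the order in which their signs are computed. -/
def quads {α : Type*} (l : List α) : List (α × α × α × α) := quadsAux l [] []

theorem quadsAux_map {α β : Type*} (f : α → β) (l S : List α) (Q : List (α × α)) :
    quadsAux (l.map f) (S.map f) (Q.map fun p => (f p.1, f p.2)) =
      (quadsAux l S Q).map fun p => (f p.1, f p.2.1, f p.2.2.1, f p.2.2.2) := by
  induction l generalizing S Q with
  | nil => rfl
  | cons p l ih =>
    simp only [quadsAux, List.map_cons, List.map_append, ← ih]
    simp [List.flatMap_map, List.map_flatMap, Function.comp_def]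

theorem quads_map {α β : Type*} (f : α → β) (l : List α) :
    quads (l.map f) = (quads l).map fun p => (f p.1, f p.2.1, f p.2.2.1, f p.2.2.2) :=
  quadsAux_map f l [] []

def orient (p : Point × Point × Point × Point) : Bool := decide (0 < det p.1 p.2.1 p.2.2.1 p.2.2.2)

theorem signFoldPoints_encodePairs {c : Point} (hc : c.Small) {L : List (Point × Point)}
    (hL : SmallPairs L) (R : PointList) (hR : ∀ p ∈ R.toList, p.Small) (O : ℕ) :
    signFoldPoints (encodePairs L) c.x c.y c.z R O =
      ((R.toList.flatMap fun q => L.map fun ab => (ab.1, ab.2, c, q)).map orient).foldl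
        pushBit O := by
  induction R generalizing O with
  | nil => rfl
  | cons k x y z w im tl ih =>
    have := signFold_encodePairs hc (d := ⟨k, x, y, z, w, im⟩) (hR _ (by simp [PointList.toList]))
      hL O
    rw [PointList.toList, List.flatMap_cons, List.map_append, List.foldl_append,
      ← ih fun p hp => hR p (by simp [PointList.toList, hp])]
    change signFoldPoints _ _ _ _ _ _ = signFoldPoints _ _ _ _ _ _
    rw [List.map_map]
    exact congrArg _ this

theorem signMask_eq (S : PointList) (hS : ∀ p ∈ S.toList, p.Small) :
    signMask S = ((quads S.toList).map orient).foldl pushBit 0 := by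
  suffices h : ∀ (S S' : PointList) (L : List (Point × Point)) (O : ℕ),
      (∀ p ∈ S.toList, p.Small) → (∀ p ∈ S'.toList, p.Small) → SmallPairs L →
      PointList.rec (motive := fun _ => PointList → PairList → ℕ → ℕ) (fun _ _ O => O)
        (fun c x y z w im tl ih S' Q O => ih (.cons c x y z w im S') (addPairs S' x y z Q)
          (signFoldPoints Q x y z tl O)) S S' (encodePairs L) O =
      ((quadsAux S.toList S'.toList L).map orient).foldl pushBit O from
    h S .nil [] 0 hS (by simp [PointList.toList]) (by simp [SmallPairs])
  intro S
  induction S with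
  | nil => intros; rfl
  | cons c x y z w im tl ih =>
    intro S' L O hS hS' hL
    have hp : Point.Small ⟨c, x, y, z, w, im⟩ := hS _ (by simp [PointList.toList])
    have htl : ∀ p ∈ tl.toList, p.Small := fun p hp => hS p (by simp [PointList.toList, hp])
    rw [PointList.toList, quadsAux, List.map_append, List.foldl_append,
      ← signFoldPoints_encodePairs hp hL tl htl]
    have := ih (.cons c x y z w im S') (S'.toList.map (·, ⟨c, x, y, z, w, im⟩) ++ L)
      (signFoldPoints (encodePairs L) x y z tl O) htl
      (by rw [PointList.toList, List.forall_mem_cons]; exact ⟨hp, hS'⟩)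
      (by
        intro q hq
        rcases List.mem_append.1 hq with h | h
        · obtain ⟨a, ha, rfl⟩ := List.mem_map.1 h
          exact ⟨hS' a ha, hp⟩
        · exact hL q h)
    rw [PointList.toList] at this
    rw [← this, ← addPairs_encodePairs S' ⟨c, x, y, z, w, im⟩]

theorem testBit_pushBit (O : ℕ) (b : Bool) (k : ℕ) :
    (pushBit O b).testBit k = if k = 0 then b else O.testBit (k - 1) := by
  cases k with
  | zero => cases b <;> simp [pushBit, Nat.testBit_zero] <;> omega
  | succ k => cases b <;> simp [pushBit, Nat.testBit_succ] <;> congr 1 <;> omega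

theorem testBit_foldl_pushBit (l : List Bool) (k : ℕ) :
    (l.foldl pushBit 0).testBit k = l.reverse.getD k false := by
  induction l using List.reverseRecOn generalizing k with
  | nil => simp
  | append_singleton l b ih =>
    rw [List.foldl_append, List.foldl_cons, List.foldl_nil, testBit_pushBit, List.reverse_append,
      List.reverse_singleton, List.singleton_append]
    cases k with
    | zero => simp
    | succ k => simp [ih]

end CuboidTorus

namespace CuboidTorus

/-- A segment `a b` and a triangle `c d e` have a common relatively interior point. -/
def Meets (a b c d e : Point) : Prop :=
  ∃ α β γ δ ε : ℤ, (0 < α ∧ 0 < β ∧ 0 < γ ∧ 0 < δ ∧ 0 < ε) ∧ α + β = γ + δ + ε ∧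
    α * a.x + β * b.x = γ * c.x + δ * d.x + ε * e.x ∧
    α * a.y + β * b.y = γ * c.y + δ * d.y + ε * e.y ∧
    α * a.z + β * b.z = γ * c.z + δ * d.z + ε * e.z

/-- Coefficients of an affine dependence of five points. -/
def Dependence (l0 l1 l2 l3 l4 : ℤ) (a b c d e : Point) : Prop :=
  l0 + l1 + l2 + l3 + l4 = 0 ∧ l0 * a.x + l1 * b.x + l2 * c.x + l3 * d.x + l4 * e.x = 0 ∧
    l0 * a.y + l1 * b.y + l2 * c.y + l3 * d.y + l4 * e.y = 0 ∧
    l0 * a.z + l1 * b.z + l2 * c.z + l3 * d.z + l4 * e.z = 0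

theorem dependence_det (a b c d e : Point) :
    Dependence (det b c d e) (-det a c d e) (det a b d e) (-det a b c e) (det a b c d) a b c d e := by
  refine ⟨?_, ?_, ?_, ?_⟩ <;> simp only [det] <;> ring

theorem Dependence.meets {l0 l1 l2 l3 l4 : ℤ} {a b c d e : Point}
    (h : Dependence l0 l1 l2 l3 l4 a b c d e)
    (hs : (0 < l0 ∧ 0 < l1 ∧ l2 < 0 ∧ l3 < 0 ∧ l4 < 0) ∨
      (l0 < 0 ∧ l1 < 0 ∧ 0 < l2 ∧ 0 < l3 ∧ 0 < l4)) : Meets a b c d e := by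
  obtain ⟨h1, h2, h3, h4⟩ := h
  rcases hs with ⟨p0, p1, p2, p3, p4⟩ | ⟨p0, p1, p2, p3, p4⟩
  · exact ⟨l0, l1, -l2, -l3, -l4, ⟨p0, p1, by omega, by omega, by omega⟩, by linarith, by linarith,
      by linarith, by linarith⟩
  · exact ⟨-l0, -l1, l2, l3, l4, ⟨by omega, by omega, p2, p3, p4⟩, by linarith, by linarith,
      by linarith, by linarith⟩

theorem testBit_shiftLeft_one {c k : ℕ} : (Nat.shiftLeft 1 c).testBit k = true ↔ k = c := by
  change (1 <<< c).testBit k = true ↔ _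
  rw [Nat.one_shiftLeft, Nat.testBit_two_pow]
  simp [eq_comm]

theorem radonBit_testBit {O m0 m1 m2 m3 m4 c0 c1 c2 c3 c4 c5 c6 c7 c8 c9 k : ℕ}
    (h : (radonBit O m0 m1 m2 m3 m4 c0 c1 c2 c3 c4 c5 c6 c7 c8 c9).testBit k = true) :
    let s0 := !(Nat.beq (Nat.land O m0) (nat_lit 0))
    let s1 := Nat.beq (Nat.land O m1) (nat_lit 0)
    let s2 := !(Nat.beq (Nat.land O m2) (nat_lit 0))
    let s3 := Nat.beq (Nat.land O m3) (nat_lit 0)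
    let s4 := !(Nat.beq (Nat.land O m4) (nat_lit 0))
    ∃ v : Bool,
      (k = c0 ∧ s0 = v ∧ s1 = v ∧ s2 = !v ∧ s3 = !v ∧ s4 = !v) ∨
      (k = c1 ∧ s0 = v ∧ s2 = v ∧ s1 = !v ∧ s3 = !v ∧ s4 = !v) ∨
      (k = c2 ∧ s0 = v ∧ s3 = v ∧ s1 = !v ∧ s2 = !v ∧ s4 = !v) ∨
      (k = c3 ∧ s0 = v ∧ s4 = v ∧ s1 = !v ∧ s2 = !v ∧ s3 = !v) ∨
      (k = c4 ∧ s1 = v ∧ s2 = v ∧ s0 = !v ∧ s3 = !v ∧ s4 = !v) ∨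
      (k = c5 ∧ s1 = v ∧ s3 = v ∧ s0 = !v ∧ s2 = !v ∧ s4 = !v) ∨
      (k = c6 ∧ s1 = v ∧ s4 = v ∧ s0 = !v ∧ s2 = !v ∧ s3 = !v) ∨
      (k = c7 ∧ s2 = v ∧ s3 = v ∧ s0 = !v ∧ s1 = !v ∧ s4 = !v) ∨
      (k = c8 ∧ s2 = v ∧ s4 = v ∧ s0 = !v ∧ s1 = !v ∧ s3 = !v) ∨
      (k = c9 ∧ s3 = v ∧ s4 = v ∧ s0 = !v ∧ s1 = !v ∧ s2 = !v) := by
  revert h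
  unfold radonBit
  cases Nat.beq (Nat.land O m0) (nat_lit 0) <;> cases Nat.beq (Nat.land O m1) (nat_lit 0) <;>
    cases Nat.beq (Nat.land O m2) (nat_lit 0) <;> cases Nat.beq (Nat.land O m3) (nat_lit 0) <;>
    cases Nat.beq (Nat.land O m4) (nat_lit 0) <;> intro h <;>
    first
      | (obtain rfl := testBit_shiftLeft_one.1 h; simp)
      | (exact absurd h (by simp))

def edgeIndex (i j : ℕ) : ℕ := j * (j - 1) / 2 + i

def triangleIndex (i j k : ℕ) : ℕ := k * (k - 1) * (k - 2) / 6 + j * (j - 1) / 2 + i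

def sortedTriangleIndex (i j k : ℕ) : ℕ :=
  if k < i then triangleIndex k i j else if k < j then triangleIndex i k j else triangleIndex i j k

def edgePairs (n : ℕ) : List (ℕ × ℕ) :=
  (List.range n).flatMap fun j => (List.range j).map fun i => (i, j)

def triples (n : ℕ) : List (ℕ × ℕ × ℕ) :=
  (List.range n).flatMap fun k => (edgePairs k).map fun p => (p.1, p.2, k)

def fives (n : ℕ) : List (ℕ × ℕ × ℕ × ℕ × ℕ) :=
  (List.range n).flatMap fun a => ((List.range n).filter (a < ·)).flatMap fun b =>
    ((List.range n).filter (b < ·)).flatMap fun c => ((List.range n).filter (c < ·)).flatMap fun d =>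
      ((List.range n).filter (d < ·)).map fun e => (a, b, c, d, e)

theorem mem_edgePairs {n i j : ℕ} : (i, j) ∈ edgePairs n ↔ i < j ∧ j < n := by
  simp [edgePairs, and_comm]

theorem mem_triples {n i j k : ℕ} : (i, j, k) ∈ triples n ↔ i < j ∧ j < k ∧ k < n := by
  simp only [triples, List.mem_flatMap, List.mem_range, List.mem_map, Prod.mk.injEq]
  constructor
  · rintro ⟨c, hc, ⟨a, b⟩, h, rfl, rfl, rfl⟩
    rw [mem_edgePairs] at h
    exact ⟨h.1, h.2, hc⟩
  · rintro ⟨h1, h2, h3⟩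
    exact ⟨k, h3, (i, j), mem_edgePairs.2 ⟨h1, h2⟩, rfl, rfl, rfl⟩

theorem mem_fives {n a b c d e : ℕ} (h : (a, b, c, d, e) ∈ fives n) :
    a < b ∧ b < c ∧ c < d ∧ d < e ∧ e < n := by
  simp only [fives, List.mem_flatMap, List.mem_range, List.mem_map, List.mem_filter,
    Prod.mk.injEq, decide_eq_true_eq] at h
  omega

theorem triangleIndex_inj {i j k i' j' k' : ℕ} (h : i < j ∧ j < k ∧ k < 8)
    (h' : i' < j' ∧ j' < k' ∧ k' < 8) (he : triangleIndex i j k = triangleIndex i' j' k') :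
    i = i' ∧ j = j' ∧ k = k' := by
  have hn : ((triples 8).map fun t => triangleIndex t.1 t.2.1 t.2.2).Nodup := by decide +kernel
  have := List.inj_on_of_nodup_map hn (mem_triples.2 h) (mem_triples.2 h') he
  simpa using this

theorem triangleIndex_lt {i j k : ℕ} (h : i < j ∧ j < k ∧ k < 8) : triangleIndex i j k < 56 := by
  have hn : ∀ t ∈ triples 8, triangleIndex t.1 t.2.1 t.2.2 < 56 := by decide +kernel
  exact hn _ (mem_triples.2 h)

theorem edgeIndex_inj {i j i' j' : ℕ} (h : i < j ∧ j < 8) (h' : i' < j' ∧ j' < 8)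
    (he : edgeIndex i j = edgeIndex i' j') : i = i' ∧ j = j' := by
  have hn : ((edgePairs 8).map fun t => edgeIndex t.1 t.2).Nodup := by decide +kernel
  have := List.inj_on_of_nodup_map hn (mem_edgePairs.2 h) (mem_edgePairs.2 h') he
  simpa using this

/-- Position of a pair (edge, triangle) in the table of piercings. -/
def pairCode (a b c d e : ℕ) : ℕ := 70 + (56 * edgeIndex a b + triangleIndex c d e)

/-- The bit of the sign of a quadruple. -/
def signBit (n : ℕ) (q : ℕ × ℕ × ℕ × ℕ) : ℕ := (quads (List.range n)).reverse.idxOf q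

namespace FiveList

def toList : FiveList → List (List ℕ)
  | nil => []
  | cons m0 m1 m2 m3 m4 c0 c1 c2 c3 c4 c5 c6 c7 c8 c9 tl =>
    [m0, m1, m2, m3, m4, c0, c1, c2, c3, c4, c5, c6, c7, c8, c9] :: tl.toList

end FiveList

def fiveRow (n : ℕ) : ℕ × ℕ × ℕ × ℕ × ℕ → List ℕ := fun (a, b, c, d, e) =>
  [2 ^ signBit n (b, c, d, e), 2 ^ signBit n (a, c, d, e), 2 ^ signBit n (a, b, d, e),
    2 ^ signBit n (a, b, c, e), 2 ^ signBit n (a, b, c, d),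
    pairCode a b c d e, pairCode a c b d e, pairCode a d b c e, pairCode a e b c d,
    pairCode b c a d e, pairCode b d a c e, pairCode b e a c d, pairCode c d a b e,
    pairCode c e a b d, pairCode d e a b c]

def FivesValid (n : ℕ) (F : FiveList) : Prop :=
  F.toList = (fives n).map (fiveRow n) ∧
    (∀ f ∈ fives n, ∀ q ∈ quads [f.1, f.2.1, f.2.2.1, f.2.2.2.1, f.2.2.2.2],
      q ∈ quads (List.range n)) ∧ (quads (List.range n)).length ≤ 70

instance (n : ℕ) (F : FiveList) : Decidable (FivesValid n F) := inferInstanceAs (Decidable (_ ∧ _))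

theorem fivesValid7 : FivesValid 7 fiveList7 := by decide +kernel

theorem fivesValid8 : FivesValid 8 fiveList8 := by decide +kernel

theorem lt_two_pow_foldl_pushBit (l : List Bool) : l.foldl pushBit 0 < 2 ^ l.length := by
  induction l using List.reverseRecOn with
  | nil => simp
  | append_singleton l b ih =>
    rw [List.foldl_append, List.foldl_cons, List.foldl_nil, List.length_append, List.length_singleton,
      pow_succ]
    cases b <;> simp only [pushBit] <;> omega

theorem land_two_pow_eq_zero {O k : ℕ} :
    Nat.beq (Nat.land O (2 ^ k)) (nat_lit 0) = !(O.testBit k) := by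
  rw [Bool.eq_iff_iff, Nat.beq_eq]
  change O &&& 2 ^ k = 0 ↔ _
  rw [Nat.and_two_pow]
  cases O.testBit k <;> simp

theorem pierceMask_testBit {F : FiveList} {O k : ℕ} (hO : O < 2 ^ 70) (hk : 70 ≤ k)
    (h : (pierceMask F O).testBit k = true) :
    ∃ m0 m1 m2 m3 m4 c0 c1 c2 c3 c4 c5 c6 c7 c8 c9,
      [m0, m1, m2, m3, m4, c0, c1, c2, c3, c4, c5, c6, c7, c8, c9] ∈ F.toList ∧
      (radonBit O m0 m1 m2 m3 m4 c0 c1 c2 c3 c4 c5 c6 c7 c8 c9).testBit k = true := by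
  induction F with
  | nil =>
    have : O.testBit k = true := h
    rw [Nat.testBit_eq_false_of_lt (hO.trans_le (Nat.pow_le_pow_right (by norm_num) hk))] at this
    cases this
  | cons m0 m1 m2 m3 m4 c0 c1 c2 c3 c4 c5 c6 c7 c8 c9 tl ih =>
    rcases lor_testBit.1 h with h | h
    · exact ⟨m0, m1, m2, m3, m4, c0, c1, c2, c3, c4, c5, c6, c7, c8, c9, by simp [FiveList.toList], h⟩
    · obtain ⟨m0, m1, m2, m3, m4, c0, c1, c2, c3, c4, c5, c6, c7, c8, c9, h1, h2⟩ := ih h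
      exact ⟨m0, m1, m2, m3, m4, c0, c1, c2, c3, c4, c5, c6, c7, c8, c9,
        by simp [FiveList.toList, h1], h2⟩

/-- The points with labels below `n` are in general position. -/
def General (n : ℕ) (pt : ℕ → Point) : Prop :=
  ∀ i j k l, i < j → j < k → k < l → l < n → det (pt i) (pt j) (pt k) (pt l) ≠ 0

theorem signMask_testBit {n : ℕ} {pt : ℕ → Point} {S : PointList}
    (hS : S.toList = (List.range n).map pt) (hs : ∀ i < n, (pt i).Small) {q : ℕ × ℕ × ℕ × ℕ}
    (hq : q ∈ quads (List.range n)) :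
    (signMask S).testBit (signBit n q) = true ↔
      0 < det (pt q.1) (pt q.2.1) (pt q.2.2.1) (pt q.2.2.2) := by
  rw [signMask_eq S (by rw [hS]; simpa using hs), testBit_foldl_pushBit, hS, quads_map,
    List.map_map, ← List.map_reverse]
  have h1 : signBit n q < (quads (List.range n)).reverse.length :=
    List.idxOf_lt_length_of_mem (List.mem_reverse.2 hq)
  rw [List.getD_eq_getElem _ _ (by simpa using h1), List.getElem_map]
  have : (quads (List.range n)).reverse[signBit n q] = q := List.getElem_idxOf h1
  rw [this]
  simp [orient]

theorem meets_of_pierceMask {n : ℕ} {F : FiveList} (hF : FivesValid n F)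
    {pt : ℕ → Point}
    {S : PointList} (hS : S.toList = (List.range n).map pt) (hs : ∀ i < n, (pt i).Small)
    (hg : General n pt) {k : ℕ} (hk : 70 ≤ k)
    (h : (pierceMask F (signMask S)).testBit k = true) :
    ∃ a b c d e, (a < b ∧ b < n) ∧ (c < d ∧ d < e ∧ e < n) ∧
      (a ≠ c ∧ a ≠ d ∧ a ≠ e ∧ b ≠ c ∧ b ≠ d ∧ b ≠ e) ∧ k = pairCode a b c d e ∧
      Meets (pt a) (pt b) (pt c) (pt d) (pt e) := by
  have hO : signMask S < 2 ^ 70 := by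
    rw [signMask_eq S (by rw [hS]; simpa using hs), hS, quads_map]
    refine (lt_two_pow_foldl_pushBit _).trans_le (Nat.pow_le_pow_right (by norm_num) ?_)
    simpa using hF.2.2
  obtain ⟨m0, m1, m2, m3, m4, c0, c1, c2, c3, c4, c5, c6, c7, c8, c9, h1, h2⟩ :=
    pierceMask_testBit hO hk h
  rw [hF.1] at h1
  obtain ⟨⟨a, b, c, d, e⟩, hf, hr⟩ := List.mem_map.1 h1
  simp only [fiveRow, List.cons.injEq, and_true] at hr
  obtain ⟨rfl, rfl, rfl, rfl, rfl, rfl, rfl, rfl, rfl, rfl, rfl, rfl, rfl, rfl, rfl⟩ := hr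
  obtain ⟨hab, hbc, hcd, hde, hen⟩ := mem_fives hf
  have hq := hF.2.1 _ hf
  have b0 := signMask_testBit hS hs (hq (b, c, d, e) (by simp [quads, quadsAux]))
  have b1 := signMask_testBit hS hs (hq (a, c, d, e) (by simp [quads, quadsAux]))
  have b2 := signMask_testBit hS hs (hq (a, b, d, e) (by simp [quads, quadsAux]))
  have b3 := signMask_testBit hS hs (hq (a, b, c, e) (by simp [quads, quadsAux]))
  have b4 := signMask_testBit hS hs (hq (a, b, c, d) (by simp [quads, quadsAux]))
  have n0 := hg b c d e hbc hcd hde hen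
  have n1 := hg a c d e (by omega) hcd hde hen
  have n2 := hg a b d e hab (by omega) hde hen
  have n3 := hg a b c e hab hbc (by omega) hen
  have n4 := hg a b c d hab hbc hcd (by omega)
  have hd := dependence_det (pt a) (pt b) (pt c) (pt d) (pt e)
  have h3 := radonBit_testBit h2
  replace b0 := Bool.eq_iff_iff.2 (b0.trans decide_eq_true_iff.symm)
  replace b1 := Bool.eq_iff_iff.2 (b1.trans decide_eq_true_iff.symm)
  replace b2 := Bool.eq_iff_iff.2 (b2.trans decide_eq_true_iff.symm)
  replace b3 := Bool.eq_iff_iff.2 (b3.trans decide_eq_true_iff.symm)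
  replace b4 := Bool.eq_iff_iff.2 (b4.trans decide_eq_true_iff.symm)
  dsimp only at b0 b1 b2 b3 b4
  simp only [land_two_pow_eq_zero, Bool.not_not, b0, b1, b2, b3, b4] at h3
  clear b0 b1 b2 b3 b4
  generalize det (pt b) (pt c) (pt d) (pt e) = l0 at *
  generalize det (pt a) (pt c) (pt d) (pt e) = l1 at *
  generalize det (pt a) (pt b) (pt d) (pt e) = l2 at *
  generalize det (pt a) (pt b) (pt c) (pt e) = l3 at *
  generalize det (pt a) (pt b) (pt c) (pt d) = l4 at *
  obtain ⟨d1, d2, d3, d4⟩ := hd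
  clear h h1 h2 hq hF hO
  obtain ⟨v, h3⟩ := h3
  rcases h3 with ⟨rfl, h⟩ | ⟨rfl, h⟩ | ⟨rfl, h⟩ | ⟨rfl, h⟩ | ⟨rfl, h⟩ | ⟨rfl, h⟩ | ⟨rfl, h⟩ |
    ⟨rfl, h⟩ | ⟨rfl, h⟩ | ⟨rfl, h⟩
  · refine ⟨a, b, c, d, e, by omega, by omega, by omega, rfl, Dependence.meets (l0 := l0)
      (l1 := -l1) (l2 := l2) (l3 := -l3) (l4 := l4) ⟨by linarith, by linarith, by linarith,
      by linarith⟩ ?_⟩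
    cases v <;> simp only [Bool.not_true, Bool.not_false, decide_eq_true_eq,
      decide_eq_false_iff_not, Bool.not_eq_true', Bool.not_eq_false', not_lt] at h <;> omega
  · refine ⟨a, c, b, d, e, by omega, by omega, by omega, rfl, Dependence.meets (l0 := l0)
      (l1 := l2) (l2 := -l1) (l3 := -l3) (l4 := l4) ⟨by linarith, by linarith, by linarith,
      by linarith⟩ ?_⟩
    cases v <;> simp only [Bool.not_true, Bool.not_false, decide_eq_true_eq,
      decide_eq_false_iff_not, Bool.not_eq_true', Bool.not_eq_false', not_lt] at h <;> omega
  · refine ⟨a, d, b, c, e, by omega, by omega, by omega, rfl, Dependence.meets (l0 := l0)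
      (l1 := -l3) (l2 := -l1) (l3 := l2) (l4 := l4) ⟨by linarith, by linarith, by linarith,
      by linarith⟩ ?_⟩
    cases v <;> simp only [Bool.not_true, Bool.not_false, decide_eq_true_eq,
      decide_eq_false_iff_not, Bool.not_eq_true', Bool.not_eq_false', not_lt] at h <;> omega
  · refine ⟨a, e, b, c, d, by omega, by omega, by omega, rfl, Dependence.meets (l0 := l0)
      (l1 := l4) (l2 := -l1) (l3 := l2) (l4 := -l3) ⟨by linarith, by linarith, by linarith,
      by linarith⟩ ?_⟩
    cases v <;> simp only [Bool.not_true, Bool.not_false, decide_eq_true_eq,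
      decide_eq_false_iff_not, Bool.not_eq_true', Bool.not_eq_false', not_lt] at h <;> omega
  · refine ⟨b, c, a, d, e, by omega, by omega, by omega, rfl, Dependence.meets (l0 := -l1)
      (l1 := l2) (l2 := l0) (l3 := -l3) (l4 := l4) ⟨by linarith, by linarith, by linarith,
      by linarith⟩ ?_⟩
    cases v <;> simp only [Bool.not_true, Bool.not_false, decide_eq_true_eq,
      decide_eq_false_iff_not, Bool.not_eq_true', Bool.not_eq_false', not_lt] at h <;> omega
  · refine ⟨b, d, a, c, e, by omega, by omega, by omega, rfl, Dependence.meets (l0 := -l1)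
      (l1 := -l3) (l2 := l0) (l3 := l2) (l4 := l4) ⟨by linarith, by linarith, by linarith,
      by linarith⟩ ?_⟩
    cases v <;> simp only [Bool.not_true, Bool.not_false, decide_eq_true_eq,
      decide_eq_false_iff_not, Bool.not_eq_true', Bool.not_eq_false', not_lt] at h <;> omega
  · refine ⟨b, e, a, c, d, by omega, by omega, by omega, rfl, Dependence.meets (l0 := -l1)
      (l1 := l4) (l2 := l0) (l3 := l2) (l4 := -l3) ⟨by linarith, by linarith, by linarith,
      by linarith⟩ ?_⟩
    cases v <;> simp only [Bool.not_true, Bool.not_false, decide_eq_true_eq,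
      decide_eq_false_iff_not, Bool.not_eq_true', Bool.not_eq_false', not_lt] at h <;> omega
  · refine ⟨c, d, a, b, e, by omega, by omega, by omega, rfl, Dependence.meets (l0 := l2)
      (l1 := -l3) (l2 := l0) (l3 := -l1) (l4 := l4) ⟨by linarith, by linarith, by linarith,
      by linarith⟩ ?_⟩
    cases v <;> simp only [Bool.not_true, Bool.not_false, decide_eq_true_eq,
      decide_eq_false_iff_not, Bool.not_eq_true', Bool.not_eq_false', not_lt] at h <;> omega
  · refine ⟨c, e, a, b, d, by omega, by omega, by omega, rfl, Dependence.meets (l0 := l2)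
      (l1 := l4) (l2 := l0) (l3 := -l1) (l4 := -l3) ⟨by linarith, by linarith, by linarith,
      by linarith⟩ ?_⟩
    cases v <;> simp only [Bool.not_true, Bool.not_false, decide_eq_true_eq,
      decide_eq_false_iff_not, Bool.not_eq_true', Bool.not_eq_false', not_lt] at h <;> omega
  · refine ⟨d, e, a, b, c, by omega, by omega, by omega, rfl, Dependence.meets (l0 := -l3)
      (l1 := l4) (l2 := l0) (l3 := -l1) (l4 := l2) ⟨by linarith, by linarith, by linarith,
      by linarith⟩ ?_⟩
    cases v <;> simp only [Bool.not_true, Bool.not_false, decide_eq_true_eq,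
      decide_eq_false_iff_not, Bool.not_eq_true', Bool.not_eq_false', not_lt] at h <;> omega

end CuboidTorus

namespace CuboidTorus

/-- A triangulated surface on the points `pt 0, …, pt (n - 1)` with triangles `F`, at least `3 * n`
edges, connected vertex links and no edge piercing a triangle. -/
structure Candidate (n : ℕ) (pt : ℕ → Point) (F : ℕ → ℕ → ℕ → Prop) : Prop where
  small : ∀ i < n, (pt i).Small
  general : General n pt
  lt : ∀ {i j k}, F i j k → i < n
  ne : ∀ {i j k}, F i j k → i ≠ j
  rotate : ∀ {i j k}, F i j k → F j k i
  swap : ∀ {i j k}, F i j k → F j i k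
  two : ∀ {i j k}, F i j k → ∃ a b, a ≠ b ∧ ∀ l, F i j l ↔ l = a ∨ l = b
  link : ∀ v (W : Set ℕ), (∀ a b, F v a b → a ∈ W → b ∈ W) → (∃ a b, F v a b ∧ a ∈ W) →
    ∀ a b, F v a b → a ∈ W
  disjoint : ∀ {i j k a b c}, F i j k → F a b c → i ≠ a → i ≠ b → i ≠ c → j ≠ a → j ≠ b → j ≠ c →
    ¬ Meets (pt i) (pt j) (pt a) (pt b) (pt c)
  edges : ∃ l : List (ℕ × ℕ), l.Sublist (edgePairs n) ∧ 3 * n ≤ l.length ∧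
    ∀ p ∈ l, ∃ k, F p.1 p.2 k

/-- The set of indices of triangles. -/
def triangleSet (F : ℕ → ℕ → ℕ → Prop) : Set ℕ :=
  {t | ∃ i j k, i < j ∧ j < k ∧ F i j k ∧ t = triangleIndex i j k}

def maskOf (l : List ℕ) : ℕ := l.foldr (fun t m => Nat.lor (2 ^ t) m) 0

theorem maskOf_testBit {l : List ℕ} {t : ℕ} : (maskOf l).testBit t = true ↔ t ∈ l := by
  induction l with
  | nil => simp [maskOf]
  | cons a l ih =>
    change (Nat.lor (2 ^ a) (maskOf l)).testBit t = true ↔ _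
    rw [lor_testBit, ih, Nat.testBit_two_pow]
    simp [eq_comm]

/-- The mask of the triangles that contain an edge. -/
def starMask (n : ℕ) (p : ℕ × ℕ) : ℕ :=
  maskOf (((List.range n).filter fun k => k ≠ p.1 ∧ k ≠ p.2).map (sortedTriangleIndex p.1 p.2))

namespace StarList

def toList : StarList → List (ℕ × ℕ)
  | nil => []
  | cons e s tl => (e, s) :: tl.toList

def toEdgeList (M : ℕ) : StarList → EdgeList
  | nil => .nil
  | cons e s tl =>
    .cons s (Nat.land (Nat.shiftRight M (Nat.add 70 (Nat.mul 56 e))) 72057594037927935)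
      (Nat.lor s (Nat.land (Nat.shiftRight M (Nat.add 70 (Nat.mul 56 e))) 72057594037927935))
      (toEdgeList M tl)

end StarList

theorem force_eq {α : Type} (n : ℕ) (k : ℕ → α) : force n k = k n := by
  cases n <;> rfl

theorem edgeList_eq (L : StarList) (M : ℕ) (k : EdgeList → Bool) :
    edgeList L M k = k (L.toEdgeList M) := by
  induction L generalizing k with
  | nil => rfl
  | cons e s tl ih =>
    change edgeList tl M _ = _
    rw [ih, force_eq, force_eq]
    rfl

def starsOf (n : ℕ) : List (ℕ × ℕ) :=
  (edgePairs n).map fun p => (edgeIndex p.1 p.2, starMask n p)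

theorem stars7_toList : stars7.toList = starsOf 7 := by decide +kernel

theorem stars8_toList : stars8.toList = starsOf 8 := by decide +kernel

theorem land_shiftRight_testBit {M e t : ℕ}
    (h : (Nat.land (Nat.shiftRight M (Nat.add 70 (Nat.mul 56 e))) 72057594037927935).testBit t
      = true) : t < 56 ∧ M.testBit (70 + (56 * e + t)) = true := by
  obtain ⟨h1, h2⟩ := land_testBit.1 h
  constructor
  · have : (72057594037927935 : ℕ) = 2 ^ 56 - 1 := by norm_num
    rw [this, Nat.testBit_two_pow_sub_one] at h2
    simpa using h2
  · change (M >>> (70 + 56 * e)).testBit t = true at h1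
    rw [Nat.testBit_shiftRight] at h1
    rwa [← Nat.add_assoc]

variable {n : ℕ} {pt : ℕ → Point} {F : ℕ → ℕ → ℕ → Prop}

theorem Candidate.lt' (h : Candidate n pt F) {i j k : ℕ} (hF : F i j k) : j < n ∧ k < n :=
  ⟨h.lt (h.rotate hF), h.lt (h.rotate (h.rotate hF))⟩

theorem Candidate.ne' (h : Candidate n pt F) {i j k : ℕ} (hF : F i j k) : j ≠ k ∧ k ≠ i :=
  ⟨h.ne (h.rotate hF), h.ne (h.rotate (h.rotate hF))⟩

theorem triangleIndex_mem (hc : Candidate n pt F) (hn : n ≤ 8) {i j k : ℕ}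
    (h : i < j ∧ j < k ∧ k < n) : triangleIndex i j k ∈ triangleSet F ↔ F i j k := by
  refine ⟨?_, fun hF => ⟨i, j, k, h.1, h.2.1, hF, rfl⟩⟩
  rintro ⟨a, b, c, hab, hbc, hF, he⟩
  obtain ⟨rfl, rfl, rfl⟩ := triangleIndex_inj ⟨h.1, h.2.1, by omega⟩
    ⟨hab, hbc, (hc.lt' hF).2.trans_le hn⟩ he
  exact hF

theorem sortedTriangleIndex_mem (hc : Candidate n pt F) (hn : n ≤ 8) {i j k : ℕ} (hij : i < j)
    (hjn : j < n) (hk : k < n) (hki : k ≠ i) (hkj : k ≠ j) :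
    sortedTriangleIndex i j k ∈ triangleSet F ↔ F i j k := by
  unfold sortedTriangleIndex
  split_ifs with h1 h2
  · rw [triangleIndex_mem hc hn ⟨h1, hij, hjn⟩]
    exact ⟨hc.rotate, fun h => hc.rotate (hc.rotate h)⟩
  · rw [triangleIndex_mem hc hn ⟨by omega, h2, hjn⟩]
    exact ⟨fun h => hc.rotate (hc.rotate (hc.swap (hc.rotate h))),
      fun h => hc.rotate (hc.rotate (hc.swap (hc.rotate h)))⟩
  · rw [triangleIndex_mem hc hn ⟨hij, by omega, hk⟩]

theorem sortedTriangleIndex_inj {i j k l : ℕ} (hij : i < j) (hj : j < 8) (hk : k < 8) (hl : l < 8)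
    (hki : k ≠ i) (hkj : k ≠ j) (hli : l ≠ i) (hlj : l ≠ j)
    (h : sortedTriangleIndex i j k = sortedTriangleIndex i j l) : k = l := by
  unfold sortedTriangleIndex at h
  split_ifs at h <;>
    (have := triangleIndex_inj (by omega) (by omega) h; omega)

theorem starMask_testBit {n : ℕ} {p : ℕ × ℕ} {t : ℕ} : (starMask n p).testBit t = true ↔
    ∃ k, k < n ∧ k ≠ p.1 ∧ k ≠ p.2 ∧ t = sortedTriangleIndex p.1 p.2 k := by
  simp only [starMask, maskOf_testBit, List.mem_map, List.mem_filter, List.mem_range,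
    decide_eq_true_eq]
  exact ⟨fun ⟨k, ⟨h1, h2, h3⟩, h⟩ => ⟨k, h1, h2, h3, h.symm⟩,
    fun ⟨k, h1, h2, h3, h⟩ => ⟨k, ⟨h1, h2, h3⟩, h.symm⟩⟩

theorem mem_star_iff (hc : Candidate n pt F) (hn : n ≤ 8) {i j t : ℕ} (hij : i < j) (hj : j < n) :
    (t ∈ triangleSet F ∧ (starMask n (i, j)).testBit t = true) ↔
      ∃ k, F i j k ∧ t = sortedTriangleIndex i j k := by
  rw [starMask_testBit]
  constructor
  · rintro ⟨ht, k, hk, hki, hkj, rfl⟩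
    exact ⟨k, (sortedTriangleIndex_mem hc hn hij hj hk hki hkj).1 ht, rfl⟩
  · rintro ⟨k, hF, rfl⟩
    have h1 := hc.lt' hF
    have h2 := hc.ne' hF
    exact ⟨(sortedTriangleIndex_mem hc hn hij hj h1.2 h2.2 h2.1.symm).2 hF,
      k, h1.2, h2.2, h2.1.symm, rfl⟩

theorem absent_starMask_iff (hc : Candidate n pt F) (hn : n ≤ 8) {i j : ℕ} (hij : i < j)
    (hj : j < n) : Absent (triangleSet F) (starMask n (i, j)) ↔ ¬ ∃ k, F i j k := by
  constructor
  · rintro h ⟨k, hk⟩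
    obtain ⟨h1, h2⟩ := (mem_star_iff hc hn hij hj).2 ⟨k, hk, rfl⟩
    exact h _ h1 h2
  · rintro h t ht hs
    obtain ⟨k, hk, _⟩ := (mem_star_iff hc hn hij hj).1 ⟨ht, hs⟩
    exact h ⟨k, hk⟩

theorem edgeOK_of_candidate (hc : Candidate n pt F) (hn : n ≤ 8) {i j p : ℕ} (hij : i < j)
    (hj : j < n) (hp : ∀ {a b c k}, F i j k → F a b c → a < b → b < c →
      p.testBit (triangleIndex a b c) = true → False) :
    EdgeOK (triangleSet F) (starMask n (i, j)) p := by
  by_cases hE : ∃ k, F i j k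
  · right
    obtain ⟨k, hk⟩ := hE
    obtain ⟨a, b, hab, h⟩ := hc.two hk
    refine ⟨⟨sortedTriangleIndex i j a, sortedTriangleIndex i j b, fun he => hab ?_, fun t => ?_⟩, ?_⟩
    · have ha := (h a).2 (Or.inl rfl)
      have hb := (h b).2 (Or.inr rfl)
      have h1 := hc.lt' ha
      have h2 := hc.ne' ha
      have h3 := hc.lt' hb
      have h4 := hc.ne' hb
      exact sortedTriangleIndex_inj hij (by omega) (by omega) (by omega) h2.2 h2.1.symm h4.2
        h4.1.symm he
    · rw [mem_star_iff hc hn hij hj]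
      constructor
      · rintro ⟨l, hl, rfl⟩
        rcases (h l).1 hl with rfl | rfl <;> simp
      · rintro (rfl | rfl)
        · exact ⟨a, (h a).2 (Or.inl rfl), rfl⟩
        · exact ⟨b, (h b).2 (Or.inr rfl), rfl⟩
    · rintro t ⟨a, b, c, hab, hbc, hF, rfl⟩ ht
      exact hp hk hF hab hbc ht
  · exact Or.inl ((absent_starMask_iff hc hn hij hj).2 hE)

theorem edgeOK_of_pierceMask (hc : Candidate n pt F) (hn : n ≤ 8) {FL : FiveList}
    (hFL : FivesValid n FL) {S : PointList} (hS : S.toList = (List.range n).map pt) {i j : ℕ}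
    (hij : i < j) (hj : j < n) :
    EdgeOK (triangleSet F) (starMask n (i, j))
      (Nat.land (Nat.shiftRight (pierceMask FL (signMask S))
        (Nat.add 70 (Nat.mul 56 (edgeIndex i j)))) 72057594037927935) := by
  refine edgeOK_of_candidate hc hn hij hj fun {a b c k} h1 h2 hab hbc hb => ?_
  obtain ⟨h3, h4⟩ := land_shiftRight_testBit hb
  obtain ⟨a', b', c', d', e', h5, h6, h7, h8, h9⟩ :=
    meets_of_pierceMask hFL hS hc.small hc.general (by omega) h4
  have h10 := triangleIndex_lt (i := c') (j := d') (k := e') (by omega)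
  have h11 : edgeIndex i j = edgeIndex a' b' ∧ triangleIndex a b c = triangleIndex c' d' e' := by
    unfold pairCode at h8; omega
  obtain ⟨rfl, rfl⟩ := edgeIndex_inj ⟨hij, by omega⟩ ⟨h5.1, by omega⟩ h11.1
  have := (hc.lt' h2).2
  obtain ⟨rfl, rfl, rfl⟩ := triangleIndex_inj ⟨hab, hbc, by omega⟩ ⟨h6.1, h6.2.1, by omega⟩ h11.2
  exact hc.disjoint h1 h2 h7.1 h7.2.1 h7.2.2.1 h7.2.2.2.1 h7.2.2.2.2.1 h7.2.2.2.2.2 h9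

theorem toEdgeList_all {Q : ℕ → ℕ → Prop} {M : ℕ} {L : StarList}
    (h : ∀ p ∈ L.toList,
      Q p.2 (Nat.land (Nat.shiftRight M (Nat.add 70 (Nat.mul 56 p.1))) 72057594037927935)) :
    (L.toEdgeList M).All fun s p q => q = Nat.lor s p ∧ Q s p := by
  induction L with
  | nil => trivial
  | cons e s tl ih =>
    exact ⟨⟨rfl, h (e, s) (by simp [StarList.toList])⟩, ih fun p hp => h p (by simp [StarList.toList, hp])⟩

theorem toEdgeList_covers {M t : ℕ} {L : StarList} (h : ∃ p ∈ L.toList, p.2.testBit t = true) :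
    (L.toEdgeList M).Covers t := by
  induction L with
  | nil => simp [StarList.toList] at h
  | cons e s tl ih =>
    obtain ⟨p, hp, ht⟩ := h
    rcases List.mem_cons.1 hp with rfl | hp
    · exact Or.inl ht
    · exact Or.inr (ih ⟨p, hp, ht⟩)

open Classical in
theorem toEdgeList_absentCount {T : Set ℕ} {M : ℕ} {L : StarList} :
    (L.toEdgeList M).absentCount T = L.toList.countP fun p => Absent T p.2 := by
  induction L with
  | nil => rfl
  | cons e s tl ih =>
    rw [StarList.toEdgeList, EdgeList.absentCount, ih, StarList.toList, List.countP_cons, add_comm]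
    simp

theorem absentCount_le (hc : Candidate n pt F) (hn : n ≤ 8) {M : ℕ} {L : StarList}
    (hL : L.toList.Perm (starsOf n)) :
    (L.toEdgeList M).absentCount (triangleSet F) + 3 * n ≤ (edgePairs n).length := by
  classical
  rw [toEdgeList_absentCount, hL.countP_eq, starsOf, List.countP_map]
  obtain ⟨l, hl, hlen, hF⟩ := hc.edges
  have h1 : l.length ≤ (edgePairs n).countP fun p => decide (∃ k, F p.1 p.2 k) := by
    have : l.countP (fun p => decide (∃ k, F p.1 p.2 k)) = l.length :=
      List.countP_eq_length.2 fun p hp => by simpa using hF p hp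
    rw [← this]
    exact hl.countP_le
  have h2 : (edgePairs n).countP ((fun p : ℕ × ℕ => decide (Absent (triangleSet F) p.2)) ∘
      fun p => (edgeIndex p.1 p.2, starMask n p)) =
      (edgePairs n).countP fun p => !decide (∃ k, F p.1 p.2 k) := by
    refine List.countP_congr fun p hp => ?_
    obtain ⟨i, j⟩ := p
    have := mem_edgePairs.1 hp
    simp only [Function.comp, decide_eq_true_eq, absent_starMask_iff hc hn this.1 this.2,
      Bool.not_eq_true', decide_eq_false_iff_not]
  rw [h2]
  have h3 := List.length_eq_countP_add_countP (fun p : ℕ × ℕ => decide (∃ k, F p.1 p.2 k))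
    (l := edgePairs n)
  simp only [Bool.not_eq_true, Bool.decide_eq_false] at h3
  omega

theorem compatible_of_candidate (hc : Candidate n pt F) (hn : n ≤ 8) {FL : FiveList}
    (hFL : FivesValid n FL) {S : PointList} (hS : S.toList = (List.range n).map pt) {L : StarList}
    (hL : L.toList.Perm (starsOf n)) {A C r : ℕ} (hr : (edgePairs n).length ≤ r + 3 * n)
    (hC : ∀ i, C.testBit i = true → i ∈ triangleSet F)
    (hA : ∀ i ∈ triangleSet F, A.testBit i = true) :
    Compatible (triangleSet F) ∅ 0 A C r (L.toEdgeList (pierceMask FL (signMask S))) .nil := by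
  refine ⟨hC, hA, toEdgeList_all fun p hp => ?_, trivial, ?_, fun t ht => ?_⟩
  · obtain ⟨⟨i, j⟩, hij, rfl⟩ := List.mem_map.1 (hL.mem_iff.1 hp)
    have := mem_edgePairs.1 hij
    exact edgeOK_of_pierceMask hc hn hFL hS this.1 this.2
  · have := absentCount_le hc hn (M := pierceMask FL (signMask S)) hL
    omega
  · refine Or.inr (Or.inl (toEdgeList_covers ?_))
    obtain ⟨i, j, k, hij, hjk, hF, rfl⟩ := ht
    have := (hc.lt' hF).2
    refine ⟨(edgeIndex i j, starMask n (i, j)), hL.mem_iff.2 (List.mem_map.2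
      ⟨(i, j), mem_edgePairs.2 ⟨hij, by omega⟩, rfl⟩), ?_⟩
    rw [starMask_testBit]
    refine ⟨k, this, by dsimp only; omega, by dsimp only; omega, ?_⟩
    unfold sortedTriangleIndex
    rw [if_neg (by dsimp only; omega), if_neg (by dsimp only; omega)]

theorem triangleSet_lt (hc : Candidate n pt F) (hn : n ≤ 8) {t : ℕ} (ht : t ∈ triangleSet F) :
    t < 56 := by
  obtain ⟨i, j, k, hij, hjk, hF, rfl⟩ := ht
  have := (hc.lt' hF).2
  exact triangleIndex_lt ⟨hij, hjk, by omega⟩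

theorem triangleSet_lt_of_seven (hc : Candidate 7 pt F) {t : ℕ} (ht : t ∈ triangleSet F) :
    t < 35 := by
  obtain ⟨i, j, k, hij, hjk, hF, rfl⟩ := ht
  have := (hc.lt' hF).2
  have hn : ∀ t ∈ triples 7, triangleIndex t.1 t.2.1 t.2.2 < 35 := by decide +kernel
  exact hn _ (mem_triples.2 ⟨hij, hjk, this⟩)

theorem not_check7 {S : PointList} (hS : S.toList = (List.range 7).map pt)
    (hc : Candidate 7 pt F) : ¬ check7 S = true := by
  intro h
  rw [check7, force_eq, force_eq, edgeList_eq] at h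
  have hL : stars7.toList.Perm (starsOf 7) := by rw [stars7_toList]
  have hlen : (edgePairs 7).length ≤ 0 + 3 * 7 := by decide
  obtain ⟨C, hC, h⟩ := solve_sound 50 _ _ _ _ _
    (compatible_of_candidate hc (by norm_num) fivesValid7 hS hL hlen (by simp) fun t ht => by
      have e : (34359738367 : ℕ) = 2 ^ 35 - 1 := by norm_num
      change (34359738367 : ℕ).testBit t = true
      rw [e, Nat.testBit_two_pow_sub_one]
      simpa using triangleSet_lt_of_seven hc ht) h
  obtain ⟨_, _, h⟩ := solve_sound 1 _ _ _ _ _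
    (compatible_of_candidate hc (by norm_num) fivesValid7 hS hL hlen (fun i => (hC i).1)
      fun i => (hC i).2) h
  simp at h

theorem leaf_of_check8 {S : PointList} {order : List ℕ} (hS : S.toList = (List.range 8).map pt)
    (hc : Candidate 8 pt F) (ho : (reorder stars8 order).toList.Perm (starsOf 8))
    (h : check8 S order = true) :
    ∃ C, (∀ t, C.testBit t = true ↔ t ∈ triangleSet F) ∧ leafCheck C = true := by
  rw [check8, force_eq, force_eq, edgeList_eq] at h
  have hlen : (edgePairs 8).length ≤ 4 + 3 * 8 := by decide
  obtain ⟨C, hC, h⟩ := solve_sound 100 _ _ _ _ _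
    (compatible_of_candidate hc le_rfl fivesValid8 hS ho hlen (by simp) fun t ht => by
      have e : (72057594037927935 : ℕ) = 2 ^ 56 - 1 := by norm_num
      change (72057594037927935 : ℕ).testBit t = true
      rw [e, Nat.testBit_two_pow_sub_one]
      simpa using triangleSet_lt hc le_rfl ht) h
  exact solve_sound 1 _ _ _ _ _
    (compatible_of_candidate hc le_rfl fivesValid8 hS ho hlen (fun i => (hC i).1)
      fun i => (hC i).2) h

theorem reach_mono (L : List ℕ) (R i : ℕ) (h : R.testBit i = true) :
    (reach L R).testBit i = true := by
  induction L generalizing R with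
  | nil => exact h
  | cons m L ih =>
    change (Bool.rec (motive := fun _ => ℕ) (reach L (Nat.lor R m)) (reach L R)
      (Nat.beq (Nat.land R m) (nat_lit 0))).testBit i = true
    cases Nat.beq (Nat.land R m) (nat_lit 0)
    · exact ih _ (lor_testBit.2 (Or.inl h))
    · exact ih _ h

/-- The pairs (triangle, opposite edge) at the vertex `v`. -/
def linkRow (v : ℕ) : List (ℕ × ℕ) :=
  ((edgePairs 8).filter fun p => v ≠ p.1 ∧ v ≠ p.2).map fun p =>
    (sortedTriangleIndex p.1 p.2 v, Nat.lor (2 ^ p.1) (2 ^ p.2))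

theorem linkTable_eq : linkTable.map List.toFinset =
    (List.range 8).map fun v => (linkRow v).toFinset := by decide +kernel

theorem linkTable_row {T : List (ℕ × ℕ)} (hT : T ∈ linkTable) :
    ∃ v < 8, ∀ x, x ∈ T ↔ x ∈ linkRow v := by
  have h := List.mem_map_of_mem (f := List.toFinset) hT
  rw [linkTable_eq, List.mem_map] at h
  obtain ⟨v, hv, h⟩ := h
  refine ⟨v, List.mem_range.1 hv, fun x => ?_⟩
  rw [← List.mem_toFinset, ← List.mem_toFinset, h]

theorem not_isPinchedAt (hc : Candidate 8 pt F) {C : ℕ}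
    (hC : ∀ t, C.testBit t = true ↔ t ∈ triangleSet F) {T : List (ℕ × ℕ)} (hT : T ∈ linkTable) :
    ¬ isPinchedAt C T = true := by
  intro h
  obtain ⟨v, hv, hTv⟩ := linkTable_row hT
  unfold isPinchedAt at h
  generalize hL : (T.filterMap fun tm => if Nat.testBit C tm.1 then some tm.2 else none) = L at h
  have hmem : ∀ m, m ∈ L ↔ ∃ a b, a < b ∧ b < 8 ∧ F v a b ∧ m = Nat.lor (2 ^ a) (2 ^ b) := by
    intro m
    rw [← hL, List.mem_filterMap]
    constructor
    · rintro ⟨⟨t, m'⟩, h1, h2⟩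
      rw [hTv] at h1
      simp only [linkRow, List.mem_map, List.mem_filter, Prod.exists, Prod.mk.injEq,
        mem_edgePairs, decide_eq_true_eq] at h1
      obtain ⟨a, b, ⟨⟨hab, hb⟩, hva, hvb⟩, rfl, rfl⟩ := h1
      dsimp only at h2
      split_ifs at h2 with h3
      rw [hC, sortedTriangleIndex_mem hc le_rfl hab hb hv hva hvb] at h3
      exact ⟨a, b, hab, hb, hc.rotate (hc.rotate h3), (Option.some.inj h2).symm⟩
    · rintro ⟨a, b, hab, hb, hF, rfl⟩
      have h1 := hc.ne hF
      have h2 := (hc.ne' hF).2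
      refine ⟨(sortedTriangleIndex a b v, Nat.lor (2 ^ a) (2 ^ b)), (hTv _).2 ?_, ?_⟩
      · simp only [linkRow, List.mem_map, List.mem_filter, Prod.exists, Prod.mk.injEq,
          mem_edgePairs, decide_eq_true_eq]
        exact ⟨a, b, ⟨⟨hab, hb⟩, h1, h2.symm⟩, rfl, rfl⟩
      · rw [if_pos]
        exact (hC _).2 ((sortedTriangleIndex_mem hc le_rfl hab hb hv h1 h2.symm).2 (hc.rotate hF))
  have hbit : ∀ a b t, (Nat.lor (2 ^ a) (2 ^ b)).testBit t = true ↔ t = a ∨ t = b := by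
    intro a b t
    rw [lor_testBit, Nat.testBit_two_pow, Nat.testBit_two_pow]
    simp [eq_comm]
  cases L with
  | nil => exact absurd h (by simp)
  | cons m tl =>
    dsimp only at h
    generalize hR : reach (m :: tl) (reach (m :: tl) (reach tl m)) = R at h
    have hRm : ∀ i, m.testBit i = true → R.testBit i = true := fun i hi => by
      rw [← hR]
      exact reach_mono _ _ _ (reach_mono _ _ _ (reach_mono _ _ _ hi))
    have hm0 : m ∈ m :: tl := by simp
    generalize m :: tl = L at *
    simp only [isSeparated, Bool.and_eq_true, List.any_eq_true, List.all_eq_true, Bool.or_eq_true]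
      at h
    obtain ⟨⟨m', hm', h0⟩, hall⟩ := h
    obtain ⟨a', b', hab', hb', hF', rfl⟩ := (hmem m').1 hm'
    obtain ⟨a, b, hab, hb, hF, rfl⟩ := (hmem m).1 hm0
    have closed : ∀ c d x y, F v c d → c < d → (x = c ∨ x = d) → (y = c ∨ y = d) →
        R.testBit x = true → R.testBit y = true := by
      intro c d x y hcd hlt hx hy hxR
      have hin := (hmem _).2 ⟨c, d, hlt, (hc.lt' hcd).2, hcd, rfl⟩
      rcases hall _ hin with h | h
      · exact absurd ((hbit c d x).2 hx) (land_eq_zero (beq_true h) hxR)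
      · rw [← beq_true h]
        exact lor_testBit.2 (Or.inr ((hbit c d y).2 hy))
    have key := hc.link v {x | R.testBit x = true} (fun c d hcd hcR => by
      rcases lt_or_gt_of_ne (hc.ne' hcd).1 with hlt | hlt
      · exact closed c d c d hcd hlt (Or.inl rfl) (Or.inr rfl) hcR
      · exact closed d c c d (hc.rotate (hc.rotate (hc.swap (hc.rotate hcd)))) hlt (Or.inr rfl)
          (Or.inl rfl) hcR) ⟨a, b, hF, hRm a ((hbit a b a).2 (Or.inl rfl))⟩ a' b' hF'
    exact land_eq_zero (beq_true h0) key ((hbit a' b' a').2 (Or.inl rfl))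

/-- The triangles of two triangulated tori with eight vertices. -/
def facets : Bool → List (Finset (Fin 8))
  | false => [{0, 1, 2}, {0, 1, 3}, {0, 2, 4}, {0, 3, 4}, {1, 2, 5}, {1, 3, 6}, {1, 4, 5}, {1, 4, 7},
  {1, 6, 7}, {2, 4, 6}, {2, 5, 7}, {2, 6, 7}, {3, 4, 7}, {3, 5, 6}, {3, 5, 7}, {4, 5, 6}]
  | true => [{0, 1, 2}, {0, 1, 3}, {0, 2, 4}, {0, 3, 5}, {0, 4, 5}, {1, 2, 5}, {1, 3, 6}, {1, 4, 6},
  {1, 4, 7}, {1, 5, 7}, {2, 4, 7}, {2, 5, 6}, {2, 6, 7}, {3, 5, 7}, {3, 6, 7}, {4, 5, 6}]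

/-- Relabelings of the sets of triangles `goodMasks`. -/
def relabelings : List (ℕ × Bool × (Fin 8 → Fin 8)) := [
  (5862881346225221, true, ![4, 0, 5, 6, 3, 2, 7, 1]),
  (6052307263294880, true, ![1, 4, 3, 2, 0, 6, 5, 7]),
  (6052307263295236, false, ![5, 3, 2, 1, 0, 7, 4, 6]),
  (6476821151618178, true, ![4, 0, 3, 2, 7, 5, 6, 1]),
  (11454862864687642, true, ![0, 4, 6, 5, 2, 3, 7, 1]),
  (11692241446374532, true, ![2, 0, 7, 6, 5, 4, 3, 1]),
  (13834211532357772, true, ![4, 3, 0, 5, 6, 7, 2, 1]),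
  (22699152441888868, true, ![4, 3, 5, 6, 0, 7, 2, 1]),
  (22852337769153840, true, ![0, 3, 2, 6, 1, 5, 7, 4]),
  (41113386587785540, true, ![4, 7, 5, 6, 3, 0, 2, 1])]

theorem relabelings_spec : goodMasks = relabelings.map Prod.fst ∧
    ∀ r ∈ relabelings, Function.Injective r.2.2 ∧ ∀ i j k : Fin 8, i < j → j < k →
      (r.1.testBit (triangleIndex i j k) = true ↔
        ({r.2.2 i, r.2.2 j, r.2.2 k} : Finset (Fin 8)) ∈ facets r.2.1) := by
  decide +kernel

theorem exists_facets_of_leafCheck (hc : Candidate 8 pt F) {C : ℕ}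
    (hC : ∀ t, C.testBit t = true ↔ t ∈ triangleSet F) (h : leafCheck C = true) :
    ∃ (b : Bool) (f : Fin 8 → Fin 8), Function.Injective f ∧ ∀ i j k : Fin 8, i < j → j < k →
      (F i j k ↔ ({f i, f j, f k} : Finset (Fin 8)) ∈ facets b) := by
  rw [leafCheck, Bool.or_eq_true, List.any_eq_true, List.any_eq_true] at h
  rcases h with ⟨m, hm, h⟩ | ⟨T, hT, h⟩
  · obtain rfl := beq_true h
    rw [relabelings_spec.1] at hm
    obtain ⟨r, hr, rfl⟩ := List.mem_map.1 hm
    obtain ⟨h1, h2⟩ := relabelings_spec.2 r hr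
    refine ⟨r.2.1, r.2.2, h1, fun i j k hij hjk => ?_⟩
    rw [← h2 i j k hij hjk, hC, triangleIndex_mem hc le_rfl ⟨hij, hjk, k.2⟩]
  · exact absurd h (not_isPinchedAt hc hC hT)

end CuboidTorus

namespace CuboidTorus

/-- The integer points of the cuboid. -/
def grid : List Point := points.toList

/-- The action of a symmetry of the cuboid on coordinates. -/
def act (g : ℕ) (v : ℕ × ℕ × ℕ) : ℕ × ℕ × ℕ :=
  let x := if g.testBit 0 then 2 - v.1 else v.1
  let y := if g.testBit 1 then 2 - v.2.1 else v.2.1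
  let z := if g.testBit 2 then 3 - v.2.2 else v.2.2
  if g.testBit 3 then (y, x, z) else (x, y, z)

/-- The image of a point of the cuboid under a symmetry. -/
def sym (g : ℕ) (p : Point) : Point :=
  (grid.find? fun q => (q.x, q.y, q.z) = act g (p.x, p.y, p.z)).getD p

def packed : ℕ → (ℕ → ℕ) → ℕ
  | 0, _ => 0
  | n + 1, f => f 0 + 2 ^ 40 * packed n fun g => f (g + 1)

theorem grid_spec : ∀ p ∈ grid, (p.x ≤ 2 ∧ p.y ≤ 2 ∧ p.z ≤ 3) ∧ p.c < 36 ∧ p.w = 2 ^ p.c ∧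
    p.im = packed 16 (fun g => (sym g p).w) ∧
    ∀ g < 16, sym g p ∈ grid ∧ ((sym g p).x, (sym g p).y, (sym g p).z) = act g (p.x, p.y, p.z) := by
  decide +kernel

theorem packed_add (n : ℕ) (f g : ℕ → ℕ) :
    packed n f + packed n g = packed n fun i => f i + g i := by
  induction n generalizing f g with
  | zero => rfl
  | succ n ih => simp only [packed, ← ih]; ring

theorem packed_mul (n k : ℕ) (f : ℕ → ℕ) : packed n f * k = packed n fun i => f i * k := by
  induction n generalizing f with
  | zero => simp [packed]
  | succ n ih => simp only [packed, ← ih]; ring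

theorem land_packed (n : ℕ) (f : ℕ → ℕ) (h : ∀ g < n, f g < 2 ^ 39) :
    Nat.land (packed n f) (packed n fun _ => 2 ^ 39) = 0 := by
  induction n generalizing f with
  | zero => simp [packed, Nat.land]
  | succ n ih =>
    by_contra hne
    obtain ⟨i, hi, hi'⟩ := land_ne_zero hne
    have h0 := h 0 (by omega)
    rw [packed, add_comm, Nat.testBit_two_pow_mul_add _ (by omega)] at hi
    rw [packed, add_comm, Nat.testBit_two_pow_mul_add _ (by norm_num)] at hi'
    split_ifs at hi hi' with h1
    · rw [Nat.testBit_two_pow] at hi'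
      obtain rfl : 39 = i := by simpa using hi'
      rw [Nat.testBit_eq_false_of_lt h0] at hi
      cases hi
    · exact land_eq_zero (ih _ fun g hg => h (g + 1) (by omega)) hi hi'

theorem exceeds_packed {f : ℕ → ℕ} {b : ℕ} (hb : b < 2 ^ 39) (h : exceeds (packed 16 f) b = true) :
    ∃ g < 16, b < f g := by
  by_contra! hle
  have e1 : 4149515568884766920937232837442232774020040542402584807061061931295931780496151366866260070932401194886165022370260496548379674293686382654910946896395330563926463587380741422448641 =
    packed 16 fun _ => 1 := by decide +kernel
  have e2 : 2281220308813172367105028186310614278865335370011289985560797551353168114569986659143204481342118829924787355384240286166529482608961908836273173851188562567574195002462095706835127466834526208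
    = packed 16 fun _ => 2 ^ 39 := by decide +kernel
  have e3 : Nat.land (Nat.add (packed 16 f) (Nat.mul 4149515568884766920937232837442232774020040542402584807061061931295931780496151366866260070932401194886165022370260496548379674293686382654910946896395330563926463587380741422448641
    (Nat.sub 549755813887 b))) 2281220308813172367105028186310614278865335370011289985560797551353168114569986659143204481342118829924787355384240286166529482608961908836273173851188562567574195002462095706835127466834526208 = 0 := by
    rw [e1, e2, Nat.add_eq, Nat.mul_eq, packed_mul, packed_add]
    refine land_packed _ _ fun g hg => ?_
    have := hle g hg
    simp only [Nat.sub_eq]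
    omega
  unfold exceeds at h
  erw [e3] at h
  exact absurd h (by decide)

def Generic (X : List Point) : Prop :=
  X.Nodup ∧ ∀ a ∈ X, ∀ b ∈ X, ∀ c ∈ X, ∀ d ∈ X, a ≠ b → a ≠ c → a ≠ d → b ≠ c → b ≠ d → c ≠ d →
    det a b c d ≠ 0

def weight (f : Point → ℕ) (X : List Point) : ℕ := (X.map f).sum

/-- `Z` is a set of points whose weight is maximal in its orbit. -/
structure Admissible (Z : List Point) : Prop where
  sub : ∀ p ∈ Z, p ∈ grid
  generic : Generic Z
  maximal : ∀ g < 16, weight (fun p => (sym g p).w) Z ≤ weight Point.w Z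
  seven_le : 7 ≤ Z.length

/-- The state of the search when the points `S` of `Z` have been chosen and the points `Y` are still
to be chosen from `R`. -/
structure Reaches (Z : List Point) (S : PointList) (L : List (Point × Point)) (ws ims : ℕ)
    (R : PointList) (Y : List Point) : Prop where
  eq : Z = Y.reverse ++ S.toList
  pairs : ∀ p ∈ L, p.1 ∈ S.toList ∧ p.2 ∈ S.toList ∧ p.1 ≠ p.2
  ws : ws = weight Point.w S.toList
  ims : ims = packed 16 fun g => weight (fun p => (sym g p).w) S.toList
  sublist : Y.Sublist R.toList
  grid : R.toList.Sublist grid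

theorem weight_append (f : Point → ℕ) (X Y : List Point) :
    weight f (X ++ Y) = weight f X + weight f Y := by
  simp [weight]

theorem weight_reverse (f : Point → ℕ) (X : List Point) : weight f X.reverse = weight f X := by
  simp [weight, List.map_reverse, List.sum_reverse]

theorem weight_sublist (f : Point → ℕ) {X Y : List Point} (h : X.Sublist Y) :
    weight f X ≤ weight f Y :=
  List.Sublist.sum_le_sum (h.map f) fun _ _ => Nat.zero_le _

theorem totalWeight_eq (R : PointList) : totalWeight R = weight Point.w R.toList := by
  induction R with
  | nil => rfl
  | cons c x y z w im tl ih =>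
    change Nat.add w (totalWeight tl) = _
    rw [ih]; simp [weight, PointList.toList]

theorem count_eq (R : PointList) : count R = R.toList.length := by
  induction R with
  | nil => rfl
  | cons c x y z w im tl ih =>
    change Nat.add (count tl) 1 = _
    rw [ih]; simp [PointList.toList]

theorem keepGeneral_toList (Q : PairList) (x y z : ℕ) (R : PointList) :
    (keepGeneral Q x y z R).toList =
      R.toList.filter fun q => dualPair x y z q.x q.y q.z (noneCoplanar Q) := by
  induction R with
  | nil => rfl
  | cons c x' y' z' w im tl ih =>
    rw [PointList.toList, List.filter_cons, ← ih]
    change PointList.toList (Bool.rec (motive := fun _ => PointList) (keepGeneral Q x y z tl)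
      (.cons c x' y' z' w im (keepGeneral Q x y z tl)) (dualPair x y z x' y' z' (noneCoplanar Q))) = _
    cases h : dualPair x y z x' y' z' (noneCoplanar Q) <;> simp [PointList.toList]

theorem grid_small {p : Point} (h : p ∈ grid) : p.Small := (grid_spec p h).1

theorem explore_cons {f : PointList → PairList → ℕ → ℕ → PointList → Bool} {S : PointList}
    {Q : PairList} {ws ims : ℕ} {R : PointList} {y : Point} {Y : List Point}
    (h : explore f S Q ws ims R = true) (hY : (y :: Y).Sublist R.toList) :
    ∃ tl : PointList, (y :: tl.toList).Sublist R.toList ∧ Y.Sublist tl.toList ∧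
      f (.cons y.c y.x y.y y.z y.w y.im S) (addPairs S y.x y.y y.z Q) (ws + y.w) (ims + y.im)
        (keepGeneral Q y.x y.y y.z tl) = true := by
  induction R with
  | nil => simp [PointList.toList] at hY
  | cons c x' y' z' w im tl ih =>
    have h' : Bool.rec (motive := fun _ => Bool) false (explore f S Q ws ims tl)
      (f (.cons c x' y' z' w im S) (addPairs S x' y' z' Q) (ws + w) (ims + im)
        (keepGeneral Q x' y' z' tl)) = true := h
    cases hf : f (.cons c x' y' z' w im S) (addPairs S x' y' z' Q) (ws + w) (ims + im)
        (keepGeneral Q x' y' z' tl) with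
    | false => rw [hf] at h'; exact absurd h' (by simp)
    | true =>
      rw [hf] at h'
      rw [PointList.toList] at hY
      rcases List.sublist_cons_iff.1 hY with hY | ⟨r, hr, hY⟩
      · obtain ⟨t, h1, h2, h3⟩ := ih h' hY
        exact ⟨t, h1.cons _, h2, h3⟩
      · rw [List.cons.injEq] at hr
        obtain ⟨rfl, rfl⟩ := hr
        exact ⟨tl, by rw [PointList.toList], hY, hf⟩

theorem Reaches.explore {f : PointList → PairList → ℕ → ℕ → PointList → Bool} {Z : List Point}
    {S : PointList} {L : List (Point × Point)} {ws ims : ℕ} {R : PointList} {y : Point}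
    {Y : List Point} (hZ : Admissible Z) (h : Reaches Z S L ws ims R (y :: Y))
    (he : explore f S (encodePairs L) ws ims R = true) :
    ∃ L' ws' ims' R', Reaches Z (.cons y.c y.x y.y y.z y.w y.im S) L' ws' ims' R' Y ∧
      f (.cons y.c y.x y.y y.z y.w y.im S) (encodePairs L') ws' ims' R' = true := by
  obtain ⟨tl, h1, h2, h3⟩ := explore_cons he h.sublist
  rw [addPairs_encodePairs] at h3
  have hyZ : y ∈ Z := by rw [h.eq]; simp
  have hSZ : ∀ p ∈ S.toList, p ∈ Z := fun p hp => by rw [h.eq]; simp [hp]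
  have hYZ : ∀ p ∈ Y, p ∈ Z := fun p hp => by rw [h.eq]; simp [hp]
  have hyg : y ∈ CuboidTorus.grid := hZ.sub y hyZ
  have hnd := hZ.generic.1
  rw [h.eq] at hnd
  obtain ⟨hndY, hndS, hdis⟩ := List.nodup_append.1 hnd
  have hySy : ∀ p ∈ S.toList, p ≠ y := fun p hp => (hdis y (by simp) p hp).symm
  have hSY : ∀ p ∈ S.toList, ∀ q ∈ Y, p ≠ q := fun p hp q hq => (hdis q (by simp [hq]) p hp).symm
  have hyY : y ∉ Y := (List.nodup_cons.1 (List.nodup_reverse.1 hndY)).1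
  refine ⟨_, _, _, _, ⟨?_, ?_, ?_, ?_, ?_, ?_⟩, h3⟩
  · rw [h.eq]; simp [PointList.toList]
  · intro p hp
    rcases List.mem_append.1 hp with hp | hp
    · obtain ⟨a, ha, rfl⟩ := List.mem_map.1 hp
      exact ⟨by simp [PointList.toList, ha], by simp [PointList.toList], hySy a ha⟩
    · obtain ⟨ha, hb, hab⟩ := h.pairs p hp
      exact ⟨by simp [PointList.toList, ha], by simp [PointList.toList, hb], hab⟩
  · rw [h.ws]; simp [weight, PointList.toList, add_comm]
  · refine (congrArg₂ (· + ·) h.ims (grid_spec y hyg).2.2.2.1).trans ?_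
    rw [packed_add]
    simp [weight, PointList.toList, add_comm]
  · rw [keepGeneral_toList]
    have : Y = Y.filter fun q => dualPair y.x y.y y.z q.x q.y q.z
        (noneCoplanar (encodePairs L)) := by
      symm
      rw [List.filter_eq_self]
      intro q hq
      rw [noneCoplanar_iff (grid_small hyg) (grid_small (hZ.sub q (hYZ q hq))) fun p hp =>
        ⟨grid_small (hZ.sub _ (hSZ _ (h.pairs p hp).1)),
          grid_small (hZ.sub _ (hSZ _ (h.pairs p hp).2.1))⟩]
      intro p hp
      obtain ⟨ha, hb, hab⟩ := h.pairs p hp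
      exact hZ.generic.2 _ (hSZ _ ha) _ (hSZ _ hb) _ hyZ _ (hYZ q hq) hab (hySy _ ha)
        (hSY _ ha q hq) (hySy _ hb) (hSY _ hb q hq) (fun e => hyY (e ▸ hq))
    rw [this]
    exact h2.filter _
  · rw [keepGeneral_toList]
    exact List.filter_sublist.trans ((List.sublist_cons_self _ _).trans (h1.trans h.grid))

/-- The outcome of the search for the set `Z`. -/
def Found (Z : List Point) : Prop :=
  (Z.length = 7 ∧ check7 (.ofList Z) = true) ∨
    (Z.length = 8 ∧ memLists (indices (.ofList Z)) configurations = true)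

theorem weight_grid : weight Point.w grid < 2 ^ 36 := by decide +kernel

theorem weight_lt {Z : List Point} (hg : ∀ p ∈ Z, p ∈ grid) (hn : Z.Nodup) :
    weight Point.w Z < 2 ^ 36 := by
  have h1 : (Z.Subperm grid) := List.subperm_of_subset hn hg
  obtain ⟨l, hl, hs⟩ := h1
  have h2 : weight Point.w Z = weight Point.w l := (hl.map Point.w).sum_eq.symm
  rw [h2]
  exact (weight_sublist _ hs).trans_lt weight_grid

theorem search_sound {Z : List Point} (hZ : Admissible Z) (fuel : ℕ) :
    ∀ (S : PointList) (L : List (Point × Point)) (ws ims : ℕ) (R : PointList) (Y : List Point),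
    Reaches Z S L ws ims R Y → fuel + S.toList.length = 9 →
    search fuel S (encodePairs L) ws ims R = true → Found Z := by
  induction fuel with
  | zero => intro S L ws ims R Y _ _ h; exact absurd h (by simp [search])
  | succ k ih =>
    intro S L ws ims R Y h hk hs
    have hs' : Bool.rec (motive := fun _ => Bool)
        (Bool.rec (motive := fun _ => Bool) true
          (Bool.rec (motive := fun _ => Bool) false
            (explore (search k) S (encodePairs L) ws ims R)
            (Bool.rec (motive := fun _ => Bool)
              (Bool.rec (motive := fun _ => Bool) true (check7 S) (Nat.beq k 1))
              (memLists (indices S) configurations) (Nat.beq k 0)))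
          (Nat.ble 7 (Nat.add (count R) (Nat.sub 8 k))))
        true (exceeds ims (Nat.add ws (totalWeight R))) = true := hs
    have hw : ∀ f, weight f Z = weight f Y + weight f S.toList := fun f => by
      rw [h.eq, weight_append, weight_reverse]
    cases h1 : exceeds ims (Nat.add ws (totalWeight R)) with
    | true =>
      exfalso
      rw [h.ims, totalWeight_eq, h.ws] at h1
      have h3 := weight_sublist Point.w h.sublist
      have h4 := (weight_sublist Point.w h.grid).trans_lt weight_grid
      have h5 := weight_lt hZ.sub hZ.generic.1
      rw [hw] at h5
      rw [Nat.add_eq] at h1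
      obtain ⟨g, hg, hlt⟩ := exceeds_packed (by omega) h1
      have h2 := hZ.maximal g hg
      rw [hw, hw] at h2
      omega
    | false =>
      rw [h1] at hs'
      have hlen : Z.length = Y.length + S.toList.length := by rw [h.eq]; simp
      have h7 := hZ.seven_le
      have h2 : Nat.ble 7 (Nat.add (count R) (Nat.sub 8 k)) = true := by
        rw [Nat.ble_eq, count_eq]
        have := h.sublist.length_le
        change 7 ≤ _ + (8 - k)
        omega
      rw [h2] at hs'
      dsimp only at hs'
      cases h3 : (Bool.rec (motive := fun _ => Bool)
              (Bool.rec (motive := fun _ => Bool) true (check7 S) (Nat.beq k 1))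
              (memLists (indices S) configurations) (Nat.beq k 0) : Bool) with
      | false => rw [h3] at hs'; exact absurd hs' (by simp)
      | true =>
        rw [h3] at hs'
        dsimp only at hs'
        cases Y with
        | nil =>
          have hZS : Z = S.toList := by rw [h.eq]; simp
          rw [Found, hZS, PointList.ofList_toList]
          rw [List.length_nil] at hlen
          have : k = 0 ∨ k = 1 := by omega
          rcases this with rfl | rfl
          · exact Or.inr ⟨by omega, h3⟩
          · exact Or.inl ⟨by omega, h3⟩
        | cons y Y =>
          obtain ⟨L', ws', ims', R', hr, hf⟩ := h.explore hZ hs'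
          exact ih _ L' ws' ims' R' Y hr (by simp only [PointList.toList, List.length_cons]; omega) hf

theorem searchPart_sound {Z : List Point} (hZ : Admissible Z) (hsub : Z.reverse.Sublist grid)
    {y₁ y₂ : Point} {Y : List Point} (hY : Z.reverse = y₁ :: y₂ :: Y) {lo hi lo' hi' : ℕ}
    (h1 : lo ≤ y₁.c ∧ y₁.c ≤ hi) (h2 : lo' ≤ y₂.c ∧ y₂.c ≤ hi')
    (h : searchPart lo hi lo' hi' = true) : Found Z := by
  have h0 : Reaches Z .nil [] 0 0 points (y₁ :: y₂ :: Y) :=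
    ⟨by rw [← hY]; simp [PointList.toList], by simp, rfl, by decide +kernel, hY ▸ hsub,
      List.Sublist.refl _⟩
  obtain ⟨L1, ws1, ims1, R1, hr1, hf1⟩ := h0.explore hZ h
  have e1 : headIn lo hi (.cons y₁.c y₁.x y₁.y y₁.z y₁.w y₁.im .nil) = true := by
    simp [headIn, h1]
  rw [e1] at hf1
  obtain ⟨L2, ws2, ims2, R2, hr2, hf2⟩ := hr1.explore hZ hf1
  have e2 : headIn lo' hi' (.cons y₂.c y₂.x y₂.y y₂.z y₂.w y₂.im
      (.cons y₁.c y₁.x y₁.y y₁.z y₁.w y₁.im .nil)) = true := by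
    simp [headIn, h2]
  rw [e2] at hf2
  exact search_sound hZ 7 _ L2 ws2 ims2 R2 Y hr2 rfl hf2

end CuboidTorus

namespace CuboidTorus

set_option maxRecDepth 100000

/-- For each configuration, an order in which its edges are decided. -/
def orders : List (List ℕ) := [
  [11, 6, 18, 13, 5, 15, 12, 14, 10, 26, 25, 9, 24, 16, 7, 8, 19, 27, 22, 0, 2, 23, 20, 17, 4, 3, 21, 1],
  [15, 1, 2, 5, 14, 0, 9, 10, 11, 18, 19, 26, 23, 4, 22, 20, 3, 12, 24, 13, 21, 27, 25, 16, 7, 6, 8, 17],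
  [3, 19, 22, 12, 6, 14, 4, 2, 16, 10, 20, 7, 15, 11, 21, 1, 0, 26, 13, 9, 25, 8, 23, 24, 5, 27, 17, 18],
  [5, 6, 15, 20, 3, 8, 16, 18, 4, 14, 12, 0, 21, 27, 25, 10, 19, 24, 26, 23, 7, 22, 2, 13, 11, 17, 1, 9],
  [5, 7, 15, 10, 9, 18, 1, 14, 8, 25, 23, 12, 20, 16, 6, 0, 17, 26, 27, 22, 21, 2, 24, 4, 3, 11, 19, 13],
  [0, 16, 3, 9, 19, 2, 21, 10, 8, 5, 20, 18, 6, 15, 1, 23, 17, 27, 22, 25, 13, 26, 24, 11, 12, 14, 7, 4],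
  [18, 5, 19, 10, 1, 16, 9, 15, 0, 13, 21, 14, 2, 3, 27, 24, 17, 25, 26, 20, 12, 23, 8, 11, 22, 4, 6, 7],
  [15, 18, 8, 5, 7, 6, 2, 14, 25, 16, 13, 17, 23, 27, 0, 1, 22, 11, 10, 21, 26, 12, 20, 24, 4, 3, 9, 19],
  [24, 2, 15, 14, 25, 8, 23, 0, 3, 10, 6, 17, 5, 21, 26, 12, 9, 1, 27, 19, 22, 7, 16, 18, 4, 20, 13, 11],
  [5, 22, 15, 14, 9, 24, 10, 0, 11, 18, 19, 4, 13, 23, 12, 27, 17, 20, 26, 6, 7, 3, 21, 25, 8, 2, 16, 1],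
  [0, 9, 11, 12, 20, 26, 25, 3, 8, 7, 18, 15, 13, 5, 6, 22, 2, 16, 27, 23, 17, 21, 24, 10, 14, 1, 4, 19],
  [2, 24, 19, 13, 15, 12, 25, 8, 3, 21, 18, 4, 23, 10, 6, 9, 16, 7, 1, 0, 5, 11, 20, 26, 27, 22, 14, 17],
  [17, 25, 11, 3, 7, 5, 0, 23, 16, 24, 4, 13, 18, 27, 8, 9, 22, 12, 1, 21, 26, 10, 20, 15, 14, 6, 19, 2],
  [5, 7, 20, 15, 3, 14, 8, 21, 12, 0, 24, 22, 4, 11, 19, 26, 10, 2, 23, 25, 27, 17, 1, 18, 9, 16, 13, 6],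
  [4, 21, 7, 17, 20, 25, 5, 24, 3, 14, 15, 18, 13, 23, 26, 1, 9, 8, 12, 10, 22, 2, 0, 16, 19, 6, 27, 11],
  [11, 15, 25, 5, 3, 20, 21, 8, 0, 22, 10, 17, 7, 2, 23, 27, 16, 19, 18, 9, 4, 13, 26, 14, 6, 24, 1, 12],
  [12, 24, 15, 8, 22, 20, 25, 21, 11, 19, 6, 9, 16, 18, 7, 3, 14, 13, 4, 0, 5, 1, 10, 17, 2, 27, 23, 26],
  [5, 21, 11, 12, 14, 25, 15, 8, 0, 3, 7, 27, 10, 1, 13, 20, 18, 9, 19, 17, 24, 22, 2, 6, 16, 4, 23, 26],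
  [12, 25, 15, 4, 24, 26, 0, 1, 6, 13, 9, 10, 20, 11, 14, 22, 21, 3, 27, 18, 5, 23, 17, 16, 2, 19, 7, 8],
  [3, 2, 20, 25, 24, 7, 14, 5, 18, 17, 11, 22, 15, 26, 1, 12, 13, 4, 16, 27, 23, 8, 9, 19, 21, 6, 10, 0],
  [2, 9, 20, 25, 15, 12, 6, 7, 17, 21, 13, 0, 27, 4, 10, 16, 8, 22, 24, 3, 18, 26, 11, 5, 23, 1, 14, 19],
  [6, 11, 3, 24, 5, 21, 12, 13, 20, 15, 10, 2, 26, 1, 17, 9, 18, 27, 19, 23, 16, 0, 4, 7, 22, 25, 8, 14],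
  [12, 1, 24, 0, 4, 15, 26, 6, 21, 13, 25, 2, 16, 3, 5, 11, 20, 14, 19, 27, 8, 23, 17, 18, 7, 22, 9, 10],
  [21, 5, 20, 7, 15, 24, 16, 0, 13, 14, 2, 10, 11, 26, 23, 12, 22, 27, 6, 3, 4, 25, 8, 1, 19, 18, 17, 9],
  [10, 9, 19, 24, 5, 4, 7, 15, 1, 21, 14, 18, 8, 6, 3, 27, 16, 20, 11, 25, 26, 22, 13, 23, 17, 2, 12, 0],
  [10, 5, 19, 22, 3, 21, 8, 7, 14, 6, 24, 23, 1, 25, 27, 26, 0, 13, 9, 15, 18, 4, 16, 20, 11, 17, 12, 2],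
  [11, 3, 17, 19, 21, 5, 2, 6, 16, 12, 0, 22, 9, 25, 7, 20, 24, 4, 18, 15, 10, 8, 27, 23, 1, 26, 13, 14],
  [5, 20, 6, 22, 24, 18, 27, 1, 10, 0, 19, 16, 13, 15, 21, 3, 25, 4, 23, 17, 26, 9, 8, 14, 12, 7, 11, 2],
  [20, 3, 23, 19, 9, 12, 2, 18, 7, 17, 8, 24, 15, 1, 4, 13, 6, 14, 5, 27, 16, 22, 26, 25, 21, 11, 10, 0],
  [0, 20, 9, 23, 6, 21, 25, 11, 12, 13, 22, 14, 15, 1, 3, 10, 26, 24, 27, 7, 19, 8, 17, 16, 2, 18, 4, 5],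
  [14, 5, 15, 22, 9, 24, 10, 0, 1, 25, 23, 8, 27, 26, 3, 13, 21, 6, 18, 19, 7, 4, 16, 20, 11, 17, 2, 12],
  [14, 15, 22, 5, 2, 27, 25, 1, 12, 19, 18, 7, 26, 16, 20, 24, 13, 4, 11, 21, 9, 3, 0, 6, 10, 23, 17, 8],
  [22, 20, 5, 1, 27, 6, 18, 0, 10, 24, 23, 25, 3, 16, 13, 9, 26, 4, 15, 21, 19, 8, 7, 2, 14, 12, 17, 11],
  [11, 6, 23, 9, 20, 21, 17, 24, 22, 19, 12, 7, 25, 16, 13, 14, 8, 26, 18, 4, 27, 3, 15, 10, 1, 5, 2, 0],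
  [11, 5, 27, 21, 18, 20, 25, 2, 1, 7, 12, 15, 13, 9, 14, 3, 10, 4, 26, 16, 0, 19, 8, 23, 17, 6, 24, 22],
  [21, 7, 17, 11, 18, 25, 19, 10, 1, 15, 9, 12, 20, 4, 14, 5, 24, 8, 22, 0, 16, 23, 26, 27, 2, 3, 13, 6],
  [15, 19, 14, 4, 0, 22, 25, 3, 7, 13, 8, 21, 26, 20, 12, 23, 10, 1, 11, 24, 18, 27, 17, 9, 6, 16, 2, 5],
  [10, 7, 27, 5, 0, 12, 22, 17, 4, 20, 11, 24, 13, 14, 6, 9, 15, 21, 26, 25, 19, 8, 3, 18, 16, 23, 1, 2],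
  [17, 21, 9, 10, 27, 7, 20, 0, 19, 13, 2, 22, 18, 23, 3, 12, 4, 24, 25, 26, 5, 1, 14, 16, 6, 11, 15, 8],
  [23, 20, 4, 14, 27, 3, 8, 10, 16, 2, 7, 21, 11, 9, 22, 26, 15, 6, 17, 1, 25, 12, 18, 13, 5, 19, 0, 24],
  [8, 10, 4, 25, 12, 27, 3, 16, 26, 21, 2, 11, 22, 5, 23, 15, 7, 14, 1, 0, 6, 19, 9, 18, 13, 20, 17, 24],
  [13, 27, 7, 12, 18, 6, 2, 21, 3, 23, 8, 4, 9, 5, 0, 25, 24, 22, 16, 11, 26, 20, 14, 15, 10, 17, 19, 1],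
  [17, 3, 6, 13, 4, 21, 16, 10, 2, 19, 27, 22, 7, 26, 15, 24, 25, 11, 5, 9, 18, 23, 8, 12, 14, 1, 0, 20],
  [8, 22, 24, 13, 3, 12, 27, 21, 25, 18, 2, 9, 1, 5, 4, 20, 10, 6, 14, 19, 15, 7, 0, 11, 17, 26, 23, 16],
  [9, 17, 15, 26, 11, 5, 6, 12, 13, 0, 8, 1, 21, 24, 27, 2, 7, 10, 25, 23, 22, 4, 19, 16, 18, 3, 20, 14],
  [15, 11, 9, 8, 2, 21, 25, 16, 18, 23, 26, 19, 27, 17, 0, 10, 12, 24, 5, 13, 14, 20, 3, 1, 22, 4, 6, 7],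
  [19, 5, 26, 0, 10, 25, 12, 4, 20, 9, 21, 3, 24, 18, 16, 11, 15, 27, 23, 22, 2, 8, 6, 17, 7, 14, 1, 13],
  [19, 5, 26, 16, 3, 25, 2, 22, 11, 6, 13, 4, 23, 21, 12, 8, 1, 10, 27, 17, 20, 14, 18, 9, 24, 7, 0, 15],
  [15, 5, 21, 11, 17, 26, 7, 6, 19, 9, 12, 25, 14, 0, 3, 10, 24, 18, 13, 20, 22, 2, 23, 8, 1, 27, 16, 4],
  [11, 15, 26, 9, 23, 7, 21, 19, 17, 4, 20, 25, 0, 18, 16, 24, 2, 22, 6, 1, 8, 10, 14, 27, 3, 13, 5, 12],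
  [15, 2, 26, 9, 8, 13, 21, 4, 16, 20, 3, 25, 12, 17, 19, 0, 7, 6, 10, 11, 14, 22, 27, 23, 24, 5, 18, 1],
  [8, 22, 15, 20, 11, 9, 25, 6, 19, 24, 18, 12, 23, 21, 5, 3, 1, 13, 26, 4, 0, 10, 16, 17, 2, 27, 14, 7],
  [11, 15, 25, 18, 2, 10, 17, 8, 7, 3, 21, 0, 19, 14, 6, 22, 24, 4, 16, 27, 26, 20, 12, 23, 5, 13, 1, 9],
  [22, 12, 18, 15, 5, 25, 14, 11, 0, 10, 19, 16, 4, 13, 9, 24, 23, 8, 6, 3, 21, 1, 7, 17, 2, 26, 27, 20],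
  [2, 22, 6, 13, 15, 26, 1, 3, 5, 27, 12, 8, 17, 20, 14, 25, 19, 9, 18, 24, 23, 7, 11, 16, 0, 4, 10, 21],
  [10, 8, 18, 9, 14, 26, 2, 27, 16, 4, 21, 0, 20, 24, 25, 6, 22, 7, 17, 23, 5, 12, 13, 11, 1, 15, 19, 3],
  [15, 11, 9, 26, 6, 5, 27, 17, 2, 14, 3, 19, 25, 23, 10, 7, 21, 24, 22, 4, 0, 16, 18, 12, 1, 8, 20, 13],
  [14, 16, 21, 5, 12, 23, 26, 4, 7, 0, 27, 8, 25, 22, 17, 18, 19, 9, 15, 24, 3, 1, 6, 2, 20, 13, 11, 10],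
  [14, 21, 5, 16, 12, 17, 3, 20, 6, 0, 15, 18, 7, 19, 23, 2, 22, 8, 25, 13, 1, 11, 10, 26, 27, 24, 9, 4],
  [13, 20, 6, 16, 12, 21, 9, 18, 1, 0, 8, 15, 3, 10, 27, 24, 11, 23, 5, 7, 14, 25, 22, 2, 26, 4, 19, 17],
  [16, 14, 21, 5, 20, 3, 27, 12, 0, 6, 10, 13, 17, 8, 19, 18, 15, 1, 25, 9, 2, 11, 24, 23, 26, 22, 4, 7],
  [12, 27, 9, 6, 21, 13, 16, 0, 20, 1, 10, 18, 5, 3, 17, 15, 23, 8, 4, 25, 24, 11, 26, 14, 22, 7, 19, 2],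
  [10, 8, 27, 18, 23, 11, 2, 21, 3, 13, 4, 0, 26, 25, 22, 12, 24, 5, 7, 16, 15, 1, 19, 6, 20, 17, 14, 9],
  [25, 4, 12, 24, 21, 20, 2, 18, 8, 1, 26, 19, 16, 5, 22, 17, 15, 23, 0, 6, 7, 9, 14, 11, 10, 3, 27, 13],
  [22, 20, 8, 1, 25, 13, 0, 11, 17, 5, 14, 21, 27, 26, 10, 24, 7, 2, 16, 19, 23, 12, 3, 4, 18, 15, 6, 9]]

theorem orders_perm : ∀ o ∈ orders, (reorder stars8 o).toList.Perm (starsOf 8) := by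
  rw [← stars8_toList]
  decide +kernel

/-- The check of the configurations in positions `4 * k, …, 4 * k + 3`. -/
noncomputable def checkBlock (k : ℕ) : Bool :=
  (((configurations.zip orders).drop (4 * k)).take 4).all fun c => check8 (ofIndices c.1) c.2

theorem checkBlock0 : checkBlock 0 = true := by decide +kernel

theorem checkBlock1 : checkBlock 1 = true := by decide +kernel

theorem checkBlock2 : checkBlock 2 = true := by decide +kernel

theorem checkBlock3 : checkBlock 3 = true := by decide +kernel

theorem checkBlock4 : checkBlock 4 = true := by decide +kernel

theorem checkBlock5 : checkBlock 5 = true := by decide +kernel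

theorem checkBlock6 : checkBlock 6 = true := by decide +kernel

theorem checkBlock7 : checkBlock 7 = true := by decide +kernel

theorem checkBlock8 : checkBlock 8 = true := by decide +kernel

theorem checkBlock9 : checkBlock 9 = true := by decide +kernel

theorem checkBlock10 : checkBlock 10 = true := by decide +kernel

theorem checkBlock11 : checkBlock 11 = true := by decide +kernel

theorem checkBlock12 : checkBlock 12 = true := by decide +kernel

theorem checkBlock13 : checkBlock 13 = true := by decide +kernel

theorem checkBlock14 : checkBlock 14 = true := by decide +kernel

theorem checkBlock15 : checkBlock 15 = true := by decide +kernel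

theorem checkBlock16 : checkBlock 16 = true := by decide +kernel

theorem checkBlock_of_lt {k : ℕ} (hk : k < 17) : checkBlock k = true := by
  interval_cases k
  · exact checkBlock0
  · exact checkBlock1
  · exact checkBlock2
  · exact checkBlock3
  · exact checkBlock4
  · exact checkBlock5
  · exact checkBlock6
  · exact checkBlock7
  · exact checkBlock8
  · exact checkBlock9
  · exact checkBlock10
  · exact checkBlock11
  · exact checkBlock12
  · exact checkBlock13
  · exact checkBlock14
  · exact checkBlock15
  · exact checkBlock16

theorem check8_configuration {l : List ℕ} (hl : l ∈ configurations) :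
    ∃ o ∈ orders, check8 (ofIndices l) o = true := by
  obtain ⟨i, hi, rfl⟩ := List.getElem_of_mem hl
  have hlen : configurations.length = 65 := rfl
  have hlen' : orders.length = 65 := rfl
  refine ⟨orders[i], List.getElem_mem _, ?_⟩
  have h := checkBlock_of_lt (k := i / 4) (by omega)
  rw [checkBlock, List.all_eq_true] at h
  refine h (configurations[i], orders[i]) ?_
  refine List.mem_iff_getElem.2 ⟨i % 4, ?_, ?_⟩
  · simp only [List.length_take, List.length_drop, List.length_zip]; omega
  · simp only [List.getElem_take, List.getElem_drop, List.getElem_zip, Nat.div_add_mod]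
    rfl


theorem searchPart0 : searchPart 35 35 31 35 = true := by decide +kernel

theorem searchPart1 : searchPart 35 35 0 30 = true := by decide +kernel

theorem searchPart2 : searchPart 34 34 0 35 = true := by decide +kernel

theorem searchPart3 : searchPart 33 33 32 35 = true := by decide +kernel

theorem searchPart4 : searchPart 33 33 31 31 = true := by decide +kernel

theorem searchPart5 : searchPart 33 33 28 30 = true := by decide +kernel

theorem searchPart6 : searchPart 33 33 25 27 = true := by decide +kernel

theorem searchPart7 : searchPart 33 33 22 24 = true := by decide +kernel

theorem searchPart8 : searchPart 33 33 18 21 = true := by decide +kernel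

theorem searchPart9 : searchPart 33 33 0 17 = true := by decide +kernel

theorem searchPart10 : searchPart 0 32 0 35 = true := by decide +kernel

theorem exists_searchPart {c₁ c₂ : ℕ} (h₁ : c₁ < 36) (h₂ : c₂ < 36) :
    ∃ lo hi lo' hi', (lo ≤ c₁ ∧ c₁ ≤ hi) ∧ (lo' ≤ c₂ ∧ c₂ ≤ hi') ∧
      searchPart lo hi lo' hi' = true := by
  by_cases h35 : c₁ = 35
  · by_cases h : 31 ≤ c₂
    · exact ⟨_, _, _, _, by omega, by omega, searchPart0⟩
    · exact ⟨_, _, _, _, by omega, by omega, searchPart1⟩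
  by_cases h34 : c₁ = 34
  · exact ⟨_, _, _, _, by omega, by omega, searchPart2⟩
  by_cases h33 : c₁ = 33
  · rcases (by omega : (32 ≤ c₂ ∧ c₂ ≤ 35) ∨ (31 ≤ c₂ ∧ c₂ ≤ 31) ∨ (28 ≤ c₂ ∧ c₂ ≤ 30) ∨
      (25 ≤ c₂ ∧ c₂ ≤ 27) ∨ (22 ≤ c₂ ∧ c₂ ≤ 24) ∨ (18 ≤ c₂ ∧ c₂ ≤ 21) ∨ (0 ≤ c₂ ∧ c₂ ≤ 17))
      with h | h | h | h | h | h | h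
    · exact ⟨_, _, _, _, by omega, h, searchPart3⟩
    · exact ⟨_, _, _, _, by omega, h, searchPart4⟩
    · exact ⟨_, _, _, _, by omega, h, searchPart5⟩
    · exact ⟨_, _, _, _, by omega, h, searchPart6⟩
    · exact ⟨_, _, _, _, by omega, h, searchPart7⟩
    · exact ⟨_, _, _, _, by omega, h, searchPart8⟩
    · exact ⟨_, _, _, _, by omega, h, searchPart9⟩
  · exact ⟨_, _, _, _, (by omega : 0 ≤ c₁ ∧ c₁ ≤ 32), by omega, searchPart10⟩

theorem found {Z : List Point} (hZ : Admissible Z) (hsub : Z.reverse.Sublist grid) : Found Z := by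
  have h7 := hZ.seven_le
  rw [← List.length_reverse] at h7
  obtain ⟨y₁, y₂, Y, hY⟩ : ∃ y₁ y₂ Y, Z.reverse = y₁ :: y₂ :: Y := by
    match h : Z.reverse with
    | [] => rw [h] at h7; simp at h7
    | [_] => rw [h] at h7; simp at h7
    | y₁ :: y₂ :: Y => exact ⟨y₁, y₂, Y, rfl⟩
  have hc : ∀ p ∈ Z.reverse, p.c < 36 := fun p hp => (grid_spec p (hsub.subset hp)).2.1
  obtain ⟨lo, hi, lo', hi', h1, h2, h⟩ := exists_searchPart (hc y₁ (by simp [hY]))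
    (hc y₂ (by simp [hY]))
  exact searchPart_sound hZ hsub hY h1 h2 h

theorem grid_nodup : (grid.map Point.c).Nodup := by decide +kernel

theorem pointOf_grid {p : Point} (hp : p ∈ grid) (S : PointList) :
    pointOf p.c (fun c x y z w im => .cons c x y z w im S) =
      .cons p.c p.x p.y p.z p.w p.im S := by
  have h : ∀ R : PointList, (R.toList.map Point.c).Nodup → p ∈ R.toList →
      (PointList.rec .nil (fun c' x y z w im _ ih => Bool.rec ih (.cons c' x y z w im S)
        (Nat.beq p.c c')) R : PointList) = .cons p.c p.x p.y p.z p.w p.im S := by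
    intro R
    induction R with
    | nil => intro _ h; simp [PointList.toList] at h
    | cons c x y z w im tl ih =>
      intro hn hp
      rw [PointList.toList, List.map_cons, List.nodup_cons] at hn
      rw [PointList.toList, List.mem_cons] at hp
      dsimp only
      rcases hp with rfl | hp
      · rw [Nat.beq_refl]
      · have : Nat.beq p.c c = false := by
          rw [← Bool.not_eq_true, Nat.beq_eq]
          intro h
          have := List.mem_map_of_mem (f := Point.c) hp
          rw [h] at this
          exact hn.1 this
        rw [this]
        exact ih hn.2 hp
  exact h points grid_nodup hp

theorem ofIndices_indices {Z : List Point} (hZ : ∀ p ∈ Z, p ∈ grid) :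
    ofIndices (indices (.ofList Z)) = .ofList Z := by
  induction Z with
  | nil => rfl
  | cons p Z ih =>
    change pointOf p.c (fun c x y z w im => .cons c x y z w im
      (ofIndices (indices (.ofList Z)))) = _
    rw [ih fun q hq => hZ q (by simp [hq]), pointOf_grid (hZ p (by simp))]
    rfl

theorem mem_of_memLists {a : List ℕ} {L : List (List ℕ)} (h : memLists a L = true) : a ∈ L := by
  have eq : ∀ a b : List ℕ, indexListEq a b = true → a = b := by
    intro a
    induction a with
    | nil => intro b hb; cases b with
      | nil => rfl
      | cons y b => exact absurd hb (by simp [indexListEq])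
    | cons x a ih => intro b hb; cases b with
      | nil => exact absurd hb (by simp [indexListEq])
      | cons y b =>
        change Bool.rec (motive := fun _ => Bool) false (indexListEq a b) (Nat.beq x y) = true at hb
        cases h : Nat.beq x y with
        | false => rw [h] at hb; exact absurd hb (by simp)
        | true => rw [h] at hb; rw [beq_true h, ih b hb]
  induction L with
  | nil => exact absurd h (by simp [memLists])
  | cons b L ih =>
    change Bool.rec (motive := fun _ => Bool) (memLists a L) true (indexListEq a b) = true at h
    cases hb : indexListEq a b with
    | false => rw [hb] at h; exact List.mem_cons_of_mem _ (ih h)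
    | true => rw [eq a b hb]; simp

/-- The classification of candidates whose points have maximal weight in their orbit. -/
theorem classification {Z : List Point} (hZ : Admissible Z) (hsub : Z.reverse.Sublist grid)
    {pt : ℕ → Point} (hpt : Z = (List.range Z.length).map pt) {F : ℕ → ℕ → ℕ → Prop}
    (hc : Candidate Z.length pt F) :
    Z.length = 8 ∧ ∃ (b : Bool) (f : Fin 8 → Fin 8), Function.Injective f ∧
      ∀ i j k : Fin 8, i < j → j < k →
        (F i j k ↔ ({f i, f j, f k} : Finset (Fin 8)) ∈ facets b) := by
  rcases found hZ hsub with ⟨hlen, h⟩ | ⟨hlen, h⟩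
  · rw [hlen] at hpt hc
    exact absurd h (not_check7 (by rw [PointList.toList_ofList, ← hpt]) hc)
  · rw [hlen] at hpt hc
    obtain ⟨o, ho, h8⟩ := check8_configuration (mem_of_memLists h)
    rw [ofIndices_indices hZ.sub] at h8
    obtain ⟨C, hC, hleaf⟩ := leaf_of_check8 (by rw [PointList.toList_ofList, ← hpt]) hc
      (orders_perm o ho) h8
    exact ⟨hlen, exists_facets_of_leafCheck hc hC hleaf⟩

end CuboidTorus

namespace AbstractSimplicialComplex

variable {V : Type*} [DecidableEq V] {K : AbstractSimplicialComplex V}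

theorem mem_of_subset {s t : Finset V} (hs : s ∈ K) (hts : t ⊆ s) (ht : t.Nonempty) : t ∈ K :=
  (K.isRelLowerSet_faces hs).2 hts ht

theorem nonempty_of_mem {s : Finset V} (hs : s ∈ K) : s.Nonempty := (K.isRelLowerSet_faces hs).1

/-- The vertices `x`, `y`, `z` span a triangle. -/
def Triangle (K : AbstractSimplicialComplex V) (x y z : V) : Prop :=
  x ≠ y ∧ y ≠ z ∧ z ≠ x ∧ ({x, y, z} : Finset V) ∈ K

theorem Triangle.rotate {x y z : V} (h : K.Triangle x y z) : K.Triangle y z x :=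
  ⟨h.2.1, h.2.2.1, h.1, by
    have : ({y, z, x} : Finset V) = {x, y, z} := by ext; simp; tauto
    rw [this]; exact h.2.2.2⟩

theorem Triangle.swap {x y z : V} (h : K.Triangle x y z) : K.Triangle y x z :=
  ⟨h.1.symm, h.2.2.1.symm, h.2.1.symm, by rw [Finset.insert_comm]; exact h.2.2.2⟩

theorem Triangle.swap_right {x y z : V} (h : K.Triangle x y z) : K.Triangle x z y :=
  h.swap.rotate

theorem Triangle.pair_mem {x y z : V} (h : K.Triangle x y z) : ({x, y} : Finset V) ∈ K :=
  mem_of_subset h.2.2.2 (by intro; simp; tauto) (by simp)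

theorem linkGraph_adj_iff {v : V} (a b : {w : V // w ≠ v ∧ ({v, w} : Finset V) ∈ K}) :
    (K.linkGraph v).Adj a b ↔ K.Triangle v a b := by
  change (a ≠ b ∧ ({v, a.1, b.1} : Finset V) ∈ K) ↔ _
  rw [Triangle, Ne, Subtype.ext_iff]
  exact ⟨fun h => ⟨a.2.1.symm, h.1, b.2.1, h.2⟩, fun h => ⟨h.2.1, h.2.2.2⟩⟩

theorem IsTriangulatedSurface.two (hK : K.IsTriangulatedSurface) {x y : V} (hxy : x ≠ y)
    (h : ({x, y} : Finset V) ∈ K) :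
    ∃ a b, a ≠ b ∧ ∀ z, K.Triangle x y z ↔ z = a ∨ z = b := by
  obtain ⟨m, hm, ⟨e⟩⟩ := hK.2 x
  obtain ⟨n, rfl⟩ : ∃ n, m = n + 3 := ⟨m - 3, by omega⟩
  let y' : {w : V // w ≠ x ∧ ({x, w} : Finset V) ∈ K} := ⟨y, hxy.symm, h⟩
  have hN := SimpleGraph.cycleGraph_neighborSet (v := e y')
  have hd := SimpleGraph.cycleGraph_degree_three_le (v := e y')
  rw [← SimpleGraph.card_neighborSet_eq_degree, ← Nat.card_eq_fintype_card, hN,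
    Nat.card_coe_set_eq, Set.ncard_eq_two] at hd
  obtain ⟨a, b, hab, hs⟩ := hd
  refine ⟨e.symm a, e.symm b, fun h => hab (e.symm.injective (Subtype.ext h)), fun z => ?_⟩
  have key : ∀ c, c ∈ ({a, b} : Set (Fin (n + 3))) ↔ K.Triangle x y (e.symm c) := by
    intro c
    rw [← hs, ← hN, SimpleGraph.mem_neighborSet]
    have : (SimpleGraph.cycleGraph (n + 3)).Adj (e y') c ↔ (K.linkGraph x).Adj y' (e.symm c) := by
      conv_rhs => rw [← e.map_adj_iff]
      simp
    rw [this, linkGraph_adj_iff]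
  constructor
  · intro hz
    have hz' : z ≠ x ∧ ({x, z} : Finset V) ∈ K := ⟨hz.2.2.1, hz.swap_right.pair_mem⟩
    have := (key (e ⟨z, hz'⟩)).2 (by simpa using hz)
    rcases this with h | h
    · left; rw [← h]; simp
    · right; rw [← Set.mem_singleton_iff.1 h]; simp
  · rintro (rfl | rfl)
    · exact (key a).1 (by simp)
    · exact (key b).1 (by simp)

theorem IsTriangulatedSurface.exists_triangle (hK : K.IsTriangulatedSurface) {x y : V} (hxy : x ≠ y)
    (h : ({x, y} : Finset V) ∈ K) : ∃ z, K.Triangle x y z := by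
  obtain ⟨a, b, _, h⟩ := hK.two hxy h
  exact ⟨a, (h a).2 (Or.inl rfl)⟩

theorem IsTriangulatedSurface.exists_edge (hK : K.IsTriangulatedSurface) (x : V) :
    ∃ y, x ≠ y ∧ ({x, y} : Finset V) ∈ K := by
  obtain ⟨m, hm, ⟨e⟩⟩ := hK.2 x
  have y := e.symm ⟨0, by omega⟩
  exact ⟨y, y.2.1.symm, y.2.2⟩

theorem IsTriangulatedSurface.link (hK : K.IsTriangulatedSurface) (v : V) (W : Set V)
    (hW : ∀ a b, K.Triangle v a b → a ∈ W → b ∈ W) {a : V} (ha : a ∈ W) (hva : v ≠ a)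
    (hva' : ({v, a} : Finset V) ∈ K) {b : V} (hvb : v ≠ b) (hvb' : ({v, b} : Finset V) ∈ K) :
    b ∈ W := by
  obtain ⟨m, hm, ⟨e⟩⟩ := hK.2 v
  have hc : (K.linkGraph v).Preconnected :=
    (e.preconnected_iff).2 SimpleGraph.cycleGraph_preconnected
  obtain ⟨p⟩ := hc ⟨a, hva.symm, hva'⟩ ⟨b, hvb.symm, hvb'⟩
  have : ∀ c d : {w : V // w ≠ v ∧ ({v, w} : Finset V) ∈ K}, (K.linkGraph v).Walk c d →
      c.1 ∈ W → d.1 ∈ W := by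
    intro c d p
    induction p with
    | nil => exact id
    | cons h _ ih => exact fun hc => ih (hW _ _ ((linkGraph_adj_iff _ _).1 h) hc)
  exact this _ _ p ha

end AbstractSimplicialComplex

namespace CuboidTorus

theorem coplanar_of_det_eq_zero {p : Fin 4 → Fin 3 → ℝ} {q : Fin 4 → Point}
    (hp : ∀ i, p i = ![((q i).x : ℝ), ((q i).y : ℝ), ((q i).z : ℝ)])
    (h : det (q 0) (q 1) (q 2) (q 3) = 0) : Coplanar ℝ {p 0, p 1, p 2, p 3} := by
  let M : Matrix (Fin 3) (Fin 3) ℝ := Matrix.of ![p 1 - p 0, p 2 - p 0, p 3 - p 0]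
  have hM : M.det = 0 := by
    have h' : ((det (q 0) (q 1) (q 2) (q 3) : ℤ) : ℝ) = 0 := by rw [h]; simp
    rw [Matrix.det_fin_three]
    simp only [M, hp, Matrix.of_apply]
    simp only [det] at h'
    push_cast at h'
    simp
    linear_combination h'
  obtain ⟨v, hv, hMv⟩ := Matrix.exists_mulVec_eq_zero_iff.2 hM
  let f : Module.Dual ℝ (Fin 3 → ℝ) := ∑ i, v i • LinearMap.proj i
  have hf : ∀ x, f x = v 0 * x 0 + v 1 * x 1 + v 2 * x 2 := fun x => by
    simp [f, Fin.sum_univ_three]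
  have hf0 : f ≠ 0 := by
    intro h0
    apply hv
    funext i
    have := hf (Pi.single i 1)
    rw [h0] at this
    fin_cases i <;> simpa using this.symm
  have hfp : ∀ i, f (p i) = f (p 0) := by
    intro i
    have e : ∀ j : Fin 3, f (p j.succ - p 0) = 0 := by
      intro j
      have := congrFun hMv j
      rw [hf]
      fin_cases j <;> simpa [M, Matrix.mulVec, dotProduct, Fin.sum_univ_three, mul_comm] using this
    refine Fin.cases rfl (fun j => ?_) i
    exact sub_eq_zero.1 (by rw [← map_sub]; exact e j)
  rw [coplanar_iff_finrank_le_two]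
  have h2 := Module.Dual.finrank_ker_add_one_of_ne_zero hf0
  rw [Module.finrank_fin_fun] at h2
  refine (Submodule.finrank_mono (t := LinearMap.ker f) ?_).trans (by omega)
  rw [vectorSpan_def, Submodule.span_le]
  rintro _ ⟨a, ha, b, hb, rfl⟩
  have hall : ∀ a ∈ ({p 0, p 1, p 2, p 3} : Set (Fin 3 → ℝ)), f a = f (p 0) := by
    rintro a (rfl | rfl | rfl | rfl) <;> exact hfp _
  simp [hall a ha, hall b hb]

theorem act_coords {g : ℕ} (hg : g < 16) : ∃ s t u : ℤ, ∃ a b c : ℤ,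
    (s = 1 ∨ s = -1) ∧ (t = 1 ∨ t = -1) ∧ (u = 1 ∨ u = -1) ∧
    ((∀ p ∈ grid, ((sym g p).x : ℤ) = s * p.x + a ∧ ((sym g p).y : ℤ) = t * p.y + b ∧
        ((sym g p).z : ℤ) = u * p.z + c) ∨
      (∀ p ∈ grid, ((sym g p).x : ℤ) = s * p.y + a ∧ ((sym g p).y : ℤ) = t * p.x + b ∧
        ((sym g p).z : ℤ) = u * p.z + c)) := by
  have flip : ∀ (b : Bool) (m : ℕ), ∃ s a : ℤ, (s = 1 ∨ s = -1) ∧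
      ∀ x : ℕ, x ≤ m → (((if b then m - x else x) : ℕ) : ℤ) = s * x + a := by
    intro b m
    cases b
    · exact ⟨1, 0, by simp, by simp⟩
    · exact ⟨-1, m, by simp, fun x hx => by simp; omega⟩
  obtain ⟨s, a, hs, h1⟩ := flip (g.testBit 0) 2
  obtain ⟨t, b, ht, h2⟩ := flip (g.testBit 1) 2
  obtain ⟨u, c, hu, h3⟩ := flip (g.testBit 2) 3
  have key : ∀ p ∈ grid, ((sym g p).x, (sym g p).y, (sym g p).z) = act g (p.x, p.y, p.z) :=
    fun p hp => ((grid_spec p hp).2.2.2.2 g hg).2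
  cases hsw : g.testBit 3 with
  | false =>
    refine ⟨s, t, u, a, b, c, hs, ht, hu, Or.inl fun p hp => ?_⟩
    have := key p hp
    simp only [act, hsw] at this
    obtain ⟨e1, e2, e3⟩ := (grid_spec p hp).1
    simp only [Bool.false_eq_true, if_false, Prod.mk.injEq] at this
    rw [this.1, this.2.1, this.2.2]
    exact ⟨h1 _ e1, h2 _ e2, h3 _ e3⟩
  | true =>
    refine ⟨t, s, u, b, a, c, ht, hs, hu, Or.inr fun p hp => ?_⟩
    have := key p hp
    simp only [act, hsw] at this
    obtain ⟨e1, e2, e3⟩ := (grid_spec p hp).1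
    simp only [if_true, Prod.mk.injEq] at this
    rw [this.1, this.2.1, this.2.2]
    exact ⟨h2 _ e2, h1 _ e1, h3 _ e3⟩

theorem ne_zero_of_sign {s : ℤ} (h : s = 1 ∨ s = -1) : s ≠ 0 := by omega

theorem grid_ext : ∀ p ∈ grid, ∀ q ∈ grid, p.x = q.x → p.y = q.y → p.z = q.z → p = q := by
  decide +kernel

theorem sym_injOn {g : ℕ} (hg : g < 16) {p q : Point} (hp : p ∈ grid) (hq : q ∈ grid)
    (h : sym g p = sym g q) : p = q := by
  have cancel : ∀ {s a : ℤ} {m n : ℕ}, (s = 1 ∨ s = -1) → s * m + a = s * n + a → m = n := by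
    rintro s a m n (rfl | rfl) h <;> omega
  obtain ⟨s, t, u, i, j, k, hs, ht, hu, h1 | h1⟩ := act_coords hg
  all_goals
    obtain ⟨a1, a2, a3⟩ := h1 p hp
    obtain ⟨b1, b2, b3⟩ := h1 q hq
    rw [h] at a1 a2 a3
    have c1 := cancel hs (a1.symm.trans b1)
    have c2 := cancel ht (a2.symm.trans b2)
    have c3 := cancel hu (a3.symm.trans b3)
  · exact grid_ext p hp q hq c1 c2 c3
  · exact grid_ext p hp q hq c2 c1 c3

theorem sym_det {g : ℕ} (hg : g < 16) {a b c d : Point} (ha : a ∈ grid) (hb : b ∈ grid)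
    (hc : c ∈ grid) (hd : d ∈ grid) (h : det a b c d ≠ 0) :
    det (sym g a) (sym g b) (sym g c) (sym g d) ≠ 0 := by
  obtain ⟨s, t, u, i, j, k, hs, ht, hu, h1 | h1⟩ := act_coords hg
  all_goals
    obtain ⟨a1, a2, a3⟩ := h1 a ha
    obtain ⟨b1, b2, b3⟩ := h1 b hb
    obtain ⟨c1, c2, c3⟩ := h1 c hc
    obtain ⟨d1, d2, d3⟩ := h1 d hd
  · have : det (sym g a) (sym g b) (sym g c) (sym g d) = s * t * u * det a b c d := by
      simp only [det, a1, a2, a3, b1, b2, b3, c1, c2, c3, d1, d2, d3]; ring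
    rw [this]
    exact mul_ne_zero (mul_ne_zero (mul_ne_zero (ne_zero_of_sign hs) (ne_zero_of_sign ht))
      (ne_zero_of_sign hu)) h
  · have : det (sym g a) (sym g b) (sym g c) (sym g d) = -(s * t * u) * det a b c d := by
      simp only [det, a1, a2, a3, b1, b2, b3, c1, c2, c3, d1, d2, d3]; ring
    rw [this]
    exact mul_ne_zero (neg_ne_zero.2 (mul_ne_zero (mul_ne_zero (ne_zero_of_sign hs)
      (ne_zero_of_sign ht)) (ne_zero_of_sign hu))) h

theorem Meets.of_sym {g : ℕ} (hg : g < 16) {a b c d e : Point} (ha : a ∈ grid) (hb : b ∈ grid)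
    (hc : c ∈ grid) (hd : d ∈ grid) (he : e ∈ grid)
    (h : Meets (sym g a) (sym g b) (sym g c) (sym g d) (sym g e)) : Meets a b c d e := by
  obtain ⟨α, β, γ, δ, ε, hpos, hsum, hx, hy, hz⟩ := h
  have cancel : ∀ {s i : ℤ} (_ : s = 1 ∨ s = -1) {x1 x2 x3 x4 x5 : ℤ},
      α * (s * x1 + i) + β * (s * x2 + i) = γ * (s * x3 + i) + δ * (s * x4 + i) + ε * (s * x5 + i) →
      α * x1 + β * x2 = γ * x3 + δ * x4 + ε * x5 := by
    intro s i hs x1 x2 x3 x4 x5 h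
    refine mul_left_cancel₀ (ne_zero_of_sign hs) ?_
    linear_combination h - i * hsum
  obtain ⟨s, t, u, i, j, k, hs, ht, hu, h1 | h1⟩ := act_coords hg
  all_goals
    obtain ⟨a1, a2, a3⟩ := h1 a ha
    obtain ⟨b1, b2, b3⟩ := h1 b hb
    obtain ⟨c1, c2, c3⟩ := h1 c hc
    obtain ⟨d1, d2, d3⟩ := h1 d hd
    obtain ⟨e1, e2, e3⟩ := h1 e he
    rw [a1, b1, c1, d1, e1] at hx
    rw [a2, b2, c2, d2, e2] at hy
    rw [a3, b3, c3, d3, e3] at hz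
  · exact ⟨α, β, γ, δ, ε, hpos, hsum, cancel hs hx, cancel ht hy, cancel hu hz⟩
  · exact ⟨α, β, γ, δ, ε, hpos, hsum, cancel ht hy, cancel hs hx, cancel hu hz⟩

open AbstractSimplicialComplex

variable {V : Type*} [DecidableEq V]

/-- A realization of a complex by points of the cuboid in general position in which no edge pierces
a disjoint triangle. -/
structure Realizes (K : AbstractSimplicialComplex V) (r : V → Point) : Prop where
  mem : ∀ v, r v ∈ grid
  inj : Function.Injective r
  det : ∀ a b c d, a ≠ b → a ≠ c → a ≠ d → b ≠ c → b ≠ d → c ≠ d →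
    det (r a) (r b) (r c) (r d) ≠ 0
  disjoint : ∀ x y a b c, x ≠ y → ({x, y} : Finset V) ∈ K → ({a, b, c} : Finset V) ∈ K →
    x ≠ a → x ≠ b → x ≠ c → y ≠ a → y ≠ b → y ≠ c → ¬ Meets (r x) (r y) (r a) (r b) (r c)

theorem Realizes.sym {K : AbstractSimplicialComplex V} {r : V → Point} (h : Realizes K r) {g : ℕ}
    (hg : g < 16) : Realizes K fun v => sym g (r v) := by
  refine ⟨fun v => ((grid_spec _ (h.mem v)).2.2.2.2 g hg).1, ?_, ?_, ?_⟩
  · intro v w hvw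
    exact h.inj (sym_injOn hg (h.mem v) (h.mem w) hvw)
  · intro a b c d h1 h2 h3 h4 h5 h6
    exact sym_det hg (h.mem a) (h.mem b) (h.mem c) (h.mem d) (h.det a b c d h1 h2 h3 h4 h5 h6)
  · intro x y a b c h0 h1 h2 h3 h4 h5 h6 h7 h8 hm
    exact h.disjoint x y a b c h0 h1 h2 h3 h4 h5 h6 h7 h8
      (hm.of_sym hg (h.mem x) (h.mem y) (h.mem a) (h.mem b) (h.mem c))

theorem mem_convexHull_of_combination {ι : Type*} (s : Finset ι) (w : ι → ℝ) (p : ι → Fin 3 → ℝ)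
    (hw : ∀ i ∈ s, 0 ≤ w i) (h0 : 0 < ∑ i ∈ s, w i) {t : Set (Fin 3 → ℝ)} (ht : ∀ i ∈ s, p i ∈ t) :
    (∑ i ∈ s, w i)⁻¹ • ∑ i ∈ s, w i • p i ∈ convexHull ℝ t :=
  s.centerMass_mem_convexHull hw h0 ht

theorem exists_realizes {K : AbstractSimplicialComplex V}
    (h : K.HasGeneralPositionRealizationIn ![2, 2, 3]) : ∃ r, Realizes K r := by
  obtain ⟨q, hq, ⟨hinj, _, hdis⟩, _, hgen⟩ := h
  have hgrid : ∀ x < 3, ∀ y < 3, ∀ z < 4, ∃ p ∈ grid, p.x = x ∧ p.y = y ∧ p.z = z := by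
    decide +kernel
  have hr : ∀ v, ∃ p ∈ grid, ∀ i, (q v i : ℝ) = ![(p.x : ℝ), (p.y : ℝ), (p.z : ℝ)] i := by
    intro v
    have h0 := hq v 0
    have h1 := hq v 1
    have h2 := hq v 2
    simp only [Matrix.cons_val_zero, Matrix.cons_val_one, Matrix.cons_val] at h0 h1 h2
    obtain ⟨p, hp, e1, e2, e3⟩ := hgrid (q v 0).toNat (by omega) (q v 1).toNat (by omega)
      (q v 2).toNat (by omega)
    have c0 : q v 0 = (p.x : ℤ) := by omega
    have c1 : q v 1 = (p.y : ℤ) := by omega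
    have c2 : q v 2 = (p.z : ℤ) := by omega
    exact ⟨p, hp, fun i => by fin_cases i <;> simp [c0, c1, c2]⟩
  choose r hmem hr using hr
  have hr' : ∀ v, (fun i => (q v i : ℝ)) = ![((r v).x : ℝ), ((r v).y : ℝ), ((r v).z : ℝ)] :=
    fun v => funext (hr v)
  refine ⟨r, hmem, ?_, ?_, ?_⟩
  · intro v w hvw
    exact hinj (by simp only [hr', hvw])
  · intro a b c d h1 h2 h3 h4 h5 h6 h0
    refine hgen a b c d h1 h2 h3 h4 h5 h6 ?_
    exact coplanar_of_det_eq_zero (p := ![_, _, _, _]) (q := ![r a, r b, r c, r d])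
      (fun i => by fin_cases i <;> exact hr' _) h0
  · rintro x y a b c hxy hxy' habc h1 h2 h3 h4 h5 h6 ⟨α, β, γ, δ, ε, hpos, hsum, hx, hy, hz⟩
    have hd := hdis {x, y} hxy' {a, b, c} habc
    have hemp : ((({x, y} : Finset V) : Set V) ∩ (({a, b, c} : Finset V) : Set V)) = ∅ := by
      ext v
      simp only [Finset.coe_insert, Finset.coe_singleton, Set.mem_inter_iff, Set.mem_insert_iff,
        Set.mem_singleton_iff, Set.mem_empty_iff_false, iff_false, not_and]
      rintro (rfl | rfl) <;> simp [*]
    rw [hemp, Set.image_empty, convexHull_empty] at hd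
    simp only [hr'] at hd
    set P : V → Fin 3 → ℝ := fun v => ![((r v).x : ℝ), ((r v).y : ℝ), ((r v).z : ℝ)] with hP
    have hsum' : ((α + β : ℤ) : ℝ) = ((γ + δ + ε : ℤ) : ℝ) := by rw [hsum]
    have hx' := congrArg (Int.cast : ℤ → ℝ) hx
    have hy' := congrArg (Int.cast : ℤ → ℝ) hy
    have hz' := congrArg (Int.cast : ℤ → ℝ) hz
    push_cast at hsum' hx' hy' hz'
    have p1 : (0 : ℝ) < α := by exact_mod_cast hpos.1
    have p2 : (0 : ℝ) < β := by exact_mod_cast hpos.2.1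
    have p3 : (0 : ℝ) < γ := by exact_mod_cast hpos.2.2.1
    have p4 : (0 : ℝ) < δ := by exact_mod_cast hpos.2.2.2.1
    have p5 : (0 : ℝ) < ε := by exact_mod_cast hpos.2.2.2.2
    have m1 := mem_convexHull_of_combination Finset.univ ![(α : ℝ), β] ![P x, P y]
      (fun i _ => by fin_cases i <;> simp [p1.le, p2.le])
      (by simpa [Fin.sum_univ_two] using add_pos p1 p2)
      (t := P '' (({x, y} : Finset V) : Set V)) (fun i _ => by fin_cases i <;> simp)
    have m2 := mem_convexHull_of_combination Finset.univ ![(γ : ℝ), δ, ε] ![P a, P b, P c]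
      (fun i _ => by fin_cases i <;> simp [p3.le, p4.le, p5.le])
      (by simpa [Fin.sum_univ_three] using add_pos (add_pos p3 p4) p5)
      (t := P '' (({a, b, c} : Finset V) : Set V)) (fun i _ => by fin_cases i <;> simp)
    simp only [Fin.sum_univ_two, Fin.sum_univ_three, Matrix.cons_val_zero, Matrix.cons_val_one,
      Matrix.cons_val] at m1 m2
    have e : (α : ℝ) • P x + (β : ℝ) • P y = (γ : ℝ) • P a + (δ : ℝ) • P b + (ε : ℝ) • P c := by
      funext i
      fin_cases i <;> simp [hP] <;> assumption
    rw [e, hsum'] at m1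
    have hm := Set.mem_inter m1 m2
    rw [hd] at hm
    exact hm

theorem exists_maximal_realizes [Fintype V] {K : AbstractSimplicialComplex V} {r : V → Point}
    (h : Realizes K r) :
    ∃ r, Realizes K r ∧ ∀ g < 16, ∑ v, (sym g (r v)).w ≤ ∑ v, (r v).w := by
  have hfin : ({n | ∃ r, Realizes K r ∧ n = ∑ v, (r v).w} : Set ℕ).Nonempty := ⟨_, r, h, rfl⟩
  have hbdd : BddAbove {n | ∃ r, Realizes K r ∧ n = ∑ v, (r v).w} := by
    refine ⟨∑ _v : V, 2 ^ 36, ?_⟩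
    rintro _ ⟨r, hr, rfl⟩
    refine Finset.sum_le_sum fun v _ => ?_
    obtain ⟨_, h1, h2, _⟩ := grid_spec _ (hr.mem v)
    rw [h2]
    exact Nat.pow_le_pow_right (by norm_num) h1.le
  obtain ⟨r, hr, hmax⟩ := Nat.sSup_mem hfin hbdd
  exact ⟨r, hr, fun g hg => hmax ▸ le_csSup hbdd ⟨_, hr.sym hg, rfl⟩⟩

theorem seven_le_of_three_mul_le {n : ℕ} (hn : n ≠ 0) (h : 3 * n ≤ n * (n - 1) / 2) : 7 ≤ n := by
  by_contra! hlt
  interval_cases n <;> omega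

open Classical in
/-- The edges of a complex. -/
noncomputable def edgeFinset [Fintype V] (K : AbstractSimplicialComplex V) : Finset (Finset V) :=
  Finset.univ.filter fun s => s.card = 2 ∧ s ∈ K

theorem edgeFinset_card_le [Fintype V] (K : AbstractSimplicialComplex V) :
    (edgeFinset K).card ≤ Fintype.card V * (Fintype.card V - 1) / 2 := by
  rw [← Nat.choose_two_right, ← Finset.card_univ, ← Finset.card_powersetCard]
  refine Finset.card_le_card fun s hs => ?_
  simp only [edgeFinset, Finset.mem_filter] at hs
  simp [Finset.mem_powersetCard, hs.2.1]

/-- A triangulated surface with at least three times as many edges as vertices that is realizable in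
the cuboid has eight vertices and one of two combinatorial types. -/
theorem exists_equiv_facets [Fintype V] [Nonempty V] {K : AbstractSimplicialComplex V}
    (hK : K.IsTriangulatedSurface) (hE : 3 * Fintype.card V ≤ (edgeFinset K).card)
    (hreal : K.HasGeneralPositionRealizationIn ![2, 2, 3]) :
    ∃ (b : Bool) (e : V ≃ Fin 8), ∀ x y z, x ≠ y → y ≠ z → z ≠ x →
      (({x, y, z} : Finset V) ∈ K ↔ ({e x, e y, e z} : Finset (Fin 8)) ∈ facets b) := by
  classical
  obtain ⟨r₀, hr₀⟩ := exists_realizes hreal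
  obtain ⟨r, hr, hmax⟩ := exists_maximal_realizes hr₀
  have hgn : grid.Nodup := grid_nodup.of_map _
  set Z : List Point := (grid.filter fun p => p ∈ Set.range r).reverse with hZdef
  have hsub : Z.reverse.Sublist grid := by rw [hZdef, List.reverse_reverse]; exact List.filter_sublist
  have hZn : Z.Nodup := List.nodup_reverse.1 (hsub.nodup hgn)
  have hZmem : ∀ p, p ∈ Z ↔ ∃ v, r v = p := by
    intro p
    rw [hZdef, List.mem_reverse, List.mem_filter]
    simp only [Set.mem_range, decide_eq_true_eq, and_iff_right_iff_imp]
    rintro ⟨v, rfl⟩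
    exact hr.mem v
  have hperm : Z.Perm ((Finset.univ : Finset V).toList.map r) := by
    refine (List.perm_ext_iff_of_nodup hZn ((Finset.nodup_toList _).map hr.inj)).2 fun p => ?_
    simp [hZmem]
  have hw : ∀ f : Point → ℕ, weight f Z = ∑ v, f (r v) := by
    intro f
    rw [weight, (hperm.map f).sum_eq, List.map_map, Finset.sum_map_toList]
    rfl
  have hlen : Z.length = Fintype.card V := by
    rw [hperm.length_eq, List.length_map, Finset.length_toList, Finset.card_univ]
  have h7 : 7 ≤ Z.length := by
    rw [hlen]
    exact seven_le_of_three_mul_le Fintype.card_ne_zero (hE.trans (edgeFinset_card_le K))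
  have hadm : Admissible Z := by
    refine ⟨fun p hp => ?_, ⟨hZn, ?_⟩, fun g hg => ?_, h7⟩
    · obtain ⟨v, rfl⟩ := (hZmem p).1 hp
      exact hr.mem v
    · intro a ha b hb c hc d hd
      obtain ⟨v, rfl⟩ := (hZmem a).1 ha
      obtain ⟨w, rfl⟩ := (hZmem b).1 hb
      obtain ⟨x, rfl⟩ := (hZmem c).1 hc
      obtain ⟨y, rfl⟩ := (hZmem d).1 hd
      intro h1 h2 h3 h4 h5 h6
      exact hr.det v w x y (ne_of_apply_ne r h1) (ne_of_apply_ne r h2) (ne_of_apply_ne r h3)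
        (ne_of_apply_ne r h4) (ne_of_apply_ne r h5) (ne_of_apply_ne r h6)
    · rw [hw, hw]
      exact hmax g hg
  let pt : ℕ → Point := fun i => Z.getD i ⟨0, 0, 0, 0, 0, 0⟩
  have hpt : Z = (List.range Z.length).map pt := by
    refine List.ext_getElem (by simp) fun i h1 h2 => ?_
    simp [pt, h1]
  have hptZ : ∀ i < Z.length, pt i ∈ Z := fun i hi => by
    simp only [pt, List.getD_eq_getElem _ _ hi]; exact List.getElem_mem hi
  have hu : ∀ i, ∃ v, i < Z.length → r v = pt i := by
    intro i
    by_cases hi : i < Z.length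
    · obtain ⟨v, hv⟩ := (hZmem _).1 (hptZ i hi)
      exact ⟨v, fun _ => hv⟩
    · exact ⟨Classical.arbitrary V, fun h => absurd h hi⟩
  choose u hu using hu
  have hptinj : ∀ i < Z.length, ∀ j < Z.length, pt i = pt j → i = j := by
    intro i hi j hj h
    simp only [pt, List.getD_eq_getElem _ _ hi, List.getD_eq_getElem _ _ hj] at h
    exact (hZn.getElem_inj_iff).1 h
  have huinj : ∀ i < Z.length, ∀ j < Z.length, u i = u j → i = j := by
    intro i hi j hj h
    exact hptinj i hi j hj (by rw [← hu i hi, ← hu j hj, h])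
  have husurj : ∀ v, ∃ i < Z.length, u i = v := by
    intro v
    obtain ⟨i, hi, h⟩ := List.getElem_of_mem ((hZmem _).2 ⟨v, rfl⟩)
    exact ⟨i, hi, hr.inj (by rw [hu i hi, ← h]; simp [pt, hi])⟩
  let F : ℕ → ℕ → ℕ → Prop := fun i j k =>
    i < Z.length ∧ j < Z.length ∧ k < Z.length ∧ K.Triangle (u i) (u j) (u k)
  have hcand : Candidate Z.length pt F := by
    refine ⟨fun i hi => grid_small (hadm.sub _ (hptZ i hi)), ?_, fun h => h.1, ?_, ?_, ?_, ?_, ?_, ?_,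
      ?_⟩
    · intro i j k l hij hjk hkl hl
      rw [← hu i (by omega), ← hu j (by omega), ← hu k (by omega), ← hu l hl]
      refine hr.det _ _ _ _ ?_ ?_ ?_ ?_ ?_ ?_ <;> intro h <;>
        (have := huinj _ (by omega) _ (by omega) h; omega)
    · rintro i j k ⟨_, _, _, h⟩ rfl
      exact h.1 rfl
    · exact fun h => ⟨h.2.1, h.2.2.1, h.1, h.2.2.2.rotate⟩
    · exact fun h => ⟨h.2.1, h.1, h.2.2.1, h.2.2.2.swap⟩
    · rintro i j k ⟨hi, hj, hk, h⟩
      obtain ⟨x, y, hxy, hz⟩ := hK.two h.1 h.pair_mem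
      obtain ⟨a, ha, rfl⟩ := husurj x
      obtain ⟨b, hb, rfl⟩ := husurj y
      refine ⟨a, b, fun h => hxy (h ▸ rfl), fun l => ⟨fun ⟨_, _, hl, h⟩ => ?_, ?_⟩⟩
      · exact ((hz _).1 h).imp (huinj l hl a ha) (huinj l hl b hb)
      · rintro (rfl | rfl)
        · exact ⟨hi, hj, ha, (hz _).2 (Or.inl rfl)⟩
        · exact ⟨hi, hj, hb, (hz _).2 (Or.inr rfl)⟩
    · rintro v W hW ⟨a, b, hab, ha⟩ c d hcd
      have hmem : u c ∈ {x | ∃ i < Z.length, u i = x ∧ i ∈ W} := by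
        refine hK.link (u v) {x | ∃ i < Z.length, u i = x ∧ i ∈ W} ?_ (a := u a)
          ⟨a, hab.2.1, rfl, ha⟩ hab.2.2.2.1 hab.2.2.2.pair_mem hcd.2.2.2.1 hcd.2.2.2.pair_mem
        rintro x y hxy ⟨i, hi, rfl, hiW⟩
        obtain ⟨j, hj, rfl⟩ := husurj y
        exact ⟨j, hj, rfl, hW i j ⟨hab.1, hi, hj, hxy⟩ hiW⟩
      obtain ⟨i, hi, hic⟩ := hmem
      rw [← huinj i hi c hcd.2.1 hic.1]
      exact hic.2
    · intro i j k a b c h1 h2 n1 n2 n3 n4 n5 n6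
      rw [← hu i h1.1, ← hu j h1.2.1, ← hu a h2.1, ← hu b h2.2.1, ← hu c h2.2.2.1]
      refine hr.disjoint _ _ _ _ _ h1.2.2.2.1 h1.2.2.2.pair_mem h2.2.2.2.2.2.2 ?_ ?_ ?_ ?_ ?_ ?_
      · exact fun h => n1 (huinj _ h1.1 _ h2.1 h)
      · exact fun h => n2 (huinj _ h1.1 _ h2.2.1 h)
      · exact fun h => n3 (huinj _ h1.1 _ h2.2.2.1 h)
      · exact fun h => n4 (huinj _ h1.2.1 _ h2.1 h)
      · exact fun h => n5 (huinj _ h1.2.1 _ h2.2.1 h)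
      · exact fun h => n6 (huinj _ h1.2.1 _ h2.2.2.1 h)
    · refine ⟨(edgePairs Z.length).filter fun p => ({u p.1, u p.2} : Finset V) ∈ K,
        List.filter_sublist, ?_, ?_⟩
      · rw [← hlen] at hE
        refine hE.trans ?_
        refine le_trans ?_ (List.toFinset_card_le _)
        refine Finset.card_le_card_of_surjOn (fun p => ({u p.1, u p.2} : Finset V)) ?_
        intro s hs
        simp only [edgeFinset, Finset.coe_filter, Finset.mem_univ, true_and, Set.mem_ofPred_eq] at hs
        obtain ⟨x, y, hxy, rfl⟩ := Finset.card_eq_two.1 hs.1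
        obtain ⟨i, hi, rfl⟩ := husurj x
        obtain ⟨j, hj, rfl⟩ := husurj y
        have hij : i ≠ j := fun h => hxy (h ▸ rfl)
        rcases lt_or_gt_of_ne hij with hlt | hlt
        · refine ⟨(i, j), ?_, rfl⟩
          simp [mem_edgePairs, hlt, hj, hs.2]
        · refine ⟨(j, i), ?_, Finset.pair_comm _ _⟩
          simp only [List.coe_toFinset, List.mem_filter, mem_edgePairs, hlt, hi, true_and,
            decide_eq_true_eq, Set.mem_ofPred_eq]
          rw [Finset.pair_comm]
          exact hs.2
      · rintro ⟨i, j⟩ hp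
        simp only [List.mem_filter, mem_edgePairs, decide_eq_true_eq] at hp
        obtain ⟨⟨hij, hj⟩, hK'⟩ := hp
        have hne : u i ≠ u j := fun h => by have := huinj i (by omega) j hj h; omega
        obtain ⟨z, hz⟩ := hK.exists_triangle hne hK'
        obtain ⟨k, hk, rfl⟩ := husurj z
        exact ⟨k, by dsimp only; omega, hj, hk, hz⟩
  obtain ⟨h8, b, f, hf, hfac⟩ := classification hadm hsub hpt hcand
  have hv : ∀ v, ∃ i : Fin 8, u i = v := fun v => by
    obtain ⟨i, hi, h⟩ := husurj v
    exact ⟨⟨i, h8 ▸ hi⟩, h⟩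
  choose ix hix using hv
  have hinj : Function.Injective fun v => f (ix v) := by
    intro v w h
    rw [← hix v, ← hix w, hf h]
  have hcard : Fintype.card V = Fintype.card (Fin 8) := by rw [← hlen, h8]; simp
  refine ⟨b, Equiv.ofBijective _ ((Fintype.bijective_iff_injective_and_card _).2 ⟨hinj, hcard⟩), ?_⟩
  have key : ∀ i j k : Fin 8, i < j → j < k → (K.Triangle (u i) (u j) (u k) ↔
      ({f i, f j, f k} : Finset (Fin 8)) ∈ facets b) := by
    intro i j k hij hjk
    rw [← hfac i j k hij hjk]
    have := i.2
    have := j.2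
    have := k.2
    exact ⟨fun h => ⟨by omega, by omega, by omega, h⟩, fun h => h.2.2.2⟩
  intro x y z hxy hyz hzx
  have hT : ({x, y, z} : Finset V) ∈ K ↔ K.Triangle (u (ix x)) (u (ix y)) (u (ix z)) := by
    rw [hix, hix, hix]
    exact ⟨fun h => ⟨hxy, hyz, hzx, h⟩, fun h => h.2.2.2⟩
  rw [hT]
  simp only [Equiv.ofBijective_apply]
  have d1 : ix x ≠ ix y := fun h => hxy (by rw [← hix x, ← hix y, h])
  have d2 : ix y ≠ ix z := fun h => hyz (by rw [← hix y, ← hix z, h])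
  have d3 : ix z ≠ ix x := fun h => hzx (by rw [← hix z, ← hix x, h])
  generalize ix x = i at *
  generalize ix y = j at *
  generalize ix z = k at *
  have s1 : ∀ a b c : Fin 8, ({a, b, c} : Finset (Fin 8)) = {b, a, c} := fun a b c =>
    Finset.insert_comm _ _ _
  have s2 : ∀ a b c : Fin 8, ({a, b, c} : Finset (Fin 8)) = {a, c, b} := fun a b c => by
    rw [Finset.pair_comm]
  have t1 : ∀ a b c, K.Triangle a b c ↔ K.Triangle b a c := fun a b c => ⟨.swap, .swap⟩
  have t2 : ∀ a b c, K.Triangle a b c ↔ K.Triangle a c b := fun a b c =>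
    ⟨.swap_right, .swap_right⟩
  rcases lt_or_gt_of_ne d1 with h1 | h1 <;> rcases lt_or_gt_of_ne d2 with h2 | h2 <;>
    rcases lt_or_gt_of_ne d3 with h3 | h3
  · exact absurd (h1.trans h2) h3.asymm
  · exact key i j k h1 h2
  · rw [t2, t1, s2, s1]; exact key k i j h3 h1
  · rw [t2, s2]; exact key i k j h3 h2
  · rw [t1, t2, s1, s2]; exact key j k i h2 h3
  · rw [t1, s1]; exact key j i k h1 h3
  · rw [t1, t2, t1, s1, s2, s1]; exact key k j i h2 h1
  · exact absurd (h1.trans h3) h2.asymm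

end CuboidTorus

namespace AbstractSimplicialComplex

variable {V : Type*} [Fintype V]

/-- The face of the standard simplex spanned by `s`. -/
def simplex (s : Finset V) : Set (V → ℝ) :=
  {x | x ∈ stdSimplex ℝ V ∧ ∀ v, x v ≠ 0 → v ∈ s}

theorem simplex_mono {s t : Finset V} (h : s ⊆ t) : simplex s ⊆ simplex t :=
  fun _ hx => ⟨hx.1, fun v hv => h (hx.2 v hv)⟩

theorem convex_simplex (s : Finset V) : Convex ℝ (simplex s) := by
  rintro x ⟨hx, hx'⟩ y ⟨hy, hy'⟩ a b ha hb hab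
  refine ⟨convex_stdSimplex ℝ V hx hy ha hb hab, fun v hv => ?_⟩
  by_contra hvs
  apply hv
  simp [not_imp_comm.1 (hx' v) hvs, not_imp_comm.1 (hy' v) hvs]

theorem isClosed_simplex (s : Finset V) : IsClosed (simplex s) := by
  have : simplex s = stdSimplex ℝ V ∩ ⋂ v ∈ {v | v ∉ s}, {x : V → ℝ | x v = 0} := by
    ext x
    simp [simplex, not_imp_comm]
  rw [this]
  refine (isCompact_stdSimplex ℝ V).isClosed.inter ?_
  exact isClosed_biInter fun v _ => isClosed_eq (continuous_apply v) continuous_const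

theorem isPreconnected_simplex (s : Finset V) : IsPreconnected (simplex s) :=
  (convex_simplex s).isPreconnected

theorem single_mem_simplex [DecidableEq V] {s : Finset V} {v : V} (hv : v ∈ s) :
    (Pi.single v 1 : V → ℝ) ∈ simplex s := by
  refine ⟨single_mem_stdSimplex ℝ v, fun w hw => ?_⟩
  by_contra h
  exact hw (Pi.single_eq_of_ne (fun e : w = v => h (e ▸ hv)) 1)

theorem simplex_subset_geomRealization {K : AbstractSimplicialComplex V} {s : Finset V}
    (hs : s ∈ K) : simplex s ⊆ K.geomRealization :=
  fun _ hx => ⟨hx.1, s, hs, hx.2⟩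

theorem mem_geomRealization_iff {K : AbstractSimplicialComplex V} {x : V → ℝ} :
    x ∈ K.geomRealization ↔ ∃ s ∈ K, x ∈ simplex s :=
  ⟨fun ⟨h, s, hs, h'⟩ => ⟨s, hs, h, h'⟩, fun ⟨s, hs, h, h'⟩ => ⟨h, s, hs, h'⟩⟩

/-- A retraction of the space of functions onto a simplex. -/
theorem exists_retraction_simplex {s : Finset V} (hs : s.Nonempty) :
    ∃ R : (V → ℝ) → V → ℝ, Continuous R ∧ (∀ x, R x ∈ simplex s) ∧ ∀ x ∈ simplex s, R x = x := by
  classical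
  obtain ⟨w, hw⟩ := hs
  let S : (V → ℝ) → ℝ := fun x => ∑ v ∈ s, max (x v) 0
  let N : (V → ℝ) → V → ℝ := fun x v =>
    (if v ∈ s then max (x v) 0 else 0) + if v = w then max (1 - S x) 0 else 0
  have hSc : Continuous S := by fun_prop
  have hS : ∀ x, 0 < max (S x) 1 := fun x => lt_max_of_lt_right one_pos
  have hN : ∀ x, ∑ v, N x v = max (S x) 1 := by
    intro x
    simp only [N, Finset.sum_add_distrib, Finset.sum_ite_mem, Finset.univ_inter,
      Finset.sum_ite_eq', Finset.mem_univ, if_true]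
    change S x + _ = _
    rcases le_total (S x) 1 with h | h
    · rw [max_eq_left (by linarith), max_eq_right h]; ring
    · rw [max_eq_right (by linarith), max_eq_left h]; ring
  refine ⟨fun x v => N x v / max (S x) 1, ?_, fun x => ⟨⟨fun v => ?_, ?_⟩, fun v hv => ?_⟩, ?_⟩
  · refine continuous_pi fun v => Continuous.div₀ ?_ (by fun_prop) fun x => (hS x).ne'
    refine Continuous.add ?_ ?_
    · split_ifs <;> fun_prop
    · split_ifs <;> fun_prop
  · refine div_nonneg (add_nonneg ?_ ?_) (hS x).le <;> split_ifs <;> simp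
  · rw [← Finset.sum_div, hN, div_self (hS x).ne']
  · by_contra h
    apply hv
    have : v ≠ w := fun e => h (e ▸ hw)
    simp [N, h, this]
  · rintro x ⟨hx, hx'⟩
    have h1 : ∀ v, (if v ∈ s then max (x v) 0 else 0) = x v := by
      intro v
      split_ifs with h
      · exact max_eq_left (hx.1 v)
      · exact (not_imp_comm.1 (hx' v) h).symm
    have h2 : S x = 1 := by
      rw [← hx.2, ← Finset.sum_congr rfl fun v _ => h1 v]
      simp [S]
    funext v
    simp [N, h1, h2]

theorem exists_sqrt_simplex {s : Finset V} (hs : s.Nonempty) {f : (V → ℝ) → ℂ}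
    (hf : ContinuousOn f (simplex s)) (h0 : ∀ x ∈ simplex s, f x ≠ 0) :
    ∃ r : (V → ℝ) → ℂ, ContinuousOn r (simplex s) ∧ ∀ x ∈ simplex s, r x ^ 2 = f x := by
  obtain ⟨R, hR, hRs, hid⟩ := exists_retraction_simplex hs
  have hsc : IsSimplyConnected (Set.univ : Set (V → ℝ)) := by
    have : ContractibleSpace (Set.univ : Set (V → ℝ)) :=
      convex_univ.contractibleSpace Set.univ_nonempty
    exact SimplyConnectedSpace.ofContractible _
  have hg : ContinuousOn (f ∘ R) Set.univ :=
    (hf.comp_continuous hR hRs).continuousOn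
  obtain ⟨r, hr, hr2⟩ := Complex.exists_continuousOn_pow_eq hsc isOpen_univ hg
    (by rintro ⟨x, _, hx⟩; exact h0 _ (hRs x) hx) two_ne_zero
  exact ⟨r, hr.mono (Set.subset_univ _), fun x hx => by rw [hr2, Function.comp, hid x hx]⟩

variable [DecidableEq V]

theorem root_eq_on {f r r' : (V → ℝ) → ℂ} {s t : Finset V} (hst : s ⊆ t)
    (h0 : ∀ x ∈ simplex s, f x ≠ 0)
    (hr : ContinuousOn r (simplex s)) (hr2 : ∀ x ∈ simplex s, r x ^ 2 = f x)
    (hr' : ContinuousOn r' (simplex t)) (hr2' : ∀ x ∈ simplex t, r' x ^ 2 = f x) {v : V}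
    (hv : v ∈ s) (h : r (Pi.single v 1) = r' (Pi.single v 1)) : Set.EqOn r r' (simplex s) :=
  (isPreconnected_simplex s).eq_of_sq_eq hr (hr'.mono (simplex_mono hst))
    (fun x hx => (hr2 x hx).trans (hr2' x (simplex_mono hst hx)).symm)
    (fun {x} hx h => h0 x hx (by rw [← hr2' x (simplex_mono hst hx), h]; simp))
    (single_mem_simplex hv) h

/-- Square roots that are compatible along all edges glue to a global square root. -/
theorem exists_sqrt {K : AbstractSimplicialComplex V} {f : (V → ℝ) → ℂ}
    (hf : ContinuousOn f K.geomRealization) (h0 : ∀ x ∈ K.geomRealization, f x ≠ 0) {σ : V → ℂ}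
    (hσ : ∀ v, {v} ∈ K → σ v ^ 2 = f (Pi.single v 1))
    (he : ∀ u v, u ≠ v → {u, v} ∈ K → ∃ r : (V → ℝ) → ℂ, ContinuousOn r (simplex {u, v}) ∧
      (∀ x ∈ simplex {u, v}, r x ^ 2 = f x) ∧ r (Pi.single u 1) = σ u ∧ r (Pi.single v 1) = σ v) :
    ∃ F : (V → ℝ) → ℂ, ContinuousOn F K.geomRealization ∧
      ∀ x ∈ K.geomRealization, F x ^ 2 = f x := by
  have hroot : ∀ s : Finset V, ∃ r : (V → ℝ) → ℂ, s ∈ K → ContinuousOn r (simplex s) ∧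
      (∀ x ∈ simplex s, r x ^ 2 = f x) ∧ ∀ v ∈ s, r (Pi.single v 1) = σ v := by
    intro s
    by_cases hs : s ∈ K
    swap
    · exact ⟨0, fun h => absurd h hs⟩
    have hsub := simplex_subset_geomRealization hs
    obtain ⟨w, hw⟩ := nonempty_of_mem hs
    obtain ⟨r, hr, hr2⟩ := exists_sqrt_simplex ⟨w, hw⟩ (hf.mono hsub) fun x hx => h0 x (hsub hx)
    obtain ⟨r, hr, hr2, hrw⟩ : ∃ r : (V → ℝ) → ℂ, ContinuousOn r (simplex s) ∧
        (∀ x ∈ simplex s, r x ^ 2 = f x) ∧ r (Pi.single w 1) = σ w := by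
      have : r (Pi.single w 1) ^ 2 = σ w ^ 2 := by
        rw [hσ w (mem_of_subset hs (by simpa) (by simp)), hr2 _ (single_mem_simplex hw)]
      rcases sq_eq_sq_iff_eq_or_eq_neg.1 this with h | h
      · exact ⟨r, hr, hr2, h⟩
      · exact ⟨-r, hr.neg, fun x hx => by rw [Pi.neg_apply, neg_sq, hr2 x hx], by simp [h]⟩
    refine ⟨r, fun _ => ⟨hr, hr2, fun v hv => ?_⟩⟩
    by_cases hwv : w = v
    · rw [← hwv, hrw]
    have hsub' : ({w, v} : Finset V) ⊆ s := by
      intro x; simp only [Finset.mem_insert, Finset.mem_singleton]; rintro (rfl | rfl) <;> assumption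
    obtain ⟨r', hr', hr2', h1, h2⟩ := he w v hwv (mem_of_subset hs hsub' (by simp))
    rw [← h2, root_eq_on hsub' (fun x hx => h0 x (hsub (simplex_mono hsub' hx))) hr' hr2' hr hr2
      (by simp) (h1.trans hrw.symm) (single_mem_simplex (by simp))]
  choose r hr using hroot
  let F : (V → ℝ) → ℂ := fun x => r (Finset.univ.filter fun v => x v ≠ 0) x
  have hF : ∀ s ∈ K, Set.EqOn F (r s) (simplex s) := by
    intro s hs x hx
    set t : Finset V := Finset.univ.filter fun v => x v ≠ 0 with ht
    have hts : t ⊆ s := fun v hv => hx.2 v (Finset.mem_filter.1 hv).2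
    have hxt : x ∈ simplex t := ⟨hx.1, fun v hv => by simp [ht, hv]⟩
    obtain ⟨w, hw⟩ : t.Nonempty := by
      by_contra h
      have h1 := hx.1.2
      rw [Finset.sum_eq_zero] at h1
      · exact zero_ne_one h1
      · intro v _
        by_contra hv
        exact h ⟨v, by simp [ht, hv]⟩
    have htK : t ∈ K := mem_of_subset hs hts ⟨w, hw⟩
    obtain ⟨a1, a2, a3⟩ := hr t htK
    obtain ⟨b1, b2, b3⟩ := hr s hs
    exact root_eq_on hts (fun y hy => h0 y (simplex_subset_geomRealization htK hy)) a1 a2 b1 b2 hw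
      ((a3 w hw).trans (b3 w (hts hw)).symm) hxt
  refine ⟨F, ?_, fun x hx => ?_⟩
  · have hU : K.geomRealization = ⋃ s : {s // s ∈ K}, simplex s.1 := by
      ext x; simp [mem_geomRealization_iff]
    rw [hU]
    refine (locallyFinite_of_finite _).continuousOn_iUnion (fun s => isClosed_simplex s.1) ?_
    intro s
    exact (hr s.1 s.2).1.congr (hF s.1 s.2)
  · obtain ⟨s, hs, hxs⟩ := mem_geomRealization_iff.1 hx
    rw [hF s hs hxs, (hr s hs).2.1 x hxs]

/-- There is no continuous square root on the circle. -/
theorem not_exists_sqrt_circle (G : Circle → ℂ) (hG : Continuous G) (h : ∀ z, G z ^ 2 = z) :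
    False := by
  have h1 : ContinuousOn (fun t : ℝ => G (Circle.exp t)) Set.univ := by
    have := Circle.exp.continuous
    fun_prop
  have h2 : ContinuousOn (fun t : ℝ => Complex.exp (t / 2 * Complex.I)) Set.univ := by fun_prop
  have key : ∀ t : ℝ, Complex.exp (t / 2 * Complex.I) ^ 2 = (Circle.exp t : ℂ) := by
    intro t
    rw [Circle.coe_exp, ← Complex.exp_nat_mul]
    congr 1
    push_cast
    ring
  have e0 : Circle.exp (2 * Real.pi) = Circle.exp 0 := by
    simp [Circle.exp_two_pi]
  have e1 : Complex.exp (((2 * Real.pi : ℝ) : ℂ) / 2 * Complex.I) = -1 := by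
    rw [← Complex.exp_pi_mul_I]
    congr 1
    push_cast
    ring
  rcases isPreconnected_univ.eq_or_eq_neg_of_sq_eq h1 h2
    (fun t _ => by simp only [Pi.pow_apply]; rw [h, key]) (fun _ => Complex.exp_ne_zero _) with h | h
  · have a := h (Set.mem_univ (2 * Real.pi))
    have b := h (Set.mem_univ 0)
    simp only [e0, e1] at a b
    rw [a] at b
    norm_num at b
  · have a := h (Set.mem_univ (2 * Real.pi))
    have b := h (Set.mem_univ 0)
    simp only [Pi.neg_apply, e0, e1] at a b
    rw [a] at b
    norm_num at b

/-- A set of vertices closed under passing to neighbours is everything or nothing if the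
realization is connected. -/
theorem eq_of_isPreconnected {K : AbstractSimplicialComplex V}
    (hc : IsPreconnected K.geomRealization) (hK : ∀ v, {v} ∈ K) {W : Set V}
    (hW : ∀ u v, u ≠ v → {u, v} ∈ K → u ∈ W → v ∈ W) {u v : V} (hu : u ∈ W) : v ∈ W := by
  classical
  let f : (V → ℝ) → ℝ := fun x => ∑ v, if v ∈ W then x v else 0
  have hf : ContinuousOn f K.geomRealization := by
    refine Continuous.continuousOn (continuous_finsetSum _ fun v _ => ?_)
    split_ifs <;> fun_prop
  have h01 : ∀ x ∈ K.geomRealization, f x = 0 ∨ f x = 1 := by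
    rintro x ⟨hx, s, hs, hxs⟩
    by_cases h : ∃ a ∈ s, a ∈ W
    · obtain ⟨a, ha, haW⟩ := h
      right
      rw [← hx.2]
      refine Finset.sum_congr rfl fun v _ => ?_
      by_cases hv : x v = 0
      · simp [hv]
      rw [if_pos]
      by_cases hav : a = v
      · rwa [← hav]
      refine hW a v hav (mem_of_subset hs ?_ (by simp)) haW
      intro y; simp only [Finset.mem_insert, Finset.mem_singleton]
      rintro (rfl | rfl)
      exacts [ha, hxs _ hv]
    · left
      refine Finset.sum_eq_zero fun v _ => ?_
      split_ifs with hv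
      · by_contra hne
        exact h ⟨v, hxs v hne, hv⟩
      · rfl
  have hvert : ∀ w, (Pi.single w 1 : V → ℝ) ∈ K.geomRealization := fun w =>
    simplex_subset_geomRealization (hK w) (single_mem_simplex (by simp))
  have hval : ∀ w, f (Pi.single w 1) = if w ∈ W then 1 else 0 := by
    intro w
    simp only [f]
    rw [Finset.sum_eq_single w]
    · simp
    · intro b _ hb; simp [hb]
    · simp
  by_contra hv
  have hi := hc.intermediate_value (hvert v) (hvert u) hf
  rw [hval, hval, if_neg hv, if_pos hu] at hi
  obtain ⟨x, hx, hx'⟩ := hi (show (1 / 2 : ℝ) ∈ Set.Icc 0 1 by norm_num)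
  rcases h01 x hx with h | h <;> rw [h] at hx' <;> norm_num at hx'

end AbstractSimplicialComplex

namespace AbstractSimplicialComplex

/-- The character of the group of order two. -/
noncomputable def sgn (a : ZMod 2) : ℂ := (-1) ^ a.val

theorem sgn_add (a b : ZMod 2) : sgn (a + b) = sgn a * sgn b := by
  rw [sgn, sgn, sgn, ← pow_add, ZMod.val_add, ← neg_one_pow_eq_pow_mod_two]

theorem sgn_pow (a b : ZMod 2) : sgn b ^ a.val = sgn (a * b) := by
  rw [sgn, sgn, ← pow_mul, ZMod.val_mul, ← neg_one_pow_eq_pow_mod_two, mul_comm]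

theorem sgn_zero : sgn 0 = 1 := by simp [sgn]

theorem sgn_one : sgn 1 = -1 := by simp [sgn, ZMod.val_one]

theorem sgn_sq (a : ZMod 2) : sgn a ^ 2 = 1 := by
  rw [sq, ← sgn_add, CharTwo.add_self_eq_zero, sgn_zero]

theorem sgn_injective : Function.Injective sgn := by
  intro a b h
  have : ∀ c : ZMod 2, c = 0 ∨ c = 1 := by decide
  rcases this a with rfl | rfl <;> rcases this b with rfl | rfl
  · rfl
  · rw [sgn_zero, sgn_one] at h; norm_num at h
  · rw [sgn_zero, sgn_one] at h; norm_num at h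
  · rfl

variable {V : Type*} [Fintype V] [DecidableEq V] {K : AbstractSimplicialComplex V}

/-- The function `r` is a square root of `f` on the face `s` whose values at the vertices are
`sgn (ε v) * ρ v`. -/
structure IsRoot (s : Finset V) (f : (V → ℝ) → ℂ) (ρ : V → ℂ) (r : (V → ℝ) → ℂ)
    (ε : V → ZMod 2) : Prop where
  cont : ContinuousOn r (simplex s)
  sq : ∀ x ∈ simplex s, r x ^ 2 = f x
  val : ∀ v ∈ s, r (Pi.single v 1) = sgn (ε v) * ρ v

theorem exists_isRoot {s : Finset V} (hs : s ∈ K) {f : (V → ℝ) → ℂ}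
    (hf : ContinuousOn f K.geomRealization) (h0 : ∀ x ∈ K.geomRealization, f x ≠ 0) {ρ : V → ℂ}
    (hρ : ∀ v, ρ v ^ 2 = f (Pi.single v 1)) : ∃ r ε, IsRoot s f ρ r ε := by
  have hsub := simplex_subset_geomRealization hs
  obtain ⟨r, hr, hr2⟩ := exists_sqrt_simplex (nonempty_of_mem hs) (hf.mono hsub)
    fun x hx => h0 x (hsub hx)
  have : ∀ v, ∃ a, v ∈ s → r (Pi.single v 1) = sgn a * ρ v := by
    intro v
    by_cases hv : v ∈ s
    swap
    · exact ⟨0, fun h => absurd h hv⟩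
    rcases sq_eq_sq_iff_eq_or_eq_neg.1 ((hr2 _ (single_mem_simplex hv)).trans (hρ v).symm) with h | h
    · exact ⟨0, fun _ => by rw [h, sgn_zero, one_mul]⟩
    · exact ⟨1, fun _ => by rw [h, sgn_one, neg_one_mul]⟩
  choose ε hε using this
  exact ⟨r, ε, hr, hr2, fun v hv => hε v hv⟩

/-- The obstruction cocycle to extracting a global square root. -/
theorem exists_cocycle {f : (V → ℝ) → ℂ} (hf : ContinuousOn f K.geomRealization)
    (h0 : ∀ x ∈ K.geomRealization, f x ≠ 0) {ρ : V → ℂ} (hρ : ∀ v, ρ v ^ 2 = f (Pi.single v 1)) :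
    ∃ n : Finset V → ZMod 2, ∀ s ∈ K, ∃ r ε, IsRoot s f ρ r ε ∧
      ∀ u ∈ s, ∀ v ∈ s, u ≠ v → n {u, v} = ε u + ε v := by
  have : ∀ s : Finset V, ∃ r ε, s ∈ K → IsRoot s f ρ r ε := by
    intro s
    by_cases hs : s ∈ K
    · obtain ⟨r, ε, h⟩ := exists_isRoot hs hf h0 hρ
      exact ⟨r, ε, fun _ => h⟩
    · exact ⟨0, 0, fun h => absurd h hs⟩
  choose r ε h using this
  refine ⟨fun e => ∑ v ∈ e, ε e v, fun s hs => ⟨r s, ε s, h s hs, fun u hu v hv huv => ?_⟩⟩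
  have hsub : ({u, v} : Finset V) ⊆ s := by
    intro x; simp only [Finset.mem_insert, Finset.mem_singleton]; rintro (rfl | rfl) <;> assumption
  have he : {u, v} ∈ K := mem_of_subset hs hsub (by simp)
  change ∑ v ∈ {u, v}, _ = _
  rw [Finset.sum_pair huv]
  set e : Finset V := {u, v} with hedef
  have hue : u ∈ e := by simp [hedef]
  have hve : v ∈ e := by simp [hedef]
  obtain ⟨c1, c2, c3⟩ := h e he
  obtain ⟨d1, d2, d3⟩ := h s hs
  have hmono := simplex_mono (V := V) hsub
  have hne : ∀ x ∈ simplex e, r s x ≠ 0 := fun x hx hr0 =>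
    h0 x (simplex_subset_geomRealization he hx) (by rw [← d2 x (hmono hx), hr0]; simp)
  have hρ0 : ∀ w ∈ e, ρ w ≠ 0 := fun w hw hw0 => by
    have := hne _ (single_mem_simplex hw)
    rw [d3 w (hsub hw), hw0, mul_zero] at this
    exact this rfl
  rcases (isPreconnected_simplex e).eq_or_eq_neg_of_sq_eq c1 (d1.mono hmono)
    (fun x hx => (c2 x hx).trans (d2 x (hmono hx)).symm) (fun {x} hx => hne x hx) with hq | hq
  · have key : ∀ w ∈ e, ε e w = ε s w := by
      intro w hw
      have := hq (single_mem_simplex hw)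
      rw [c3 w hw, d3 w (hsub hw)] at this
      exact sgn_injective (mul_right_cancel₀ (hρ0 w hw) this)
    rw [key u hue, key v hve]
  · have key : ∀ w ∈ e, ε e w = 1 + ε s w := by
      intro w hw
      have := hq (single_mem_simplex hw)
      rw [Pi.neg_apply, c3 w hw, d3 w (hsub hw), ← neg_mul] at this
      apply sgn_injective
      rw [sgn_add, sgn_one, neg_one_mul]
      exact mul_right_cancel₀ (hρ0 w hw) this
    rw [key u hue, key v hve]
    linear_combination CharTwo.add_self_eq_zero (1 : ZMod 2)

/-- If a combination of two obstruction cocycles is a coboundary, the corresponding product has a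
square root. -/
theorem exists_sqrt_of_cocycle {f g : (V → ℝ) → ℂ} (hf : ContinuousOn f K.geomRealization)
    (hf0 : ∀ x ∈ K.geomRealization, f x ≠ 0) (hg : ContinuousOn g K.geomRealization)
    (hg0 : ∀ x ∈ K.geomRealization, g x ≠ 0) {ρ τ : V → ℂ} (hρ : ∀ v, ρ v ^ 2 = f (Pi.single v 1))
    (hτ : ∀ v, τ v ^ 2 = g (Pi.single v 1)) {n k : Finset V → ZMod 2}
    (hn : ∀ s ∈ K, ∃ r ε, IsRoot s f ρ r ε ∧ ∀ u ∈ s, ∀ v ∈ s, u ≠ v → n {u, v} = ε u + ε v)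
    (hk : ∀ s ∈ K, ∃ r ε, IsRoot s g τ r ε ∧ ∀ u ∈ s, ∀ v ∈ s, u ≠ v → k {u, v} = ε u + ε v)
    {a b : ZMod 2} {m : V → ZMod 2}
    (h : ∀ u v, u ≠ v → {u, v} ∈ K → m u + m v + a * n {u, v} + b * k {u, v} = 0) :
    ∃ F : (V → ℝ) → ℂ, ContinuousOn F K.geomRealization ∧
      ∀ x ∈ K.geomRealization, F x ^ 2 = f x ^ a.val * g x ^ b.val := by
  refine exists_sqrt ((hf.pow _).mul (hg.pow _))
    (fun x hx => mul_ne_zero (pow_ne_zero _ (hf0 x hx)) (pow_ne_zero _ (hg0 x hx)))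
    (σ := fun v => sgn (m v) * (ρ v ^ a.val * τ v ^ b.val)) (fun v _ => ?_) fun u v huv he => ?_
  · rw [← hρ, ← hτ, mul_pow, sgn_sq]; ring
  · obtain ⟨r, ε, ⟨r1, r2, r3⟩, hr⟩ := hn _ he
    obtain ⟨q, δ, ⟨q1, q2, q3⟩, hq⟩ := hk _ he
    have hu : u ∈ ({u, v} : Finset V) := by simp
    have hv : v ∈ ({u, v} : Finset V) := by simp
    have e1 := h u v huv he
    rw [hr u hu v hv huv, hq u hu v hv huv] at e1
    have key : ∀ w c, c + (a * ε w + b * δ w) = m w →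
        sgn c * ((sgn (ε w) * ρ w) ^ a.val * (sgn (δ w) * τ w) ^ b.val) =
          sgn (m w) * (ρ w ^ a.val * τ w ^ b.val) := by
      intro w c hc
      rw [mul_pow, mul_pow, sgn_pow, sgn_pow, ← hc, sgn_add, sgn_add]
      ring
    refine ⟨fun x => sgn (a * ε u + b * δ u + m u) * (r x ^ a.val * q x ^ b.val),
      continuousOn_const.mul ((r1.pow _).mul (q1.pow _)), fun x hx => ?_, ?_, ?_⟩
    · rw [← r2 x hx, ← q2 x hx, mul_pow, sgn_sq]; ring
    · simp only [r3 u hu, q3 u hu]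
      refine key u _ ?_
      linear_combination CharTwo.add_self_eq_zero (a * ε u + b * δ u)
    · simp only [r3 v hv, q3 v hv]
      refine key v _ ?_
      linear_combination e1 - CharTwo.add_self_eq_zero (m v)

/-- The faces with `n` vertices. -/
abbrev Faces (K : AbstractSimplicialComplex V) (n : ℕ) := {s : Finset V // s.card = n ∧ s ∈ K}

noncomputable instance (n : ℕ) : Fintype (K.Faces n) := Fintype.ofFinite _

variable (K) in
/-- The incidence matrix between triangles and edges. -/
def incidence : Matrix (K.Faces 3) (K.Faces 2) (ZMod 2) :=
  Matrix.of fun t e => if e.1 ⊆ t.1 then 1 else 0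

theorem incidence_mulVec (t : K.Faces 3) (g : Finset V → ZMod 2) (ε : V → ZMod 2)
    (hg : ∀ u ∈ t.1, ∀ v ∈ t.1, u ≠ v → g {u, v} = ε u + ε v) :
    (K.incidence.mulVec fun e => g e.1) t = 0 := by
  have h1 : (K.incidence.mulVec fun e => g e.1) t = ∑ e ∈ t.1.powersetCard 2, g e := by
    simp only [Matrix.mulVec, dotProduct, incidence, Matrix.of_apply, ite_mul, one_mul, zero_mul]
    rw [← Finset.sum_filter]
    refine Finset.sum_nbij (·.1) ?_ ?_ ?_ fun _ _ => rfl
    · intro e he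
      exact Finset.mem_powersetCard.2 ⟨(Finset.mem_filter.1 he).2, e.2.1⟩
    · intro e _ e' _ h
      exact Subtype.ext h
    · intro e he
      obtain ⟨h1, h2⟩ := Finset.mem_powersetCard.1 he
      exact ⟨⟨e, h2, mem_of_subset t.2.2 h1 (Finset.card_pos.1 (by omega))⟩, by simp [h1], rfl⟩
  rw [h1]
  obtain ⟨x, y, z, hxy, hxz, hyz, ht⟩ := Finset.card_eq_three.1 t.2.1
  rw [ht] at hg ⊢
  have hp : ({x, y, z} : Finset V).powersetCard 2 = {{x, y}, {x, z}, {y, z}} := by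
    ext s
    rw [Finset.mem_powersetCard]
    constructor
    · rintro ⟨hs, hc⟩
      obtain ⟨p, q, hpq, rfl⟩ := Finset.card_eq_two.1 hc
      have hp := hs (Finset.mem_insert_self p {q})
      have hq := hs (Finset.mem_insert_of_mem (Finset.mem_singleton_self q))
      simp only [Finset.mem_insert, Finset.mem_singleton] at hp hq ⊢
      rcases hp with rfl | rfl | rfl <;> rcases hq with rfl | rfl | rfl <;>
        simp_all [Finset.pair_comm]
    · simp only [Finset.mem_insert, Finset.mem_singleton]
      rintro (rfl | rfl | rfl)
      · exact ⟨by intro; simp; tauto, Finset.card_pair hxy⟩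
      · exact ⟨by intro; simp; tauto, Finset.card_pair hxz⟩
      · exact ⟨by intro; simp; tauto, Finset.card_pair hyz⟩
  have ne : ∀ p q r : V, p ≠ q → p ≠ r → ({p, q} : Finset V) ≠ {r, q} ∧ ({p, q} : Finset V) ≠ {q, r}
      := by
    intro p q r h1 h2
    constructor <;> intro h <;>
      · have : p ∈ ({p, q} : Finset V) := by simp
        rw [h] at this
        simp at this
        tauto
  rw [hp, Finset.sum_insert, Finset.sum_insert, Finset.sum_singleton, hg x (by simp) y (by simp) hxy,
    hg x (by simp) z (by simp) hxz, hg y (by simp) z (by simp) hyz]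
  · linear_combination CharTwo.add_self_eq_zero (ε x) + CharTwo.add_self_eq_zero (ε y) +
      CharTwo.add_self_eq_zero (ε z)
  · rw [Finset.mem_singleton]
    exact (ne x z y hxz hxy).1
  · rw [Finset.mem_insert, Finset.mem_singleton, not_or]
    refine ⟨?_, (ne x y z hxy hxz).2⟩
    rw [Finset.pair_comm x y, Finset.pair_comm x z]
    exact (ne y x z hxy.symm hyz).1

/-- If no nontrivial combination of two nowhere vanishing functions has a square root, then there are
many cocycles modulo two. -/
theorem card_add_one_le_finrank_ker (hV : ∀ v : V, {v} ∈ K)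
    (hc : IsPreconnected K.geomRealization) {f g : (V → ℝ) → ℂ}
    (hf : ContinuousOn f K.geomRealization) (hf0 : ∀ x ∈ K.geomRealization, f x ≠ 0)
    (hg : ContinuousOn g K.geomRealization) (hg0 : ∀ x ∈ K.geomRealization, g x ≠ 0)
    (hfg : ∀ a b : ZMod 2, (∃ F : (V → ℝ) → ℂ, ContinuousOn F K.geomRealization ∧
      ∀ x ∈ K.geomRealization, F x ^ 2 = f x ^ a.val * g x ^ b.val) → a = 0 ∧ b = 0) :
    Fintype.card V + 1 ≤ Module.finrank (ZMod 2) (LinearMap.ker K.incidence.mulVecLin) := by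
  have hsqrt : ∀ z : ℂ, ∃ w, w ^ 2 = z := fun z => IsAlgClosed.exists_pow_nat_eq z two_pos
  choose root hroot using hsqrt
  obtain ⟨n, hn⟩ := exists_cocycle hf hf0 (ρ := fun v => root (f (Pi.single v 1)))
    fun v => hroot _
  obtain ⟨k, hk⟩ := exists_cocycle hg hg0 (ρ := fun v => root (g (Pi.single v 1)))
    fun v => hroot _
  let Φ : ((V → ZMod 2) × ZMod 2 × ZMod 2) →ₗ[ZMod 2] (K.Faces 2 → ZMod 2) :=
    { toFun := fun p e => (∑ v ∈ e.1, p.1 v) + p.2.1 * n e.1 + p.2.2 * k e.1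
      map_add' := fun p q => by
        funext e
        simp only [Prod.fst_add, Prod.snd_add, Pi.add_apply, Finset.sum_add_distrib]
        ring
      map_smul' := fun c p => by
        funext e
        simp only [Prod.smul_fst, Prod.smul_snd, Pi.smul_apply, smul_eq_mul, RingHom.id_apply,
          ← Finset.mul_sum]
        ring }
  have hrange : LinearMap.range Φ ≤ LinearMap.ker K.incidence.mulVecLin := by
    rintro _ ⟨p, rfl⟩
    rw [LinearMap.mem_ker, Matrix.mulVecLin_apply]
    funext t
    obtain ⟨_, ε, _, h1⟩ := hn t.1 t.2.2
    obtain ⟨_, δ, _, h2⟩ := hk t.1 t.2.2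
    refine incidence_mulVec t (fun e => (∑ v ∈ e, p.1 v) + p.2.1 * n e + p.2.2 * k e)
      (fun v => p.1 v + p.2.1 * ε v + p.2.2 * δ v) fun u hu v hv huv => ?_
    simp only [h1 u hu v hv huv, h2 u hu v hv huv, Finset.sum_pair huv]
    ring
  have hker : LinearMap.ker Φ ≤ Submodule.span (ZMod 2) {(1, 0, 0)} := by
    rintro ⟨m, a, b⟩ h
    rw [LinearMap.mem_ker] at h
    have h' : ∀ u v, u ≠ v → {u, v} ∈ K → m u + m v + a * n {u, v} + b * k {u, v} = 0 := by
      intro u v huv he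
      have := congrFun h ⟨{u, v}, Finset.card_pair huv, he⟩
      simpa [Φ, Finset.sum_pair huv] using this
    obtain ⟨rfl, rfl⟩ := hfg a b (exists_sqrt_of_cocycle hf hf0 hg hg0 (fun v => hroot _)
      (fun v => hroot _) hn hk h')
    have hconst : ∀ u v, m v = m u := by
      intro u v
      refine eq_of_isPreconnected hc hV (W := {w | m w = m u}) (fun x y hxy he hx => ?_) (u := u) rfl
      have := h' x y hxy he
      simp only [zero_mul, add_zero] at this
      exact (CharTwo.add_eq_zero.1 this).symm.trans hx
    rcases isEmpty_or_nonempty V with hemp | ⟨⟨u⟩⟩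
    · exact Submodule.mem_span_singleton.2 ⟨0, by ext v; exacts [hemp.elim v, rfl, rfl]⟩
    · exact Submodule.mem_span_singleton.2 ⟨m u, by ext v <;> simp [hconst u]⟩
  have h1 := Submodule.finrank_mono hrange
  have h2 := (Submodule.finrank_mono hker).trans (finrank_span_le_card _)
  have h3 := LinearMap.finrank_range_add_finrank_ker Φ
  simp only [Set.toFinset_singleton, Finset.card_singleton] at h2
  simp only [Module.finrank_prod, Module.finrank_fintype_fun_eq_card, Module.finrank_self] at h3
  omega

/-- The face of a triangle. -/
def Triangle.face {x y z : V} (h : K.Triangle x y z) : K.Faces 3 :=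
  ⟨{x, y, z}, Finset.card_eq_three.2 ⟨x, y, z, h.1, h.2.2.1.symm, h.2.1, rfl⟩, h.2.2.2⟩

theorem exists_triangle_eq (t : K.Faces 3) {v : V} (hv : v ∈ t.1) :
    ∃ (a b : V) (h : K.Triangle v a b), t = h.face := by
  obtain ⟨x, y, z, h1, h2, h3, ht⟩ := Finset.card_eq_three.1 t.2.1
  have hK := t.2.2
  rw [ht] at hv hK
  have h : K.Triangle x y z := ⟨h1, h3, h2.symm, hK⟩
  simp only [Finset.mem_insert, Finset.mem_singleton] at hv
  rcases hv with rfl | rfl | rfl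
  · exact ⟨_, _, h, Subtype.ext ht⟩
  · exact ⟨_, _, h.rotate, Subtype.ext (by rw [ht]; ext; simp [Triangle.face]; tauto)⟩
  · exact ⟨_, _, h.rotate.rotate, Subtype.ext (by rw [ht]; ext; simp [Triangle.face]; tauto)⟩

theorem IsTriangulatedSurface.exists_filter_eq (hK : K.IsTriangulatedSurface) (e : K.Faces 2) :
    ∃ t t' : K.Faces 3, t ≠ t' ∧
      (Finset.univ.filter fun t : K.Faces 3 => e.1 ⊆ t.1) = {t, t'} := by
  obtain ⟨x, y, hxy, he⟩ := Finset.card_eq_two.1 e.2.1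
  have heK := e.2.2
  rw [he] at heK ⊢
  obtain ⟨a, b, hab, hz⟩ := hK.two hxy heK
  have ha := (hz a).2 (Or.inl rfl)
  have hb := (hz b).2 (Or.inr rfl)
  refine ⟨ha.face, hb.face, fun h => ?_, ?_⟩
  · have h1 : a ∈ ha.face.1 := by simp [Triangle.face]
    rw [h] at h1
    simp only [Triangle.face, Finset.mem_insert, Finset.mem_singleton] at h1
    rcases h1 with h1 | h1 | h1
    exacts [ha.2.2.1 h1, ha.2.1 h1.symm, hab h1]
  · ext t
    simp only [Finset.mem_filter, Finset.mem_univ, true_and, Finset.mem_insert,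
      Finset.mem_singleton]
    constructor
    · intro h
      obtain ⟨z, hz', ht⟩ := Finset.exists_eq_insert_iff.2 ⟨h, by rw [Finset.card_pair hxy, t.2.1]⟩
      simp only [Finset.mem_insert, Finset.mem_singleton, not_or] at hz'
      have htr : K.Triangle z x y := ⟨hz'.1, hxy, Ne.symm hz'.2, by rw [ht]; exact t.2.2⟩
      have hface : t = htr.rotate.face := Subtype.ext (by
        rw [← ht]; ext; simp [Triangle.face]; tauto)
      rw [hface]
      rcases (hz z).1 htr.rotate with rfl | rfl
      exacts [Or.inl rfl, Or.inr rfl]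
    · rintro (rfl | rfl) <;> · intro; simp [Triangle.face]; tauto

/-- In a connected surface the triangles satisfy at most one relation modulo two. -/
theorem IsTriangulatedSurface.card_le_rank (hK : K.IsTriangulatedSurface)
    (hV : ∀ v : V, {v} ∈ K) (hc : IsPreconnected K.geomRealization) :
    Fintype.card (K.Faces 3) ≤ K.incidence.rank + 1 := by
  have hker : LinearMap.ker K.incidence.transpose.mulVecLin ≤
      Submodule.span (ZMod 2) {fun _ => 1} := by
    intro c h
    rw [LinearMap.mem_ker, Matrix.mulVecLin_apply] at h
    have hadj : ∀ (e : K.Faces 2) (t t' : K.Faces 3), e.1 ⊆ t.1 → e.1 ⊆ t'.1 → c t = c t' := by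
      intro e t t' ht ht'
      obtain ⟨s, s', hss, hf⟩ := hK.exists_filter_eq e
      have he := congrFun h e
      simp only [Matrix.mulVec, dotProduct, incidence, Matrix.transpose_apply, Matrix.of_apply,
        ite_mul, one_mul, zero_mul, Pi.zero_apply] at he
      rw [← Finset.sum_filter, hf, Finset.sum_pair hss, CharTwo.add_eq_zero] at he
      have key : ∀ t : K.Faces 3, e.1 ⊆ t.1 → t = s ∨ t = s' := by
        intro t ht
        have : t ∈ Finset.univ.filter fun t : K.Faces 3 => e.1 ⊆ t.1 := by simp [ht]
        rw [hf] at this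
        simpa using this
      rcases key t ht with rfl | rfl <;> rcases key t' ht' with rfl | rfl <;> simp [he]
    have hface : ∀ {x y z w} (h1 : K.Triangle x y z) (h2 : K.Triangle x y w),
        c h1.face = c h2.face := fun h1 h2 =>
      hadj ⟨_, Finset.card_pair h1.1, h1.pair_mem⟩ _ _ (by intro; simp [Triangle.face]; tauto)
        (by intro; simp [Triangle.face]; tauto)
    have hswap : ∀ {x y z} (h1 : K.Triangle x y z), h1.swap_right.face = h1.face := fun h1 =>
      Subtype.ext (by simp only [Triangle.face]; rw [Finset.pair_comm])
    have hloc : ∀ (v : V) (t t' : K.Faces 3), v ∈ t.1 → v ∈ t'.1 → c t = c t' := by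
      intro v t t' ht ht'
      obtain ⟨x, y, h1, rfl⟩ := exists_triangle_eq t ht
      obtain ⟨x', y', h2, rfl⟩ := exists_triangle_eq t' ht'
      have := hK.link v {a | ∀ b (h : K.Triangle v a b), c h1.face = c h.face} (a := x) (b := x')
        ?_ (fun b h => hface _ _) h1.1 h1.pair_mem h2.1 h2.pair_mem
      · exact this _ h2
      · intro a b hab ha d hd
        rw [ha b hab, ← hswap hab]
        exact hface _ _
    rcases isEmpty_or_nonempty (K.Faces 3) with hemp | ⟨⟨t₀⟩⟩
    · exact Submodule.mem_span_singleton.2 ⟨0, by ext v; exact hemp.elim v⟩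
    refine Submodule.mem_span_singleton.2 ⟨c t₀, funext fun t => ?_⟩
    obtain ⟨u, hu⟩ := nonempty_of_mem t₀.2.2
    obtain ⟨v, hv⟩ := nonempty_of_mem t.2.2
    have := eq_of_isPreconnected hc hV (W := {w | ∀ t : K.Faces 3, w ∈ t.1 → c t = c t₀}) ?_
      (u := u) (v := v) fun t ht => hloc u t t₀ ht hu
    · simp [this t hv]
    · intro x y hxy he hx t ht
      obtain ⟨z, hz⟩ := hK.exists_triangle hxy he
      rw [hloc y t hz.face ht (by simp [Triangle.face])]
      exact hx _ (by simp [Triangle.face])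
  have h1 := (Submodule.finrank_mono hker).trans (finrank_span_le_card _)
  have h2 := LinearMap.finrank_range_add_finrank_ker K.incidence.transpose.mulVecLin
  rw [Module.finrank_fintype_fun_eq_card] at h2
  have h3 : Module.finrank (ZMod 2) (LinearMap.range K.incidence.transpose.mulVecLin) =
      K.incidence.rank := by rw [← Matrix.rank_transpose]; rfl
  simp only [Set.toFinset_singleton, Finset.card_singleton] at h1
  omega

theorem IsTriangulatedSurface.three_mul_card (hK : K.IsTriangulatedSurface) :
    3 * Fintype.card (K.Faces 3) = 2 * Fintype.card (K.Faces 2) := by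
  have := Finset.card_mul_eq_card_mul (s := (Finset.univ : Finset (K.Faces 3)))
    (t := (Finset.univ : Finset (K.Faces 2))) (fun t e => e.1 ⊆ t.1) (m := 3) (n := 2)
    (fun t _ => ?_) fun e _ => ?_
  · rw [Finset.card_univ, Finset.card_univ] at this
    omega
  · have h3 := Finset.card_powersetCard 2 t.1
    rw [t.2.1] at h3
    change _ = 3 at h3
    refine Eq.trans ?_ h3
    refine Finset.card_nbij (·.1) ?_ ?_ ?_
    · intro e he
      exact Finset.mem_powersetCard.2 ⟨(Finset.mem_bipartiteAbove _).1 he |>.2, e.2.1⟩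
    · intro e _ e' _ h
      exact Subtype.ext h
    · intro e he
      obtain ⟨h1, h2⟩ := Finset.mem_powersetCard.1 he
      refine ⟨⟨e, h2, mem_of_subset t.2.2 h1 (Finset.card_pos.1 (by omega))⟩, ?_, rfl⟩
      exact (Finset.mem_bipartiteAbove _).2 ⟨Finset.mem_univ _, h1⟩
  · obtain ⟨s, s', hss, hf⟩ := hK.exists_filter_eq e
    rw [Finset.bipartiteBelow, hf, Finset.card_pair hss]

/-- A triangulated torus has at least three times as many edges as vertices. -/
theorem IsTriangulatedTorus.three_mul_card_le (hK : K.IsTriangulatedTorus) :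
    3 * Fintype.card V ≤ Fintype.card (K.Faces 2) := by
  obtain ⟨hS, ⟨φ⟩⟩ := hK
  have hV : ∀ v : V, {v} ∈ K := fun v => by
    obtain ⟨y, _, h⟩ := hS.exists_edge v
    exact mem_of_subset h (by simp) (by simp)
  have hc : IsPreconnected K.geomRealization := by
    have : Set.range (fun p => (φ.symm p).1) = K.geomRealization := by
      rw [← Function.comp_def Subtype.val, φ.symm.surjective.range_comp, Subtype.range_coe]
    rw [← this]
    exact isPreconnected_range (by fun_prop)
  classical
  have hcomp : ∀ π : Circle × Circle → Circle, Continuous π → ∃ f : (V → ℝ) → ℂ,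
      ContinuousOn f K.geomRealization ∧ (∀ x ∈ K.geomRealization, f x ≠ 0) ∧
      ∀ p, f (φ.symm p) = π p := by
    intro π hπ
    refine ⟨fun x => if h : x ∈ K.geomRealization then π (φ ⟨x, h⟩) else 0, ?_, fun x hx => ?_,
      fun p => ?_⟩
    · rw [continuousOn_iff_continuous_domRestrict]
      have : Continuous fun x : K.geomRealization => (π (φ x) : ℂ) := by fun_prop
      convert this using 2 with x
      simp
    · simp [hx]
    · simp
  obtain ⟨f, hf, hf0, hfφ⟩ := hcomp Prod.fst continuous_fst
  obtain ⟨g, hg, hg0, hgφ⟩ := hcomp Prod.snd continuous_snd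
  have hfg : ∀ a b : ZMod 2, (∃ F : (V → ℝ) → ℂ, ContinuousOn F K.geomRealization ∧
      ∀ x ∈ K.geomRealization, F x ^ 2 = f x ^ a.val * g x ^ b.val) → a = 0 ∧ b = 0 := by
    rintro a b ⟨F, hF, hF2⟩
    have hcont : ∀ ι : Circle → Circle × Circle, Continuous ι →
        Continuous fun z => F (φ.symm (ι z)) := fun ι hι =>
      hF.comp_continuous (by fun_prop) fun z => (φ.symm (ι z)).2
    have h01 : ∀ c : ZMod 2, c = 0 ∨ c = 1 := by decide
    refine ⟨(h01 a).resolve_right fun ha => ?_, (h01 b).resolve_right fun hb => ?_⟩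
    · refine not_exists_sqrt_circle _ (hcont (fun z => (z, 1)) (by fun_prop)) fun z => ?_
      rw [hF2 _ (φ.symm _).2, hfφ, hgφ, ha]
      simp [ZMod.val_one]
    · refine not_exists_sqrt_circle _ (hcont (fun z => (1, z)) (by fun_prop)) fun z => ?_
      rw [hF2 _ (φ.symm _).2, hfφ, hgφ, hb]
      simp [ZMod.val_one]
  have h1 := card_add_one_le_finrank_ker hV hc hf hf0 hg hg0 hfg
  have h2 := hS.card_le_rank hV hc
  have h3 := LinearMap.finrank_range_add_finrank_ker K.incidence.mulVecLin
  rw [Module.finrank_fintype_fun_eq_card] at h3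
  have h4 : Module.finrank (ZMod 2) (LinearMap.range K.incidence.mulVecLin) = K.incidence.rank := rfl
  have h5 := hS.three_mul_card
  omega

end AbstractSimplicialComplex

namespace AbstractSimplicialComplex

variable {V W : Type*} [Fintype V] [DecidableEq V] [Fintype W] [DecidableEq W]

/-- The union of the simplices spanned by the sets in `L`. -/
def facetSpace (L : List (Finset V)) : Set (V → ℝ) := {x | ∃ t ∈ L, x ∈ simplex t}

theorem facetSpace_mono {L L' : List (Finset V)} (h : ∀ t ∈ L, ∃ t' ∈ L', t ⊆ t') :
    facetSpace L ⊆ facetSpace L' := by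
  rintro x ⟨t, ht, hx⟩
  obtain ⟨t', ht', hsub⟩ := h t ht
  exact ⟨t', ht', simplex_mono hsub hx⟩

/-- Push the common weight of `B` over to `A`. -/
noncomputable def flipMap (A B : Finset V) (hB : B.Nonempty) (x : V → ℝ) : V → ℝ := fun v =>
  x v + B.inf' hB x * ((if v ∈ A then (B.card / A.card : ℝ) else 0) - if v ∈ B then 1 else 0)

theorem continuous_flipMap (A B : Finset V) (hB : B.Nonempty) : Continuous (flipMap A B hB) := by
  have : Continuous fun x : V → ℝ => B.inf' hB x :=
    Continuous.finset_inf'_apply hB fun v _ => continuous_apply v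
  exact continuous_pi fun v => (continuous_apply v).add (this.mul continuous_const)

/-- The combinatorial effect of pushing the common weight of `B` over to `A`. -/
def Flips (L L' : List (Finset V)) (A B : Finset V) : Prop :=
  ∀ t ∈ L, ¬ A ⊆ t ∧ (B ⊆ t → ∀ b ∈ B, ∃ t' ∈ L', t.erase b ∪ A ⊆ t') ∧
    (¬ B ⊆ t → ∃ t' ∈ L', t ⊆ t')

instance (L L' : List (Finset V)) (A B : Finset V) : Decidable (Flips L L' A B) := by
  unfold Flips; infer_instance

theorem flipMap_mem {L L' : List (Finset V)} {A B : Finset V} (hA : A.Nonempty) (hB : B.Nonempty)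
    (hAB : Disjoint A B) (h : Flips L L' A B) {x : V → ℝ} (hx : x ∈ facetSpace L) :
    flipMap A B hB x ∈ facetSpace L' := by
  obtain ⟨t, ht, hx, hxt⟩ := hx
  obtain ⟨b, hb, hbμ⟩ := B.exists_mem_eq_inf' hB x
  have hμ0 : 0 ≤ B.inf' hB x := hbμ ▸ hx.1 b
  have hA0 : (0 : ℝ) < A.card := by exact_mod_cast hA.card_pos
  have hstd : flipMap A B hB x ∈ stdSimplex ℝ V := by
    refine ⟨fun v => ?_, ?_⟩
    · by_cases hv : v ∈ B
      · have := Finset.inf'_le x hv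
        simp only [flipMap, hv, Finset.disjoint_right.1 hAB hv, if_true, if_false]
        linarith
      · simp only [flipMap, hv, if_false, sub_zero]
        exact add_nonneg (hx.1 v) (mul_nonneg hμ0 (by split_ifs <;> positivity))
    · simp only [flipMap, Finset.sum_add_distrib, ← Finset.mul_sum, Finset.sum_sub_distrib,
        Finset.sum_ite_mem, Finset.univ_inter, Finset.sum_const, nsmul_eq_mul, hx.2]
      field_simp
      ring
  obtain ⟨_, h2, h3⟩ := h t ht
  by_cases hBt : B ⊆ t
  · obtain ⟨t', ht', hsub⟩ := h2 hBt b hb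
    refine ⟨t', ht', hstd, fun v hv => hsub ?_⟩
    rw [Finset.mem_union, Finset.mem_erase]
    by_contra hcon
    rw [not_or, not_and_or, not_not] at hcon
    obtain ⟨h4, h5⟩ := hcon
    apply hv
    rcases h4 with rfl | h4
    · simp [flipMap, hb, h5, hbμ]
    · simp [flipMap, h5, mt (@hBt v) h4, not_imp_comm.1 (hxt v) h4]
  · obtain ⟨t', ht', hsub⟩ := h3 hBt
    obtain ⟨c, hc, hct⟩ := Finset.not_subset.1 hBt
    have hμ : B.inf' hB x = 0 :=
      le_antisymm ((Finset.inf'_le x hc).trans (not_imp_comm.1 (hxt c) hct).le) hμ0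
    refine ⟨t', ht', hstd, fun v hv => hsub (hxt v fun h0 => hv ?_)⟩
    simp [flipMap, hμ, h0]

theorem flipMap_flipMap {L L' : List (Finset V)} {A B : Finset V} (hA : A.Nonempty)
    (hB : B.Nonempty) (hAB : Disjoint A B) (h : Flips L L' A B) {x : V → ℝ}
    (hx : x ∈ facetSpace L) : flipMap B A hA (flipMap A B hB x) = x := by
  obtain ⟨t, ht, hx, hxt⟩ := hx
  obtain ⟨a, ha, hat⟩ := Finset.not_subset.1 (h t ht).1
  have hA0 : (0 : ℝ) < A.card := by exact_mod_cast hA.card_pos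
  have hB0 : (0 : ℝ) < B.card := by exact_mod_cast hB.card_pos
  have hval : ∀ v ∈ A, flipMap A B hB x v = x v + B.inf' hB x * (B.card / A.card) := by
    intro v hv
    simp [flipMap, hv, Finset.disjoint_left.1 hAB hv]
  have hμ : A.inf' hA (flipMap A B hB x) = B.inf' hB x * (B.card / A.card) := by
    refine le_antisymm ((Finset.inf'_le _ ha).trans ?_) (Finset.le_inf' _ _ fun v hv => ?_)
    · rw [hval a ha, not_imp_comm.1 (hxt a) hat, zero_add]
    · rw [hval v hv]
      exact le_add_of_nonneg_left (hx.1 v)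
  funext v
  rw [flipMap, hμ, flipMap]
  split_ifs <;> field_simp <;> ring

/-- A bistellar flip does not change the realization up to homeomorphism. -/
theorem nonempty_homeomorph_flip {L L' : List (Finset V)} (A B : Finset V) (hA : A.Nonempty)
    (hB : B.Nonempty) (hAB : Disjoint A B) (h : Flips L L' A B) (h' : Flips L' L B A) :
    Nonempty (facetSpace L ≃ₜ facetSpace L') :=
  ⟨{ toFun := fun x => ⟨_, flipMap_mem hA hB hAB h x.2⟩
     invFun := fun x => ⟨_, flipMap_mem hB hA hAB.symm h' x.2⟩
     left_inv := fun x => Subtype.ext (flipMap_flipMap hA hB hAB h x.2)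
     right_inv := fun x => Subtype.ext (flipMap_flipMap hB hA hAB.symm h' x.2)
     continuous_toFun := ((continuous_flipMap A B hB).comp continuous_subtype_val).subtype_mk _
     continuous_invFun := ((continuous_flipMap B A hA).comp continuous_subtype_val).subtype_mk _ }⟩

/-- The facets after a bistellar flip replacing the star of `B` by the star of `A`. -/
def flipFacets (A B : List V) (L : List (Finset V)) : List (Finset V) :=
  (L.filter fun t => ¬ B.toFinset ⊆ t) ++
    (L.filter fun t => B.toFinset ⊆ t).flatMap fun t => B.map fun b => t.erase b ∪ A.toFinset

/-- A sequence of bistellar flips leads from `L` to `M`. -/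
def flipsTo (M : List (Finset V)) : List (List V × List V) → List (Finset V) → Bool
  | [], L => decide ((∀ t ∈ L, ∃ t' ∈ M, t ⊆ t') ∧ ∀ t ∈ M, ∃ t' ∈ L, t ⊆ t')
  | (A, B) :: ms, L =>
    decide (A.toFinset.Nonempty ∧ B.toFinset.Nonempty ∧ Disjoint A.toFinset B.toFinset ∧
      Flips L (flipFacets A B L) A.toFinset B.toFinset ∧
      Flips (flipFacets A B L) L B.toFinset A.toFinset) && flipsTo M ms (flipFacets A B L)

theorem nonempty_homeomorph_of_flipsTo {M : List (Finset V)} (ms : List (List V × List V)) :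
    ∀ L, flipsTo M ms L = true → Nonempty (facetSpace L ≃ₜ facetSpace M) := by
  induction ms with
  | nil =>
    intro L h
    have h := of_decide_eq_true h
    exact ⟨Homeomorph.setCongr ((facetSpace_mono h.1).antisymm (facetSpace_mono h.2))⟩
  | cons m ms ih =>
    obtain ⟨A, B⟩ := m
    intro L h
    rw [flipsTo, Bool.and_eq_true, decide_eq_true_eq] at h
    obtain ⟨⟨hA, hB, hAB, h1, h2⟩, h3⟩ := h
    obtain ⟨e⟩ := nonempty_homeomorph_flip _ _ hA hB hAB h1 h2
    obtain ⟨e'⟩ := ih _ h3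
    exact ⟨e.trans e'⟩

/-- Adding vertices that are not used does not change the realization. -/
theorem nonempty_homeomorph_map (ι : V ↪ W) (L : List (Finset V)) :
    Nonempty (facetSpace L ≃ₜ facetSpace (L.map fun t => t.map ι)) := by
  let E : (V → ℝ) → W → ℝ := fun x => Function.extend ι x (fun _ => (0 : ℝ))
  have hEι : ∀ x v, E x (ι v) = x v := fun x v => ι.injective.extend_apply x _ v
  have hE0 : ∀ x w, (¬ ∃ v, ι v = w) → E x w = 0 := fun x w hw => Function.extend_apply' x _ w hw
  have hEc : Continuous E := by
    refine continuous_pi fun w => ?_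
    by_cases hw : ∃ v, ι v = w
    · obtain ⟨v, rfl⟩ := hw
      simp only [hEι]
      exact continuous_apply v
    · simp only [hE0 _ w hw]
      exact continuous_const
  have hsum : ∀ y : W → ℝ, (∀ w, (¬ ∃ v, ι v = w) → y w = 0) → ∑ v, y (ι v) = ∑ w, y w := by
    intro y hy
    rw [← Finset.sum_map Finset.univ ι]
    exact Finset.sum_subset (Finset.subset_univ _) fun w _ hw => hy w (by simpa using hw)
  have hrange : ∀ y ∈ facetSpace (L.map fun t => t.map ι), ∀ w, (¬ ∃ v, ι v = w) → y w = 0 := by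
    rintro y ⟨t, ht, hy⟩ w hw
    obtain ⟨t, ht, rfl⟩ := List.mem_map.1 ht
    by_contra h0
    obtain ⟨v, _, hv⟩ := Finset.mem_map.1 (hy.2 w h0)
    exact hw ⟨v, hv⟩
  refine ⟨{ toFun := fun x => ⟨E x, ?_⟩, invFun := fun y => ⟨y ∘ ι, ?_⟩, left_inv := fun x => ?_,
            right_inv := fun y => ?_, continuous_toFun := ?_, continuous_invFun := ?_ }⟩
  · obtain ⟨t, ht, hx, hxt⟩ := x.2
    refine ⟨t.map ι, List.mem_map_of_mem ht, ⟨fun w => ?_, ?_⟩, fun w hw => ?_⟩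
    · by_cases hw : ∃ v, ι v = w
      · obtain ⟨v, rfl⟩ := hw
        rw [hEι]; exact hx.1 v
      · exact (hE0 _ w hw).ge
    · rw [← hsum _ (hE0 _)]
      simp only [hEι]
      exact hx.2
    · by_cases hw' : ∃ v, ι v = w
      · obtain ⟨v, rfl⟩ := hw'
        rw [hEι] at hw
        exact Finset.mem_map_of_mem ι (hxt v hw)
      · exact absurd (hE0 _ w hw') hw
  · obtain ⟨t, ht, hy, hyt⟩ := y.2
    obtain ⟨t, ht', rfl⟩ := List.mem_map.1 ht
    refine ⟨t, ht', ⟨fun v => hy.1 _, ?_⟩, fun v hv => ?_⟩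
    · exact (hsum _ (hrange _ y.2)).trans hy.2
    · simpa using hyt _ hv
  · exact Subtype.ext (funext fun v => hEι _ v)
  · refine Subtype.ext (funext fun w => ?_)
    by_cases hw : ∃ v, ι v = w
    · obtain ⟨v, rfl⟩ := hw
      exact hEι _ v
    · exact (hE0 _ w hw).trans (hrange _ y.2 w hw).symm
  · exact (hEc.comp continuous_subtype_val).subtype_mk _
  · exact Continuous.subtype_mk (continuous_pi fun v => (show Continuous fun y : W → ℝ => y (ι v) from
      continuous_apply _).comp continuous_subtype_val) _

theorem isCompact_facetSpace (L : List (Finset V)) : IsCompact (facetSpace L) := by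
  have : facetSpace L = ⋃ t ∈ {t | t ∈ L}, simplex t := by ext; simp [facetSpace]
  rw [this]
  refine L.finite_toSet.isCompact_biUnion fun t _ => ?_
  exact (isCompact_stdSimplex ℝ V).of_isClosed_subset (isClosed_simplex t) fun x hx => hx.1

/-- The boundary of a triangle. -/
def triangleBoundary : Set (Fin 3 → ℝ) := {x | x ∈ stdSimplex ℝ (Fin 3) ∧ ∃ i, x i = 0}

theorem nonempty_homeomorph_circle : Nonempty (triangleBoundary ≃ₜ Circle) := by
  let z : (Fin 3 → ℝ) → ℂ := fun x => ⟨x 0 - x 2, x 1 - x 2⟩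
  let m : ℂ → ℝ := fun w => min (min w.re w.im) 0
  let N : ℂ → ℝ := fun w => w.re + w.im - 3 * m w
  let y : ℂ → Fin 3 → ℝ := fun w => ![(w.re - m w) / N w, (w.im - m w) / N w, - m w / N w]
  have hzc : Continuous z := by
    have : z = fun x => ((x 0 - x 2 : ℝ) : ℂ) + ((x 1 - x 2 : ℝ) : ℂ) * Complex.I := by
      funext x; exact (Complex.mk_eq_add_mul_I _ _)
    rw [this]
    fun_prop
  have hmc : Continuous m := (Complex.continuous_re.min Complex.continuous_im).min continuous_const
  have hNc : Continuous N := by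
    have := Complex.continuous_re
    have := Complex.continuous_im
    fun_prop
  have hm : ∀ w, m w ≤ w.re ∧ m w ≤ w.im ∧ m w ≤ 0 ∧ (m w = w.re ∨ m w = w.im ∨ m w = 0) := by
    intro w
    simp only [m]
    refine ⟨by simp, by simp, by simp, ?_⟩
    rcases min_choice (min w.re w.im) 0 with h | h
    · rcases min_choice w.re w.im with h' | h' <;> rw [h, h'] <;> simp
    · simp [h]
  have hN : ∀ w, w ≠ 0 → 0 < N w := by
    intro w hw
    obtain ⟨h1, h2, h3, h4⟩ := hm w
    simp only [N]
    by_contra! hle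
    exact hw (Complex.ext (by simp; linarith) (by simp; linarith))
  have hyz : ∀ w, w ≠ 0 → z (y w) = ((N w)⁻¹ : ℝ) * w := by
    intro w hw
    have := hN w hw
    apply Complex.ext
    · simp [z, y]; field_simp; ring
    · simp [z, y]; field_simp; ring
  have hzb : ∀ x ∈ triangleBoundary, z x ≠ 0 := by
    rintro x ⟨hx, i, hi⟩ h
    have h1 : x 0 - x 2 = 0 := congrArg Complex.re h
    have h2 : x 1 - x 2 = 0 := congrArg Complex.im h
    have h3 := hx.2
    rw [Fin.sum_univ_three] at h3
    fin_cases i <;> simp at hi <;> linarith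
  have hmz : ∀ x ∈ triangleBoundary, m (z x) = - x 2 := by
    rintro x ⟨hx, i, hi⟩
    have h0 := hx.1 0
    have h1 := hx.1 1
    have h2 := hx.1 2
    simp only [m, z]
    rw [min_def, min_def]
    fin_cases i <;> simp at hi <;> split_ifs <;> linarith
  have hmul : ∀ (c : ℝ) (w : ℂ), 0 < c → y (c * w) = y w := by
    intro c w hc
    have h1 : m (c * w) = c * m w := by
      simp only [m, Complex.re_ofReal_mul, Complex.im_ofReal_mul]
      rw [mul_min_of_nonneg _ _ hc.le, mul_min_of_nonneg _ _ hc.le, mul_zero]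
    have h2 : N (c * w) = c * N w := by
      simp only [N, h1, Complex.re_ofReal_mul, Complex.im_ofReal_mul]; ring
    have key : ∀ a, c * a / (c * N w) = a / N w := fun a => mul_div_mul_left _ _ hc.ne'
    funext i
    simp only [y, h1, h2, Complex.re_ofReal_mul, Complex.im_ofReal_mul, ← mul_sub, ← mul_neg, key]
  have hzy : ∀ x ∈ triangleBoundary, y (z x) = x := by
    intro x hx
    have h3 := hx.1.2
    rw [Fin.sum_univ_three] at h3
    have hN1 : N (z x) = 1 := by
      simp only [N, hmz x hx]
      simp only [z]
      linarith
    funext i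
    fin_cases i <;> simp [y, hN1, hmz x hx, z]
  have hyb : ∀ w, w ≠ 0 → y w ∈ triangleBoundary := by
    intro w hw
    have hN := hN w hw
    obtain ⟨h1, h2, h3, h4⟩ := hm w
    refine ⟨⟨fun i => ?_, ?_⟩, ?_⟩
    · fin_cases i <;> simp only [y] <;> exact div_nonneg (by simp; linarith) hN.le
    · rw [Fin.sum_univ_three]
      simp only [y, Matrix.cons_val_zero, Matrix.cons_val_one, Matrix.cons_val]
      rw [← add_div, ← add_div, div_eq_one_iff_eq hN.ne']
      simp only [N]; ring
    · rcases h4 with h4 | h4 | h4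
      · exact ⟨0, by simp [y, h4]⟩
      · exact ⟨1, by simp [y, h4]⟩
      · exact ⟨2, by simp [y, h4]⟩
  have hu : ∀ x ∈ triangleBoundary, ((‖z x‖⁻¹ : ℝ) : ℂ) * z x ∈ Submonoid.unitSphere ℂ := by
    intro x hx
    refine mem_sphere_zero_iff_norm.2 ?_
    rw [norm_mul, Complex.norm_real, norm_inv, norm_norm,
      inv_mul_cancel₀ (norm_ne_zero_iff.2 (hzb x hx))]
  refine ⟨{ toFun := fun x => ⟨_, hu x x.2⟩
            invFun := fun w => ⟨y w, hyb w w.coe_ne_zero⟩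
            left_inv := fun x => Subtype.ext ?_
            right_inv := fun w => Circle.ext ?_
            continuous_toFun := ?_, continuous_invFun := ?_ }⟩
  · exact (hmul _ _ (inv_pos.2 (norm_pos_iff.2 (hzb x x.2)))).trans (hzy x x.2)
  · have h1 := hN w w.coe_ne_zero
    change ((‖z (y w)‖⁻¹ : ℝ) : ℂ) * z (y w) = w
    rw [hyz w w.coe_ne_zero, norm_mul, Complex.norm_real, Circle.norm_coe, mul_one, norm_inv,
      Real.norm_of_nonneg h1.le, inv_inv, ← mul_assoc, ← Complex.ofReal_mul,
      mul_inv_cancel₀ h1.ne', Complex.ofReal_one, one_mul]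
  · refine Continuous.subtype_mk (Continuous.mul (Complex.continuous_ofReal.comp ?_) ?_) _
    · exact Continuous.inv₀ (by fun_prop) fun x => norm_ne_zero_iff.2 (hzb x x.2)
    · fun_prop
  · refine Continuous.subtype_mk ?_ _
    have hw : Continuous fun w : Circle => (w : ℂ) := by fun_prop
    have h0 : ∀ w : Circle, N w ≠ 0 := fun w => (hN w w.coe_ne_zero).ne'
    have hre := Complex.continuous_re
    have him := Complex.continuous_im
    refine continuous_pi fun i => ?_
    fin_cases i
    · exact Continuous.div (f := fun w : Circle => (w : ℂ).re - m w) (by fun_prop) (by fun_prop) h0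
    · exact Continuous.div (f := fun w : Circle => (w : ℂ).im - m w) (by fun_prop) (by fun_prop) h0
    · exact Continuous.div (f := fun w : Circle => - m w) (by fun_prop) (by fun_prop) h0

end AbstractSimplicialComplex

namespace AbstractSimplicialComplex

/-- The facets of the first kind of the triangulation of the torus by a `3 × 3` grid. -/
def lowerFacet (i j : Fin 3) : Finset (Fin 3 × Fin 3) := {(i, j), (i + 1, j), (i + 1, j + 1)}

/-- The facets of the second kind of the triangulation of the torus by a `3 × 3` grid. -/
def upperFacet (i j : Fin 3) : Finset (Fin 3 × Fin 3) := {(i, j), (i, j + 1), (i + 1, j + 1)}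

/-- The triangulation of the torus by a `3 × 3` grid. -/
def gridFacets : List (Finset (Fin 3 × Fin 3)) :=
  (List.finRange 3).flatMap fun i => (List.finRange 3).flatMap fun j =>
    [lowerFacet i j, upperFacet i j]

/-- The marginals of a point of the grid. -/
def marginals (x : Fin 3 × Fin 3 → ℝ) : (Fin 3 → ℝ) × (Fin 3 → ℝ) :=
  (fun i => ∑ j, x (i, j), fun j => ∑ i, x (i, j))

theorem marginals_fst (x : Fin 3 × Fin 3 → ℝ) (i : Fin 3) : (marginals x).1 i = ∑ j, x (i, j) := rfl

theorem marginals_snd (x : Fin 3 × Fin 3 → ℝ) (j : Fin 3) : (marginals x).2 j = ∑ i, x (i, j) := rfl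

/-- Recovers a point of the grid from its marginals. -/
def ofMarginals (p : (Fin 3 → ℝ) × (Fin 3 → ℝ)) : Fin 3 × Fin 3 → ℝ := fun v =>
  max 0 (1 - max (p.1 (v.1 + 1)) (p.2 (v.2 + 1)) - max (p.1 (v.1 + 2)) (p.2 (v.2 + 2)))

theorem sum_cyclic (f : Fin 3 → ℝ) (i : Fin 3) : ∑ k, f k = f i + f (i + 1) + f (i + 2) := by
  rw [Fin.sum_univ_three]
  fin_cases i
  · rfl
  · change _ = f 1 + f 2 + f 0; ring
  · change _ = f 2 + f 0 + f 1; ring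

theorem cyclic_cases : ∀ i k : Fin 3, k = i ∨ k = i + 1 ∨ k = i + 2 := by decide

theorem cyclic_add : ∀ i : Fin 3, i + 1 + 1 = i + 2 ∧ i + 1 + 2 = i ∧ i + 2 + 1 = i ∧
    i + 2 + 2 = i + 1 := by decide

theorem cyclic_ne : ∀ i : Fin 3, i ≠ i + 1 ∧ i + 1 ≠ i ∧ i ≠ i + 2 ∧ i + 2 ≠ i ∧ i + 1 ≠ i + 2 ∧
    i + 2 ≠ i + 1 := by decide

theorem ofMarginals_lower {x : Fin 3 × Fin 3 → ℝ} {i j : Fin 3} (hx : x ∈ simplex (lowerFacet i j)) :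
    ofMarginals (marginals x) = x := by
  obtain ⟨⟨hx, hsum⟩, hxt⟩ := hx
  have h0 : ∀ v, v ∉ lowerFacet i j → x v = 0 := fun v => not_imp_comm.1 (hxt v)
  obtain ⟨i1, i2, i3, i4⟩ := cyclic_add i
  obtain ⟨j1, j2, j3, j4⟩ := cyclic_add j
  obtain ⟨a1, a2, a3, a4, a5, a6⟩ := cyclic_ne i
  obtain ⟨b1, b2, b3, b4, b5, b6⟩ := cyclic_ne j
  have z1 : x (i, j + 1) = 0 := h0 _ (by simp [lowerFacet, *])
  have z2 : x (i, j + 2) = 0 := h0 _ (by simp [lowerFacet, *])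
  have z3 : x (i + 1, j + 2) = 0 := h0 _ (by simp [lowerFacet, *])
  have z4 : x (i + 2, j) = 0 := h0 _ (by simp [lowerFacet, *])
  have z5 : x (i + 2, j + 1) = 0 := h0 _ (by simp [lowerFacet, *])
  have z6 : x (i + 2, j + 2) = 0 := h0 _ (by simp [lowerFacet, *])
  have p1 := hx (i, j)
  have p2 := hx (i + 1, j)
  have p3 := hx (i + 1, j + 1)
  rw [Fintype.sum_prod_type, sum_cyclic _ i, sum_cyclic _ j, sum_cyclic _ j, sum_cyclic _ j] at hsum
  simp only [z1, z2, z3, z4, z5, z6, add_zero] at hsum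
  have hr : ∀ k, (marginals x).1 k = x (k, j) + x (k, j + 1) + x (k, j + 2) := fun k => by
    rw [marginals_fst, sum_cyclic _ j]
  have hs : ∀ k, (marginals x).2 k = x (i, k) + x (i + 1, k) + x (i + 2, k) := fun k => by
    rw [marginals_snd, sum_cyclic _ i]
  clear h0 hxt hx
  funext ⟨k, l⟩
  simp only [ofMarginals, hr, hs]
  rcases cyclic_cases i k with rfl | rfl | rfl <;> rcases cyclic_cases j l with rfl | rfl | rfl <;>
    simp only [i1, i2, i3, i4, j1, j2, j3, j4, z1, z2, z3, z4, z5, z6, add_zero, zero_add] <;>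
    clear i1 i2 i3 i4 j1 j2 j3 j4 a1 a2 a3 a4 a5 a6 b1 b2 b3 b4 b5 b6 hr hs z1 z2 z3 z4 z5 z6 <;>
    (simp only [max_def]; split_ifs <;> linarith)

theorem swap_mem_lower {x : Fin 3 × Fin 3 → ℝ} {i j : Fin 3} (hx : x ∈ simplex (upperFacet i j)) :
    x ∘ Prod.swap ∈ simplex (lowerFacet j i) := by
  refine ⟨⟨fun v => hx.1.1 _, ?_⟩, fun v hv => ?_⟩
  · rw [← hx.1.2]
    exact (Equiv.prodComm _ _).sum_comp x
  · have := hx.2 _ hv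
    obtain ⟨k, l⟩ := v
    simp only [upperFacet, lowerFacet, Prod.swap, Finset.mem_insert, Finset.mem_singleton,
      Prod.mk.injEq] at this ⊢
    tauto

theorem ofMarginals_marginals {x : Fin 3 × Fin 3 → ℝ} (hx : x ∈ facetSpace gridFacets) :
    ofMarginals (marginals x) = x := by
  obtain ⟨t, ht, hx⟩ := hx
  simp only [gridFacets, List.mem_flatMap, List.mem_cons, List.not_mem_nil, or_false] at ht
  obtain ⟨i, _, j, _, rfl | rfl⟩ := ht
  · exact ofMarginals_lower hx
  · have h := ofMarginals_lower (swap_mem_lower hx)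
    funext v
    rw [← Prod.swap_swap v, ← Function.comp_apply (f := x), ← h]
    simp only [ofMarginals, marginals, Function.comp, Prod.swap]
    rw [max_comm (∑ k, x (v.1 + 1, k)), max_comm (∑ k, x (v.1 + 2, k))]

theorem mem_gridFacets (i j : Fin 3) : lowerFacet i j ∈ gridFacets ∧ upperFacet i j ∈ gridFacets := by
  simp only [gridFacets, List.mem_flatMap, List.mem_finRange, true_and]
  exact ⟨⟨i, j, by simp⟩, ⟨i, j, by simp⟩⟩

theorem exists_lower {r s : Fin 3 → ℝ} (hr : r ∈ stdSimplex ℝ (Fin 3)) (hs : s ∈ stdSimplex ℝ (Fin 3))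
    {i j : Fin 3} (hi : r (i + 2) = 0) (hj : s (j + 2) = 0) (hle : s (j + 1) ≤ r (i + 1)) :
    ∃ x ∈ simplex (lowerFacet i j), marginals x = (r, s) := by
  obtain ⟨a1, a2, a3, a4, a5, a6⟩ := cyclic_ne i
  obtain ⟨b1, b2, b3, b4, b5, b6⟩ := cyclic_ne j
  have hr2 := hr.2
  have hs2 := hs.2
  rw [sum_cyclic r i] at hr2
  rw [sum_cyclic s j] at hs2
  let x : Fin 3 × Fin 3 → ℝ := fun v => if v = (i, j) then r i else if v = (i + 1, j) then
    r (i + 1) - s (j + 1) else if v = (i + 1, j + 1) then s (j + 1) else 0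
  have hm : marginals x = (r, s) := by
    refine Prod.ext (funext fun k => ?_) (funext fun k => ?_)
    · rw [marginals_fst, sum_cyclic _ j]
      rcases cyclic_cases i k with rfl | rfl | rfl <;> simp [x, *]
    · rw [marginals_snd, sum_cyclic _ i]
      rcases cyclic_cases j k with rfl | rfl | rfl <;> simp [x, *]
      linarith
  refine ⟨x, ⟨⟨fun v => ?_, ?_⟩, fun v hv => ?_⟩, hm⟩
  · simp only [x]
    split_ifs
    exacts [hr.1 _, sub_nonneg.2 hle, hs.1 _, le_rfl]
  · rw [Fintype.sum_prod_type, ← hr.2]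
    exact Finset.sum_congr rfl fun k _ => congrFun (congrArg Prod.fst hm) k
  · by_contra h
    simp only [lowerFacet, Finset.mem_insert, Finset.mem_singleton, not_or] at h
    exact hv (by simp [x, h])

theorem exists_marginals_eq {r s : Fin 3 → ℝ} (hr : r ∈ triangleBoundary)
    (hs : s ∈ triangleBoundary) : ∃ x ∈ facetSpace gridFacets, marginals x = (r, s) := by
  have hk : ∀ k : Fin 3, ∃ i, k = i + 2 := by decide
  obtain ⟨hr, k, hrk⟩ := hr
  obtain ⟨hs, l, hsl⟩ := hs
  obtain ⟨i, rfl⟩ := hk k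
  obtain ⟨j, rfl⟩ := hk l
  rcases le_total (s (j + 1)) (r (i + 1)) with hle | hle
  · obtain ⟨x, hx, hm⟩ := exists_lower hr hs hrk hsl hle
    exact ⟨x, ⟨_, (mem_gridFacets i j).1, hx⟩, hm⟩
  · obtain ⟨x, hx, hm⟩ := exists_lower hs hr hsl hrk hle
    refine ⟨x ∘ Prod.swap, ⟨_, (mem_gridFacets i j).2, ⟨⟨fun v => hx.1.1 _, ?_⟩, fun v hv => ?_⟩⟩, ?_⟩
    · rw [← hx.1.2]
      exact (Equiv.prodComm _ _).sum_comp x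
    · have := hx.2 _ hv
      obtain ⟨k, l⟩ := v
      simp only [upperFacet, lowerFacet, Prod.swap, Finset.mem_insert, Finset.mem_singleton,
        Prod.mk.injEq] at this ⊢
      tauto
    · exact Prod.ext (congrArg Prod.snd hm) (congrArg Prod.fst hm)

theorem marginals_mem {x : Fin 3 × Fin 3 → ℝ} (hx : x ∈ facetSpace gridFacets) :
    (marginals x).1 ∈ triangleBoundary ∧ (marginals x).2 ∈ triangleBoundary := by
  obtain ⟨t, ht, hx, hxt⟩ := hx
  have key : ∃ i j : Fin 3, (∀ k, (i, k) ∉ t) ∧ ∀ k, (k, j) ∉ t := by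
    clear hxt
    revert t
    decide +kernel
  obtain ⟨i, j, hi, hj⟩ := key
  refine ⟨⟨⟨fun k => ?_, ?_⟩, i, ?_⟩,
    ⟨⟨fun k => ?_, ?_⟩, j, ?_⟩⟩
  · rw [marginals_fst]
    exact Finset.sum_nonneg fun l _ => hx.1 _
  · rw [← hx.2, Fintype.sum_prod_type]; rfl
  · rw [marginals_fst]
    exact Finset.sum_eq_zero fun k _ => not_imp_comm.1 (hxt _) (hi k)
  · rw [marginals_snd]
    exact Finset.sum_nonneg fun l _ => hx.1 _
  · rw [← hx.2, Fintype.sum_prod_type_right]; rfl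
  · rw [marginals_snd]
    exact Finset.sum_eq_zero fun k _ => not_imp_comm.1 (hxt _) (hj k)

theorem nonempty_homeomorph_grid : Nonempty (facetSpace gridFacets ≃ₜ Circle × Circle) := by
  let F : facetSpace gridFacets → triangleBoundary × triangleBoundary := fun x =>
    (⟨_, (marginals_mem x.2).1⟩, ⟨_, (marginals_mem x.2).2⟩)
  have hc : ∀ v, Continuous fun x : facetSpace gridFacets => x.1 v := fun v =>
    (show Continuous fun y : Fin 3 × Fin 3 → ℝ => y v from continuous_apply v).comp
      continuous_subtype_val
  have hF : Continuous F := by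
    refine Continuous.prodMk (Continuous.subtype_mk (continuous_pi fun i => ?_) _)
      (Continuous.subtype_mk (continuous_pi fun i => ?_) _)
    · simp only [marginals_fst]
      exact continuous_finsetSum _ fun j _ => hc (i, j)
    · simp only [marginals_snd]
      exact continuous_finsetSum _ fun j _ => hc (j, i)
  have hinj : Function.Injective F := by
    intro x y h
    apply Subtype.ext
    rw [← ofMarginals_marginals x.2, ← ofMarginals_marginals y.2]
    congr 1
    exact Prod.ext (congrArg (fun p => p.1.1) h) (congrArg (fun p => p.2.1) h)
  have hsurj : Function.Surjective F := by
    rintro ⟨r, s⟩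
    obtain ⟨x, hx, hm⟩ := exists_marginals_eq r.2 s.2
    exact ⟨⟨x, hx⟩, Prod.ext (Subtype.ext (congrArg Prod.fst hm))
      (Subtype.ext (congrArg Prod.snd hm))⟩
  have : CompactSpace (facetSpace gridFacets) := isCompact_iff_compactSpace.1 (isCompact_facetSpace _)
  obtain ⟨e⟩ := nonempty_homeomorph_circle
  exact ⟨(Continuous.homeoOfEquivCompactToT2 (f := Equiv.ofBijective F ⟨hinj, hsurj⟩) hF).trans
    (e.prodCongr e)⟩

end AbstractSimplicialComplex

namespace AbstractSimplicialComplex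

/-- The simplicial complex with given facets. -/
def ofFacets {V : Type*} (L : List (Finset V)) (hL : ∀ v, ∃ t ∈ L, v ∈ t) :
    AbstractSimplicialComplex V where
  faces := {s | s.Nonempty ∧ ∃ t ∈ L, s ⊆ t}
  isRelLowerSet_faces := fun _ h => ⟨h.1, fun _ hst hs => ⟨hs, let ⟨t, ht, h⟩ := h.2
    ⟨t, ht, hst.trans h⟩⟩⟩
  singleton_mem := fun v => ⟨Finset.singleton_nonempty v, let ⟨t, ht, h⟩ := hL v
    ⟨t, ht, Finset.singleton_subset_iff.2 h⟩⟩

theorem mem_ofFacets {V : Type*} {L : List (Finset V)} {hL : ∀ v, ∃ t ∈ L, v ∈ t} {s : Finset V} :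
    s ∈ ofFacets L hL ↔ s.Nonempty ∧ ∃ t ∈ L, s ⊆ t := Iff.rfl

theorem geomRealization_ofFacets {V : Type*} [Fintype V] {L : List (Finset V)}
    {hL : ∀ v, ∃ t ∈ L, v ∈ t} : (ofFacets L hL).geomRealization = facetSpace L := by
  classical
  refine Set.Subset.antisymm (fun x hx => ?_) ?_
  · obtain ⟨h1, s, ⟨_, t, ht, hst⟩, h2⟩ := hx
    exact ⟨t, ht, h1, fun v hv => hst (h2 v hv)⟩
  · rintro x ⟨t, ht, hx⟩
    obtain ⟨v, hv⟩ : ∃ v, x v ≠ 0 := by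
      by_contra! h
      have := hx.1.2
      simp [h] at this
    exact simplex_subset_geomRealization (mem_ofFacets.2 ⟨⟨v, hx.2 v hv⟩, t, ht, subset_rfl⟩) hx

/-- A criterion for the link of a vertex to be a cycle. -/
theorem nonempty_linkGraph_iso {V : Type*} [DecidableEq V] {K : AbstractSimplicialComplex V} {v : V}
    {l : List V} (hl : l.Nodup) (h1 : ∀ w, w ∈ l ↔ w ≠ v ∧ {v, w} ∈ K)
    (h2 : ∀ i j : Fin l.length, i ≠ j ∧ {v, l.get i, l.get j} ∈ K ↔
      (i - j).val = 1 ∨ (j - i).val = 1) :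
    Nonempty (K.linkGraph v ≃g SimpleGraph.cycleGraph l.length) := by
  let e : Fin l.length ≃ {w : V // w ≠ v ∧ ({v, w} : Finset V) ∈ K} :=
    Equiv.ofBijective (fun i => ⟨l.get i, (h1 _).1 (List.get_mem l i)⟩)
      ⟨fun i j h => hl.injective_get (congrArg Subtype.val h), fun w => by
        obtain ⟨i, hi⟩ := List.get_of_mem ((h1 _).2 w.2)
        exact ⟨i, Subtype.ext hi⟩⟩
  refine ⟨RelIso.symm ⟨e, fun {i j} => ?_⟩⟩
  rw [SimpleGraph.cycleGraph_adj', ← h2]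
  change (e i ≠ e j ∧ _) ↔ _
  rw [e.injective.ne_iff]
  rfl

end AbstractSimplicialComplex

namespace CuboidTorus

open AbstractSimplicialComplex

theorem facets_cover : ∀ b v, ∃ t ∈ facets b, v ∈ t := by decide +kernel

/-- The two triangulated tori. -/
def torus (b : Bool) : AbstractSimplicialComplex (Fin 8) := ofFacets (facets b) (facets_cover b)

instance (b : Bool) (s : Finset (Fin 8)) : Decidable (s ∈ torus b) :=
  decidable_of_iff _ mem_ofFacets.symm

/-- The vertex `v` is surrounded by the cyclic sequence `l` of neighbours. -/
def IsLinkCycle (b : Bool) (v : Fin 8) (l : List (Fin 8)) : Prop :=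
  3 ≤ l.length ∧ l.Nodup ∧ (∀ w, w ∈ l ↔ w ≠ v ∧ {v, w} ∈ torus b) ∧
    ∀ i j : Fin l.length, i ≠ j ∧ {v, l.get i, l.get j} ∈ torus b ↔
      (i - j).val = 1 ∨ (j - i).val = 1

instance (b : Bool) (v : Fin 8) (l : List (Fin 8)) : Decidable (IsLinkCycle b v l) := by
  unfold IsLinkCycle; infer_instance

/-- The links of the vertices of the two tori. -/
def linkCycle : Bool → Fin 8 → List (Fin 8)
  | false => ![[1, 2, 4, 3], [0, 2, 5, 4, 7, 6, 3], [0, 1, 5, 7, 6, 4], [0, 1, 6, 5, 7, 4],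
      [0, 2, 6, 5, 1, 7, 3], [1, 2, 7, 3, 6, 4], [1, 3, 5, 4, 2, 7], [1, 4, 3, 5, 2, 6]]
  | true => ![[1, 2, 4, 5, 3], [0, 2, 5, 7, 4, 6, 3], [0, 1, 5, 6, 7, 4], [0, 1, 6, 7, 5],
      [0, 2, 7, 1, 6, 5], [0, 3, 7, 1, 2, 6, 4], [1, 3, 7, 2, 5, 4], [1, 4, 2, 6, 3, 5]]

theorem isLinkCycle_linkCycle : ∀ b v, IsLinkCycle b v (linkCycle b v) := by decide +kernel

theorem torus_isTriangulatedSurface (b : Bool) : (torus b).IsTriangulatedSurface := by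
  refine ⟨fun s hs => ?_, fun v => ?_⟩
  · obtain ⟨_, t, ht, hst⟩ := mem_ofFacets.1 hs
    have : ∀ b, ∀ t ∈ facets b, t.card ≤ 3 := by decide +kernel
    exact (Finset.card_le_card hst).trans (this b t ht)
  · obtain ⟨h1, h2, h3, h4⟩ := isLinkCycle_linkCycle b v
    exact ⟨_, h1, nonempty_linkGraph_iso h2 h3 h4⟩

/-- Positions of the vertices of the tori in the grid. -/
def gridPosition : Bool → Fin 8 → Fin 3 × Fin 3
  | false => ![(2, 0), (1, 0), (2, 1), (1, 2), (0, 1), (1, 1), (0, 2), (2, 2)]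
  | true => ![(0, 1), (2, 0), (0, 0), (2, 1), (1, 2), (0, 2), (1, 0), (1, 1)]

/-- Bistellar flips leading to the grid. -/
def gridFlips : Bool → List (List (Fin 3 × Fin 3) × List (Fin 3 × Fin 3))
  | false => [([(0, 0)], [(0, 1), (1, 0)]),
      ([(2, 0), (2, 2)], [(0, 1), (1, 2)]),
      ([(0, 1), (1, 2)], [(0, 2), (1, 1)]),
      ([(0, 0), (2, 0)], [(0, 1), (2, 2)]),
      ([(0, 0), (0, 2)], [(1, 0), (2, 2)])]
  | true => [([(2, 2)], [(1, 1), (2, 0)]),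
      ([(0, 0), (2, 2)], [(0, 2), (2, 0)]),
      ([(0, 1), (1, 1)], [(0, 0), (1, 2)]),
      ([(2, 1), (2, 2)], [(0, 2), (1, 1)])]

theorem gridPosition_injective : ∀ b, Function.Injective (gridPosition b) := by decide +kernel

theorem flipsTo_gridFlips (b : Bool) : flipsTo gridFacets (gridFlips b)
    ((facets b).map fun t => t.map ⟨gridPosition b, gridPosition_injective b⟩) = true := by
  cases b <;> decide +kernel

theorem torus_isTriangulatedTorus (b : Bool) : (torus b).IsTriangulatedTorus := by
  refine ⟨torus_isTriangulatedSurface b, ?_⟩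
  obtain ⟨e₁⟩ := nonempty_homeomorph_map ⟨gridPosition b, gridPosition_injective b⟩ (facets b)
  obtain ⟨e₂⟩ := nonempty_homeomorph_of_flipsTo _ _ (flipsTo_gridFlips b)
  obtain ⟨e₃⟩ := nonempty_homeomorph_grid
  exact ⟨(Homeomorph.setCongr geomRealization_ofFacets).trans (e₁.trans (e₂.trans e₃))⟩

end CuboidTorus

namespace CuboidTorus

open AbstractSimplicialComplex

theorem exists_weights {V : Type*} [Fintype V] {p : V → Fin 3 → ℝ} (hp : Function.Injective p)
    {s : Finset V} {x : Fin 3 → ℝ} (hx : x ∈ convexHull ℝ (p '' s)) :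
    ∃ w : V → ℝ, (∀ v, 0 ≤ w v) ∧ ∑ v, w v = 1 ∧ ∑ v, w v • p v = x ∧ ∀ v, w v ≠ 0 → v ∈ s := by
  classical
  rw [← Finset.coe_image, Finset.mem_convexHull'] at hx
  obtain ⟨w, h1, h2, h3⟩ := hx
  rw [Finset.sum_image hp.injOn] at h2 h3
  refine ⟨fun v => if v ∈ s then w (p v) else 0, fun v => ?_, ?_, ?_, fun v hv => ?_⟩
  · dsimp only
    split_ifs with h
    exacts [h1 _ (Finset.mem_image_of_mem p h), le_rfl]
  · rw [Finset.sum_ite_mem, Finset.univ_inter, h2]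
  · simp only [ite_smul, zero_smul]
    rw [Finset.sum_ite_mem, Finset.univ_inter, h3]
  · by_contra h
    simp [h] at hv

theorem mem_convexHull_of_weights {V : Type*} [Fintype V] {p : V → Fin 3 → ℝ} {w : V → ℝ}
    {s : Set V} (h0 : ∀ v, 0 ≤ w v) (h1 : ∑ v, w v = 1) (hs : ∀ v, w v ≠ 0 → v ∈ s) :
    ∑ v, w v • p v ∈ convexHull ℝ (p '' s) := by
  classical
  have h2 : ∑ v with w v ≠ 0, w v = 1 := by rw [Finset.sum_filter_ne_zero, h1]
  have h3 : ∑ v, w v • p v = ∑ v with w v ≠ 0, w v • p v := by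
    rw [Finset.sum_filter_of_ne]
    intro v _ hv h
    simp [h] at hv
  rw [h3]
  exact (convex_convexHull ℝ _).sum_mem (fun v _ => h0 v) h2 fun v hv =>
    subset_convexHull ℝ _ ⟨v, hs v (Finset.mem_filter.1 hv).2, rfl⟩

/-- The function `g` separates the face `S` from the face `T`, apart from common vertices. -/
def Separates {V : Type*} (g : V → ℤ) (S T : Finset V) : Prop :=
  (∀ v ∈ S, 0 ≤ g v ∧ (g v = 0 → v ∈ T)) ∧ ∀ v ∈ T, g v ≤ 0

instance {V : Type*} [DecidableEq V] (g : V → ℤ) (S T : Finset V) :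
    Decidable (Separates g S T) := by unfold Separates; infer_instance

theorem weights_eq {V : Type*} [Fintype V] {p : V → Fin 3 → ℝ} {T : Finset V}
    (hT : AffineIndependent ℝ fun v : T => p v) {w w' : V → ℝ} (h1 : ∑ v, w v = 1)
    (h1' : ∑ v, w' v = 1) (hs : ∀ v, w v ≠ 0 → v ∈ T) (hs' : ∀ v, w' v ≠ 0 → v ∈ T)
    (h : ∑ v, w v • p v = ∑ v, w' v • p v) : w = w' := by
  classical
  have hz : ∀ v, v ∉ T → w v = 0 ∧ w' v = 0 := fun v hv =>
    ⟨not_imp_comm.1 (hs v) hv, not_imp_comm.1 (hs' v) hv⟩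
  rw [affineIndependent_iff] at hT
  have key := hT Finset.univ (fun v => w v - w' v) ?_ ?_
  · funext v
    by_cases hv : v ∈ T
    · exact sub_eq_zero.1 (key ⟨v, hv⟩ (Finset.mem_univ _))
    · rw [(hz v hv).1, (hz v hv).2]
  · rw [Finset.univ_eq_attach, Finset.sum_attach T fun v => w v - w' v,
      Finset.sum_subset (Finset.subset_univ T), Finset.sum_sub_distrib, h1, h1', sub_self]
    intro v _ hv
    simp [hz v hv]
  · rw [Finset.univ_eq_attach, Finset.sum_attach T fun v => (w v - w' v) • p v,
      Finset.sum_subset (Finset.subset_univ T)]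
    · simp only [sub_smul, Finset.sum_sub_distrib, h, sub_self]
    · intro v _ hv
      simp [hz v hv]

theorem weights_mem_of_separates {V : Type*} [Fintype V] {p : V → Fin 3 → ℝ} {g : V → ℤ}
    {a : Fin 3 → ℝ} {c : ℝ} (hg : ∀ v, (g v : ℝ) = ∑ i, a i * p v i - c) {S T : Finset V}
    (hST : Separates g S T) {w w' : V → ℝ} (h0 : ∀ v, 0 ≤ w v) (h0' : ∀ v, 0 ≤ w' v)
    (h1 : ∑ v, w v = 1) (h1' : ∑ v, w' v = 1) (hs : ∀ v, w v ≠ 0 → v ∈ S)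
    (hs' : ∀ v, w' v ≠ 0 → v ∈ T) (h : ∑ v, w v • p v = ∑ v, w' v • p v) :
    ∀ v, w v ≠ 0 → v ∈ T := by
  have hval : ∀ u : V → ℝ, ∑ v, u v = 1 →
      ∑ v, u v * (g v : ℝ) = ∑ i, a i * (∑ v, u v • p v) i - c := by
    intro u hu
    simp only [hg, mul_sub, Finset.sum_sub_distrib, ← Finset.sum_mul, hu, one_mul,
      Finset.sum_apply, Pi.smul_apply, smul_eq_mul, Finset.mul_sum]
    rw [Finset.sum_comm]
    congr 1
    exact Finset.sum_congr rfl fun i _ => Finset.sum_congr rfl fun v _ => by ring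
  have e : ∑ v, w v * (g v : ℝ) = ∑ v, w' v * (g v : ℝ) := by rw [hval w h1, hval w' h1', h]
  have hnn : ∀ v, 0 ≤ w v * (g v : ℝ) := by
    intro v
    by_cases hv : w v = 0
    · simp [hv]
    · exact mul_nonneg (h0 v) (by exact_mod_cast (hST.1 v (hs v hv)).1)
  have hnp : ∀ v, w' v * (g v : ℝ) ≤ 0 := by
    intro v
    by_cases hv : w' v = 0
    · simp [hv]
    · exact mul_nonpos_of_nonneg_of_nonpos (h0' v) (by exact_mod_cast hST.2 v (hs' v hv))
  have hz : ∑ v, w v * (g v : ℝ) = 0 :=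
    le_antisymm (e ▸ Finset.sum_nonpos fun v _ => hnp v) (Finset.sum_nonneg fun v _ => hnn v)
  intro v hv
  have := (Finset.sum_eq_zero_iff_of_nonneg fun v _ => hnn v).1 hz v (Finset.mem_univ v)
  refine (hST.1 v (hs v hv)).2 ?_
  exact_mod_cast (mul_eq_zero.1 this).resolve_left hv

theorem isLinearRealization_ofFacets {V : Type*} [Fintype V] {L : List (Finset V)}
    {hL : ∀ v, ∃ t ∈ L, v ∈ t} {p : V → Fin 3 → ℝ} (hp : Function.Injective p)
    (hind : ∀ t ∈ L, AffineIndependent ℝ fun v : t => p v)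
    (hsep : ∀ S ∈ L, ∀ T ∈ L, S ≠ T → ∃ (g : V → ℤ) (a : Fin 3 → ℝ) (c : ℝ),
      (∀ v, (g v : ℝ) = ∑ i, a i * p v i - c) ∧ (Separates g S T ∨ Separates g T S)) :
    (ofFacets L hL).IsLinearRealization p := by
  refine ⟨hp, fun s hs => ?_, fun s hs t ht => Set.Subset.antisymm ?_ ?_⟩
  · obtain ⟨_, t, ht, hst⟩ := mem_ofFacets.1 hs
    exact (hind t ht).comp_embedding ⟨fun v : s => (⟨v, hst v.2⟩ : t), fun v w h =>
      Subtype.ext (Subtype.mk.inj h)⟩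
  · obtain ⟨_, S, hS, hsS⟩ := mem_ofFacets.1 hs
    obtain ⟨_, T, hT, htT⟩ := mem_ofFacets.1 ht
    rintro x ⟨hx, hx'⟩
    obtain ⟨w, w0, w1, rfl, ws⟩ := exists_weights hp hx
    obtain ⟨u, u0, u1, hwu, us⟩ := exists_weights hp hx'
    have key : w = u := by
      by_cases hST : S = T
      · exact weights_eq (hind T hT) w1 u1 (fun v hv => hST ▸ hsS (ws v hv))
          (fun v hv => htT (us v hv)) hwu.symm
      · obtain ⟨g, a, c, hg, h | h⟩ := hsep S hS T hT hST
        · exact weights_eq (hind T hT) w1 u1 (weights_mem_of_separates hg h w0 u0 w1 u1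
            (fun v hv => hsS (ws v hv)) (fun v hv => htT (us v hv)) hwu.symm)
            (fun v hv => htT (us v hv)) hwu.symm
        · exact weights_eq (hind S hS) w1 u1 (fun v hv => hsS (ws v hv))
            (weights_mem_of_separates hg h u0 w0 u1 w1 (fun v hv => htT (us v hv))
            (fun v hv => hsS (ws v hv)) hwu) hwu.symm
    exact mem_convexHull_of_weights w0 w1 fun v hv => ⟨ws v hv, us v (key ▸ hv)⟩
  · exact Set.subset_inter (convexHull_mono (Set.image_mono Set.inter_subset_left))
      (convexHull_mono (Set.image_mono Set.inter_subset_right))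

/-- Six times the oriented volume spanned by four integer points. -/
def volume (a b c d : Fin 3 → ℤ) : ℤ :=
  (b 0 - a 0) * ((c 1 - a 1) * (d 2 - a 2) - (c 2 - a 2) * (d 1 - a 1)) -
    (b 1 - a 1) * ((c 0 - a 0) * (d 2 - a 2) - (c 2 - a 2) * (d 0 - a 0)) +
    (b 2 - a 2) * ((c 0 - a 0) * (d 1 - a 1) - (c 1 - a 1) * (d 0 - a 0))

theorem not_coplanar_of_volume_ne_zero {a b c d : Fin 3 → ℤ} (h : volume a b c d ≠ 0)
    {p : (Fin 3 → ℤ) → Fin 3 → ℝ} (hp : ∀ q i, p q i = q i) :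
    ¬ Coplanar ℝ {p a, p b, p c, p d} := by
  intro hc
  rw [coplanar_iff_finrank_le_two] at hc
  let M : Matrix (Fin 3) (Fin 3) ℝ := Matrix.of ![p b - p a, p c - p a, p d - p a]
  have hM : IsUnit M := by
    rw [Matrix.isUnit_iff_isUnit_det, isUnit_iff_ne_zero]
    have : M.det = (volume a b c d : ℤ) := by
      rw [Matrix.det_fin_three]
      simp [M, hp, volume]
      ring
    rw [this]
    exact_mod_cast h
  have hli := Matrix.linearIndependent_rows_iff_isUnit.2 hM
  have hfr := finrank_span_eq_card hli
  have hsub : Submodule.span ℝ (Set.range M.row) ≤ vectorSpan ℝ {p a, p b, p c, p d} := by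
    rw [Submodule.span_le]
    rintro _ ⟨i, rfl⟩
    fin_cases i
    · exact vsub_mem_vectorSpan ℝ (p₁ := p b) (p₂ := p a) (by simp) (by simp)
    · exact vsub_mem_vectorSpan ℝ (p₁ := p c) (p₂ := p a) (by simp) (by simp)
    · exact vsub_mem_vectorSpan ℝ (p₁ := p d) (p₂ := p a) (by simp) (by simp)
  have := Submodule.finrank_mono hsub
  rw [hfr, Fintype.card_fin] at this
  omega

/-- Coordinates of general position realizations of the two tori. -/
def coordinates : Bool → Fin 8 → Fin 3 → ℤ
  | false => ![![1, 0, 0], ![0, 1, 0], ![2, 0, 3], ![0, 2, 0], ![2, 1, 1], ![0, 0, 3], ![1, 1, 2],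
      ![2, 2, 2]]
  | true => ![![2, 0, 3], ![2, 1, 1], ![1, 1, 2], ![1, 0, 0], ![2, 2, 2], ![0, 0, 3], ![0, 2, 0],
      ![0, 1, 0]]

/-- Planes separating the faces of the realizations, with normal vector and offset. -/
def separatingPlanes : Bool → List ((Fin 3 → ℤ) × ℤ)
  | false => [(![1, -6, -2], -6), (![1, 0, 1], 3), (![1, 0, -1], 0), (![2, -2, -1], -2), (![2, 1, -3], 2),
      (![0, 3, 1], 3), (![0, 0, 1], 0), (![0, 1, 2], 6), (![1, -3, 1], 0), (![2, -3, -2], -6),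
      (![5, -2, -4], -2), (![1, 1, -1], 2), (![1, 2, 1], 5), (![2, 0, -1], 0), (![3, 0, -1], 3),
      (![1, 2, 2], 6), (![1, -7, -3], -7)]
  | true => [(![1, -6, -2], -6), (![1, 0, 1], 3), (![1, 1, -1], 2), (![2, -2, -1], -2), (![2, 1, -3], 2),
      (![0, 0, 1], 0), (![0, 1, 0], 0), (![0, 1, 2], 6), (![1, 2, 1], 5), (![1, 2, -2], 2),
      (![2, -3, -2], -6), (![5, -2, -4], -2), (![1, 0, 0], 1), (![2, 0, -1], 0), (![1, -2, 0], -1),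
      (![1, 2, 2], 6)]

/-- The position of a vertex relative to a plane. -/
def height (b : Bool) (P : (Fin 3 → ℤ) × ℤ) (v : Fin 8) : ℤ :=
  P.1 0 * coordinates b v 0 + P.1 1 * coordinates b v 1 + P.1 2 * coordinates b v 2 - P.2

theorem separates_height : ∀ b, ∀ S ∈ facets b, ∀ T ∈ facets b, S ≠ T →
    ∃ P ∈ separatingPlanes b, (Separates (height b P) S T ∨ Separates (height b P) T S) ∨
      (Separates (fun v => - height b P v) S T ∨ Separates (fun v => - height b P v) T S) := by
  decide +kernel

theorem volume_coordinates_ne_zero : ∀ b, ∀ v w x y : Fin 8, v ≠ w → v ≠ x → v ≠ y → w ≠ x →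
    w ≠ y → x ≠ y →
    volume (coordinates b v) (coordinates b w) (coordinates b x) (coordinates b y) ≠ 0 := by
  decide +kernel

theorem torus_hasGeneralPositionRealization (b : Bool) :
    (torus b).HasGeneralPositionRealizationIn ![2, 2, 3] := by
  have hcop : ∀ v w x y : Fin 8, v ≠ w → v ≠ x → v ≠ y → w ≠ x → w ≠ y → x ≠ y →
      ¬ Coplanar ℝ {fun i => (coordinates b v i : ℝ), fun i => (coordinates b w i : ℝ),
        fun i => (coordinates b x i : ℝ), fun i => (coordinates b y i : ℝ)} :=
    fun v w x y h1 h2 h3 h4 h5 h6 =>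
      not_coplanar_of_volume_ne_zero (volume_coordinates_ne_zero b v w x y h1 h2 h3 h4 h5 h6)
        (p := fun q i => (q i : ℝ)) fun _ _ => rfl
  have hcol : ∀ v w x : Fin 8, v ≠ w → v ≠ x → w ≠ x →
      ¬ Collinear ℝ {fun i => (coordinates b v i : ℝ), fun i => (coordinates b w i : ℝ),
        fun i => (coordinates b x i : ℝ)} := by
    intro v w x h1 h2 h3 hc
    have : ∀ v w x : Fin 8, ∃ y, y ≠ v ∧ y ≠ w ∧ y ≠ x := by decide
    obtain ⟨y, y1, y2, y3⟩ := this v w x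
    refine hcop y v w x y1 y2 y3 h1 h2 h3 ?_
    rw [coplanar_iff_finrank_le_two]
    refine (finrank_vectorSpan_insert_le_set ℝ _ _).trans ?_
    have := collinear_iff_finrank_le_one.1 hc
    omega
  refine ⟨coordinates b, ?_, isLinearRealization_ofFacets ?_ (fun t ht => ?_)
    fun S hS T hT hST => ?_, hcol, hcop⟩
  · clear hcop hcol
    revert b
    decide +kernel
  · have : Function.Injective (coordinates b) := by
      clear hcop hcol
      revert b
      decide +kernel
    intro v w h
    refine this (funext fun i => ?_)
    exact Int.cast_injective (congrFun h i)
  · have hcard : t.card = 3 := by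
      have : ∀ b, ∀ t ∈ facets b, t.card = 3 := by decide +kernel
      exact this b t ht
    have e := (t.equivFinOfCardEq hcard).symm
    rw [← affineIndependent_equiv e]
    have : (fun v : t => fun i => (coordinates b v i : ℝ)) ∘ e =
        ![fun i => (coordinates b (e 0) i : ℝ), fun i => (coordinates b (e 1) i : ℝ),
          fun i => (coordinates b (e 2) i : ℝ)] := by
      funext k
      fin_cases k <;> rfl
    rw [this, affineIndependent_iff_not_collinear_set]
    have hne : ∀ i j : Fin 3, i ≠ j → (e i : Fin 8) ≠ e j := fun i j hij h =>
      hij (e.injective (Subtype.ext h))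
    exact hcol _ _ _ (hne _ _ (by decide)) (hne _ _ (by decide)) (hne _ _ (by decide))
  · obtain ⟨P, _, h | h⟩ := separates_height b S hS T hT hST
    · refine ⟨_, fun i => (P.1 i : ℝ), P.2, fun v => ?_, h⟩
      rw [Fin.sum_univ_three]
      simp [height]
    · refine ⟨_, fun i => (- P.1 i : ℝ), - P.2, fun v => ?_, h⟩
      rw [Fin.sum_univ_three]
      simp [height]
      ring

theorem not_isomorphic_torus : ¬ (torus false).Isomorphic (torus true) := by
  rintro ⟨e, he⟩
  have h0 : (Finset.univ.filter fun s : Finset (Fin 8) =>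
      s.card = 3 ∧ 0 ∈ s ∧ s ∈ torus false).card = 4 := by decide +kernel
  have h1 : ∀ v, 5 ≤ (Finset.univ.filter fun s : Finset (Fin 8) =>
      s.card = 3 ∧ v ∈ s ∧ s ∈ torus true).card := by decide +kernel
  have hle : (Finset.univ.filter fun s : Finset (Fin 8) => s.card = 3 ∧ e 0 ∈ s ∧ s ∈ torus true).card
      ≤ (Finset.univ.filter fun s : Finset (Fin 8) => s.card = 3 ∧ 0 ∈ s ∧ s ∈ torus false).card := by
    refine Finset.card_le_card_of_injOn (fun s => s.map e.symm.toEmbedding) (fun s hs => ?_)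
      fun s _ t _ h => Finset.map_injective _ h
    obtain ⟨_, h1, h2, h3⟩ := Finset.mem_filter.1 hs
    refine Finset.mem_coe.2 (Finset.mem_filter.2 ⟨Finset.mem_univ _, ?_, ?_, ?_⟩)
    · rw [Finset.card_map, h1]
    · exact Finset.mem_map.2 ⟨e 0, h2, by simp⟩
    · rw [he]
      have : (s.map e.symm.toEmbedding).map e.toEmbedding = s := by
        ext v; simp
      rwa [this]
  have := h1 (e 0)
  omega

/-- Every triangulated torus realizable in the cuboid is one of the two tori. -/
theorem isomorphic_torus {V : Type*} [Fintype V] [DecidableEq V] {K : AbstractSimplicialComplex V}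
    (hK : K.IsTriangulatedTorus) (hreal : K.HasGeneralPositionRealizationIn ![2, 2, 3]) :
    ∃ b, K.Isomorphic (torus b) := by
  have hne : Nonempty V := by
    obtain ⟨_, ⟨φ⟩⟩ := hK
    by_contra hV
    rw [not_nonempty_iff] at hV
    have := (φ.symm 1).2.1.2
    simp at this
  have hE : 3 * Fintype.card V ≤ (edgeFinset K).card := by
    classical
    refine hK.three_mul_card_le.trans ?_
    rw [edgeFinset, ← Fintype.card_subtype]
  obtain ⟨b, e, he⟩ := exists_equiv_facets hK.1 hE hreal
  have hsub : ∀ s ∈ K, ∃ x y z, K.Triangle x y z ∧ s ⊆ {x, y, z} := by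
    intro s hs
    have h3 := hK.1.1 s hs
    have h0 := (nonempty_of_mem hs).card_pos
    have hedge : ∀ x y, x ≠ y → {x, y} ∈ K → ∀ t ⊆ ({x, y} : Finset V),
        ∃ x y z, K.Triangle x y z ∧ t ⊆ {x, y, z} := by
      intro x y hxy h t ht
      obtain ⟨z, hz⟩ := hK.1.exists_triangle hxy h
      exact ⟨x, y, z, hz, ht.trans (by intro; simp; tauto)⟩
    interval_cases hcard : s.card
    · obtain ⟨x, rfl⟩ := Finset.card_eq_one.1 hcard
      obtain ⟨y, hxy, h⟩ := hK.1.exists_edge x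
      exact hedge x y hxy h _ (by simp)
    · obtain ⟨x, y, hxy, rfl⟩ := Finset.card_eq_two.1 hcard
      exact hedge x y hxy hs _ subset_rfl
    · obtain ⟨x, y, z, h1, h2, h3, rfl⟩ := Finset.card_eq_three.1 hcard
      exact ⟨x, y, z, ⟨h1, h3, h2.symm, hs⟩, subset_rfl⟩
  refine ⟨b, e, fun s => ⟨fun hs => ?_, fun hs => ?_⟩⟩
  · obtain ⟨x, y, z, h, hsub⟩ := hsub s hs
    refine mem_ofFacets.2 ⟨(nonempty_of_mem hs).map, _, (he x y z h.1 h.2.1 h.2.2.1).1 h.2.2.2, ?_⟩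
    refine (Finset.map_subset_map.2 hsub).trans ?_
    simp
  · obtain ⟨h0, t, ht, hst⟩ := mem_ofFacets.1 hs
    have hcard : ∀ b, ∀ t ∈ facets b, t.card = 3 := by decide +kernel
    obtain ⟨p, q, r, h1, h2, h3, rfl⟩ := Finset.card_eq_three.1 (hcard b t ht)
    have hmem := (he (e.symm p) (e.symm q) (e.symm r) (by simpa) (by simpa)
      (by simpa using h2.symm)).2 (by simpa)
    refine mem_of_subset hmem (fun v hv => ?_) (Finset.map_nonempty.1 h0)
    have := hst (Finset.mem_map_of_mem _ hv)
    simpa [Equiv.eq_symm_apply] using this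

end CuboidTorus

theorem mainTheorem5 :
    ∃ K₁ K₂ : AbstractSimplicialComplex (Fin 8),
      (K₁.IsTriangulatedTorus ∧ K₁.HasGeneralPositionRealizationIn ![2, 2, 3]) ∧
      (K₂.IsTriangulatedTorus ∧ K₂.HasGeneralPositionRealizationIn ![2, 2, 3]) ∧
      ¬ K₁.Isomorphic K₂ ∧
      ∀ (V : Type*) [Fintype V] [DecidableEq V] (K : AbstractSimplicialComplex V),
        K.IsTriangulatedTorus → K.HasGeneralPositionRealizationIn ![2, 2, 3] →
          K.Isomorphic K₁ ∨ K.Isomorphic K₂ := by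
  refine ⟨CuboidTorus.torus false, CuboidTorus.torus true,
    ⟨CuboidTorus.torus_isTriangulatedTorus _, CuboidTorus.torus_hasGeneralPositionRealization _⟩,
    ⟨CuboidTorus.torus_isTriangulatedTorus _, CuboidTorus.torus_hasGeneralPositionRealization _⟩,
    CuboidTorus.not_isomorphic_torus, fun V _ _ K hK hreal => ?_⟩
  obtain ⟨b, h⟩ := CuboidTorus.isomorphic_torus hK hreal
  cases b
  exacts [Or.inl h, Or.inr h]
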